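/- Notation. Write $e(x)=\exp(2\pi i x)$ and let $\mathbb{H}$ be the upper half plane. $\mathrm{Mp}_1(\mathbb{Z})$ is the group of pairs $(\gamma,\omega)$ with $\gamma=\begin{pmatrix}a&b\\c&d\end{pmatrix}\in\mathrm{SL}_2(\mathbb{Z})$ and $\omega$ a holomorphic square root of $c\tau+d$ on $\mathbb{H}$, with multiplication $(\gamma_1,\omega_1)(\gamma_2,\omega_2)=(\gamma_1\gamma_2,\ \omega_1\circ\gamma_2\cdot\omega_2)$; $\widetilde\Gamma_0(N)$ is the preimage of $\Gamma_0(N)$. For $k\in\frac12\mathbb{Z}$ and $m\in\mathbb{C}$ put $$(f|_k(\gamma,\omega))(\tau)=\omega(\tau)^{-2k}f(\gamma\tau),\qquad (\phi|_{k,m}(\gamma,\omega))(\tau,z)=\omega(\tau)^{-2k}\,e\Big(\frac{-mcz^2}{c\tau+d}\Big)\,\phi\Big(\gamma\tau,\frac{z}{c\tau+d}\Big).$$ Let $\chi_\theta$ and $\chi_\eta$ be the characters of $\widetilde\Gamma_0(4)$ and $\mathrm{Mp}_1(\mathbb{Z})$ with $\theta|_{1/2}g=\chi_\theta(g)\theta$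 and $\eta|_{1/2}g=\chi_\eta(g)\eta$, where $\theta(\tau)=\sum_{n\in\mathbb{Z}}e(n^2\tau)$ and $\eta$ is the Dedekind eta function. A Dirichlet character $\chi$ modulo $N$ is viewed as the character $(\gamma,\omega)\mapsto\chi(d)$ of $\widetilde\Gamma_0(N)$. Modular forms. A weakly holomorphic modular form of weight $k\in\frac12\mathbb{Z}$ for a finite index subgroup $\Gamma\subseteq\mathrm{Mp}_1(\mathbb{Z})$ and a character $\chi$ of $\Gamma$ is a holomorphic $f:\mathbb{H}\to\mathbb{C}$ with $f|_k g=\chi(g)f$ for all $g\in\Gamma$, such that for some $a\in\mathbb{R}$ one has $(f|_k g)(\tau)\ll\exp(a\,\mathrm{Im}\,\tau)$ as $\mathrm{Im}\,\tau\to\infty$ for all $g\in\mathrm{Mp}_1(\mathbb{Z})$. Its Fourier coefficients are denoted $c(f;n)$, $n\in\mathbb{Q}$: $f(\tau)=\sum_n c(f;n)e(n\tau)$, with $c(f;n)=0$ for sufficiently small $n$. Jacobi forms. Let $\chi$ be a character of $\Gamma$, extended trivially to the integral Heisenberg group. A weakly holomorphic Jacobi form of weight $k$ and index $m$ for $\Gamma$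 and $\chi$ with possible singularities at $\mathbb{Z}+\tau\mathbb{Z}$ is a meromorphic function $\phi$ on $\mathbb{H}\times\mathbb{C}$, regular outside of the locus $z\in\mathbb{Z}+\tau\mathbb{Z}$, such that (i) $\phi|_{k,m}g=\chi(g)\phi$ for all $g\in\Gamma$; (ii) $e(m(\lambda^2\tau+2\lambda z+\kappa))\,\phi(\tau,z+\lambda\tau+\mu)=\phi(\tau,z)$ for all $\lambda,\mu,\kappa\in\mathbb{Z}$; (iii) for all $g\in\mathrm{Mp}_1(\mathbb{Z})$ and all $\lambda,\mu\in\mathbb{Q}$ such that $\phi|_{k,m}g$ is regular at $z=\lambda\tau+\mu$, there is $a\in\mathbb{R}$ with $(\phi|_{k,m}g)(\tau,\lambda\tau+\mu)\ll\exp(a\,\mathrm{Im}\,\tau)$ as $\mathrm{Im}\,\tau\to\infty$. Its Fourier expansion is $\phi(\tau,z)=\sum_{n,r\in\mathbb{Q}}c(\phi;n,r)e(n\tau+rz)$, valid for positive and sufficiently small $\mathrm{Im}(z)/\mathrm{Im}(\tau)$, with $c(\phi;n,r)=0$ for sufficiently small $n$. We say that $\phi$ specializes to $f$ if $f\neq0$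 is the leading coefficient of the Laurent expansion of $\phi$ around $z=0$ in powers of $2\pi i z$. If $-\nu$ is the order of $\phi$ at $z=0$, put $$\tilde c(\phi;n;z)=\big(e(\tfrac z2)-e(-\tfrac z2)\big)^{\nu}\sum_{r\in\mathbb{Q}}c(\phi;n,r)\,e(rz).$$ Explained congruences. Let $\ell$ be a prime. A complex number $x$ is called $\ell$-integral if $sx$ is an algebraic integer for some integer $s$ prime to $\ell$. The form $f$ has a Ramanujan-type congruence modulo $\ell$ on $M\mathbb{Z}+\beta$ ($M$ a positive integer, $\beta\in\mathbb{Q}$) if for every $n\in M\mathbb{Z}+\beta$ the coefficient $c(f;n)$ is $\ell$ times an $\ell$-integral number. It is explained by $\phi$ if $\phi$ specializes to $f$, the coefficients $c(\phi;n,r)$ lie in a number field and are $\ell$-integral, and for all $n\in M\mathbb{Z}+\beta$ the function $\tilde c(\phi;n;z)$ is a Laurent polynomial in $e(z/D)$ for some positive integer $D$ that is divisible, in the ring of such Laurent polynomials, by the $\ell$-th cyclotomic polynomial in $e(z)$. Statement. Let $f$ be a weakly holomorphic modular form of some weight in $\frac12\mathbb{Z}$ for some finite index subgroup of $\mathrm{Mp}_1(\mathbb{Z})$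 and some character of it, and let $\ell$ be a prime. Consider the set of all arithmetic progressions $M\mathbb{Z}+\beta$ with $M\in\mathbb{Z}_{\ge1}$ and $\beta\in\mathbb{Q}$ on which $f$ has a Ramanujan-type congruence modulo $\ell$ that is explained by some weakly holomorphic Jacobi form $\phi$ with possible singularities at $\mathbb{Z}+\tau\mathbb{Z}$, of some weight in $\frac12\mathbb{Z}$ and some index, for $\widetilde\Gamma_0(N)$ and the character $\chi\chi_\theta$ (with $4\mid N$) or $\chi\chi_\eta$, for some $N\ge1$ and some Dirichlet character $\chi$ modulo $N$. Then every element $M\mathbb{Z}+\beta$ of this set that is maximal with respect to inclusion satisfies $$\mathrm{ord}_p(M)\le\max\{0,\ \mathrm{ord}_p(\beta)+1\}\ \text{ for all odd primes } p,\qquad \mathrm{ord}_2(M)\le\max\{0,\ \mathrm{ord}_2(\beta)+3\},$$ where $\mathrm{ord}_p(0)=\infty$. -/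

import Mathlib

open UpperHalfPlane hiding I
open Complex Filter Topology
open scoped MatrixGroups Manifold LaurentPolynomial Real

namespace ExplainableRC

/-- `e(x) = exp(2πix)`. -/
noncomputable def e (x : ℂ) : ℂ := Complex.exp (2 * π * Complex.I * x)

/-! ### The metaplectic group over the integers -/

/-- The integral metaplectic group: pairs `(γ, ω)` of a matrix `γ ∈ SL₂(ℤ)` with lower row `(c, d)`
and a holomorphic function `ω` on the upper half plane with `ω(τ)² = cτ + d`. -/
@[ext]
structure Mp1Z where
  /-- the matrix `γ` -/
  mat : SL(2, ℤ)
  /-- the square root `ω` -/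
  root : ℍ → ℂ
  holo : MDifferentiable 𝓘(ℂ) 𝓘(ℂ) root
  sq : ∀ τ : ℍ, root τ ^ 2 = ((mat 1 0 : ℤ) : ℂ) * τ + ((mat 1 1 : ℤ) : ℂ)

namespace Mp1Z

theorem denom_eq (g : SL(2, ℤ)) (τ : ℍ) :
    ((g 1 0 : ℤ) : ℂ) * τ + ((g 1 1 : ℤ) : ℂ) = denom (g : GL (Fin 2) ℝ) τ := by
  simp [denom]

theorem cocycle (g h : SL(2, ℤ)) (τ : ℍ) :
    denom ((g * h : SL(2, ℤ)) : GL (Fin 2) ℝ) τ =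
      denom (g : GL (Fin 2) ℝ) ((h • τ : ℍ) : ℂ) * denom (h : GL (Fin 2) ℝ) τ := by
  have := denom_cocycle_σ (g : GL (Fin 2) ℝ) (h : GL (Fin 2) ℝ) τ
  simpa [UpperHalfPlane.σ, ← map_mul] using this

theorem mdiff_smul (g : SL(2, ℤ)) :
    MDifferentiable 𝓘(ℂ) 𝓘(ℂ) (fun τ : ℍ => g • τ) :=
  mdifferentiable_smul (g := (g : GL (Fin 2) ℝ)) (by simp)

theorem root_ne_zero (g : Mp1Z) (τ : ℍ) : g.root τ ≠ 0 := by
  intro h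
  have h2 := g.sq τ
  rw [denom_eq, h] at h2
  exact denom_ne_zero (g.mat : GL (Fin 2) ℝ) τ (by simpa using h2.symm)

/-- `(γ₁, ω₁)(γ₂, ω₂) = (γ₁γ₂, ω₁ ∘ γ₂ · ω₂)`. -/
noncomputable instance : Mul Mp1Z where
  mul g h :=
    { mat := g.mat * h.mat
      root := fun τ => g.root (h.mat • τ) * h.root τ
      holo := (g.holo.comp (mdiff_smul h.mat)).mul h.holo
      sq := fun τ => by
        rw [mul_pow, g.sq, h.sq, denom_eq, denom_eq, denom_eq, cocycle] }

noncomputable instance : One Mp1Z where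
  one :=
    { mat := 1
      root := fun _ => 1
      holo := mdifferentiable_const
      sq := fun τ => by simp }

noncomputable instance : Inv Mp1Z where
  inv g :=
    { mat := g.mat⁻¹
      root := fun τ => (g.root (g.mat⁻¹ • τ))⁻¹
      holo := by
        intro τ
        rw [mdifferentiableAt_iff]
        have h := mdifferentiableAt_iff.1 ((g.holo.comp (mdiff_smul g.mat⁻¹)) τ)
        exact h.inv (root_ne_zero g _)
      sq := fun τ => by
        have h := cocycle g.mat g.mat⁻¹ τ
        rw [mul_inv_cancel] at h
        rw [inv_pow, g.sq, denom_eq, denom_eq]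
        have h1 : denom ((1 : SL(2, ℤ)) : GL (Fin 2) ℝ) τ = 1 := by simp [denom]
        rw [h1] at h
        exact inv_eq_of_mul_eq_one_right h.symm }

@[simp] theorem mul_mat (g h : Mp1Z) : (g * h).mat = g.mat * h.mat := rfl

@[simp] theorem mul_root (g h : Mp1Z) (τ : ℍ) :
    (g * h).root τ = g.root (h.mat • τ) * h.root τ := rfl

@[simp] theorem one_mat : (1 : Mp1Z).mat = 1 := rfl

@[simp] theorem one_root (τ : ℍ) : (1 : Mp1Z).root τ = 1 := rfl

@[simp] theorem inv_mat (g : Mp1Z) : (g⁻¹).mat = g.mat⁻¹ := rfl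

@[simp] theorem inv_root (g : Mp1Z) (τ : ℍ) :
    (g⁻¹).root τ = (g.root (g.mat⁻¹ • τ))⁻¹ := rfl

noncomputable instance : Group Mp1Z :=
  Group.ofLeftAxioms
    (fun g h k => Mp1Z.ext (by simp [mul_assoc])
      (funext fun τ => by simp [mul_smul, mul_assoc]))
    (fun g => Mp1Z.ext (by simp) (funext fun τ => by simp))
    (fun g => Mp1Z.ext (by simp) (funext fun τ => by simp [root_ne_zero]))

/-- The projection to `SL₂(ℤ)`. -/
noncomputable def proj : Mp1Z →* SL(2, ℤ) where
  toFun := mat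
  map_one' := rfl
  map_mul' _ _ := rfl

end Mp1Z

/-- The preimage in the metaplectic group of the congruence subgroup `Γ₀(N)`. -/
noncomputable def Gamma0Tilde (N : ℕ) : Subgroup Mp1Z := (CongruenceSubgroup.Gamma0 N).comap Mp1Z.proj

/-! ### Modular forms

Half-integral weights `k` are encoded by the integer `w = 2k`. -/

/-- The slash action of weight `k = w / 2`: `(f|ₖ(γ,ω))(τ) = ω(τ)^{-2k} f(γτ)`. -/
noncomputable def slash (w : ℤ) (f : ℍ → ℂ) (g : Mp1Z) (τ : ℍ) : ℂ :=
  g.root τ ^ (-w) * f (g.mat • τ)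

/-- At most exponential growth in `Im τ` as `Im τ → ∞`, with exponent `a`. -/
def GrowthAtMost (a : ℝ) (f : ℍ → ℂ) : Prop :=
  f =O[atImInfty] fun τ : ℍ => Real.exp (a * τ.im)

/-- Weakly holomorphic modular forms of weight `w / 2` for the group `Γ` and its character `χ`. -/
structure IsWeaklyHolomorphicModularForm (w : ℤ) (Γ : Subgroup Mp1Z) (χ : Γ →* ℂˣ)
    (f : ℍ → ℂ) : Prop where
  holo : MDifferentiable 𝓘(ℂ) 𝓘(ℂ) f
  slash_eq : ∀ (g : Γ) (τ : ℍ), slash w f g τ = (χ g : ℂ) * f τ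
  growth : ∃ a : ℝ, ∀ g : Mp1Z, GrowthAtMost a (slash w f g)

/-- The theta function `θ(τ) = ∑ₙ e(n²τ)`. -/
noncomputable def theta (τ : ℍ) : ℂ := jacobiTheta (2 * (τ : ℂ))

/-- The Dedekind eta function. -/
noncomputable def eta (τ : ℍ) : ℂ := ModularForm.eta (τ : ℂ)

/-- The character of the preimage of `Γ₀(4)` associated with the theta function, that is,
the factor `χ_θ` in `θ|_{1/2}(γ,ω) = χ_θ(γ,ω) θ`, read off at the point `τ = i`. -/
noncomputable def thetaChar (g : Mp1Z) : ℂ :=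
  slash 1 theta g UpperHalfPlane.I / theta UpperHalfPlane.I

/-- The character of the metaplectic group associated with the Dedekind eta function, that is,
the factor `χ_η` in `η|_{1/2}(γ,ω) = χ_η(γ,ω) η`, read off at the point `τ = i`. -/
noncomputable def etaChar (g : Mp1Z) : ℂ :=
  slash 1 eta g UpperHalfPlane.I / eta UpperHalfPlane.I

/-- A Dirichlet character modulo `N` as a function of `(γ,ω)`: its value at the lower right entry
of `γ`. -/
noncomputable def dirichletChar {N : ℕ} (χ : DirichletCharacter ℂ N) (g : Mp1Z) : ℂ :=
  χ ((g.mat 1 1 : ℤ) : ZMod N)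

/-- `c : ℚ → ℂ` is the family of Fourier coefficients of `f`, that is,
`f(τ) = ∑ₙ c(n) e(nτ)` with `c(n) = 0` for all sufficiently small `n`. -/
def IsFourierExpansion (f : ℍ → ℂ) (c : ℚ → ℂ) : Prop :=
  (∃ n₀ : ℚ, ∀ n < n₀, c n = 0) ∧
    ∀ τ : ℍ, HasSum (fun n : ℚ => c n * e (n * τ)) (f τ)

/-! ### Jacobi forms -/

/-- The Jacobi slash action of weight `k = w / 2` and index `m` of the metaplectic group:
`(φ|(γ,ω))(τ,z) = ω(τ)^{-2k} e(-mcz²/(cτ+d)) φ(γτ, z/(cτ+d))`. -/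
noncomputable def jacobiSlash (w : ℤ) (m : ℂ) (φ : ℍ → ℂ → ℂ) (g : Mp1Z) (τ : ℍ) (z : ℂ) : ℂ :=
  g.root τ ^ (-w) *
    e (m * (-((g.mat 1 0 : ℤ) : ℂ) * z ^ 2 /
      (((g.mat 1 0 : ℤ) : ℂ) * τ + ((g.mat 1 1 : ℤ) : ℂ)))) *
    φ (g.mat • τ) (z / (((g.mat 1 0 : ℤ) : ℂ) * τ + ((g.mat 1 1 : ℤ) : ℂ)))

/-- The slash action of index `m` of an element `(lam, mu, κ)` of the Heisenberg group. -/
noncomputable def heisenbergSlash (m : ℂ) (φ : ℍ → ℂ → ℂ) (lam mu κ : ℤ) (τ : ℍ) (z : ℂ) : ℂ :=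
  e (m * ((lam : ℂ) ^ 2 * τ + 2 * lam * z + κ)) * φ τ (z + lam * τ + mu)

/-- The lattice `ℤ + τℤ`. -/
def latticePoints (τ : ℂ) : Set ℂ := {z | ∃ a b : ℤ, z = a * τ + b}

/-- `φ` is a meromorphic function on `ℍ × ℂ`, regular outside of the locus `z ∈ ℤ + τℤ`.
The values of `φ` on this locus carry no meaning and are disregarded throughout. -/
structure IsMeromorphicAwayFromLattice (φ : ℍ → ℂ → ℂ) : Prop where
  holo : DifferentiableOn ℂ (fun p : ℂ × ℂ => φ (ofComplex p.1) p.2)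
    {p | 0 < p.1.im ∧ p.2 ∉ latticePoints p.1}
  mero : ∀ (τ : ℍ) (lam mu : ℤ), ∃ (j : ℕ) (g : ℂ × ℂ → ℂ),
    AnalyticAt ℂ g ((τ : ℂ), lam * τ + mu) ∧
    ∀ᶠ p : ℂ × ℂ in 𝓝 ((τ : ℂ), lam * τ + mu), p.2 ≠ lam * p.1 + mu →
      (p.2 - (lam * p.1 + mu)) ^ j * φ (ofComplex p.1) p.2 = g p

/-- Weakly holomorphic Jacobi forms of weight `w / 2` and index `m` with possible singularities
at `ℤ + τℤ`, for the character of `Γ ⋉ H(ℤ)` given by the function `χ` on `Γ` and trivial on the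
Heisenberg group `H(ℤ)`.

In `growth`, the function `h` is the restriction of `φ|(γ,ω)` to the torsion point
`z = lam τ + mu`; it is required to be the limit from nearby points, so that the condition is
imposed for all those torsion points at which `φ|(γ,ω)` is regular, and only for those. -/
structure IsWeaklyHolomorphicJacobiForm (w : ℤ) (m : ℂ) (Γ : Subgroup Mp1Z) (χ : Mp1Z → ℂ)
    (φ : ℍ → ℂ → ℂ) : Prop where
  mero : IsMeromorphicAwayFromLattice φ
  slash_eq : ∀ g ∈ Γ, ∀ (τ : ℍ) (z : ℂ), z ∉ latticePoints τ →
    jacobiSlash w m φ g τ z = χ g * φ τ z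
  heisenberg_eq : ∀ (lam mu κ : ℤ) (τ : ℍ) (z : ℂ), z ∉ latticePoints τ →
    heisenbergSlash m φ lam mu κ τ z = φ τ z
  growth : ∀ (g : Mp1Z) (lam mu : ℚ) (h : ℍ → ℂ),
    (∀ τ : ℍ, Tendsto (jacobiSlash w m φ g τ) (𝓝[≠] ((lam : ℂ) * τ + mu)) (𝓝 (h τ))) →
    ∃ a : ℝ, GrowthAtMost a h

/-- The order of `φ` at `z = 0` is `-ν`, and the leading term of the Laurent expansion of `φ`
around `z = 0`, in powers of `2πiz`, is `f`. -/
def SpecializesTo (φ : ℍ → ℂ → ℂ) (ν : ℤ) (f : ℍ → ℂ) : Prop :=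
  f ≠ 0 ∧ ∀ τ : ℍ,
    Tendsto (fun z : ℂ => (2 * π * Complex.I * z) ^ ν * φ τ z) (𝓝[≠] 0) (𝓝 (f τ))

/-- `c n r` are the Fourier coefficients of `φ`, that is,
`φ(τ,z) = ∑_{n,r} c(n,r) e(nτ + rz)` for positive and sufficiently small `Im z / Im τ`,
with `c(n,r) = 0` for all sufficiently small `n`. -/
def IsJacobiFourierExpansion (φ : ℍ → ℂ → ℂ) (c : ℚ → ℚ → ℂ) : Prop :=
  (∃ n₀ : ℚ, ∀ n < n₀, ∀ r, c n r = 0) ∧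
    ∃ ε > (0 : ℝ), ∀ (τ : ℍ) (z : ℂ), 0 < z.im → z.im < ε * τ.im →
      HasSum (fun p : ℚ × ℚ => c p.1 p.2 * e (p.1 * τ + p.2 * z)) (φ τ z)

/-- The leading Fourier coefficient `(e(z/2) - e(-z/2))^ν ∑ᵣ c(n,r) e(rz)`, for `Im z > 0`,
of a Jacobi form with Fourier coefficients `c` and order `-ν` at `z = 0`. -/
noncomputable def leadingCoeff (c : ℚ → ℚ → ℂ) (ν : ℤ) (n : ℚ) (z : ℂ) : ℂ :=
  (e (z / 2) - e (-z / 2)) ^ ν * ∑' r : ℚ, c n r * e (r * z)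

/-- The value of a Laurent polynomial at `e(x)`. -/
noncomputable def laurentEval (P : ℂ[T;T⁻¹]) (x : ℂ) : ℂ :=
  LaurentPolynomial.eval₂ (RingHom.id ℂ) (Units.mk0 (e x) (Complex.exp_ne_zero _)) P

/-- The function `F`, given for `Im z > 0`, is a Laurent polynomial in `e(z/D)` for some positive
integer `D`, and in the ring of these Laurent polynomials it is divisible by the `ℓ`-th cyclotomic
polynomial in `e(z)`. (Divisibility does not depend on the choice of `D`.) -/
def CyclotomicDvd (ℓ : ℕ) (F : ℂ → ℂ) : Prop :=
  ∃ (D : ℕ) (P : ℂ[T;T⁻¹]), 0 < D ∧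
    (∀ z : ℂ, 0 < z.im → F z = laurentEval P (z / D)) ∧
    Polynomial.aeval (LaurentPolynomial.T (D : ℤ) : ℂ[T;T⁻¹]) (Polynomial.cyclotomic ℓ ℂ) ∣ P

/-! ### Ramanujan-type congruences -/

/-- `s * x` is an algebraic integer for some integer `s` prime to the prime `ℓ`. For `x` in a number
field `K`, this says that `x` lies in the localization of the ring of integers of `K` at `ℓ`. -/
def IsEllIntegral (ℓ : ℕ) (x : ℂ) : Prop :=
  ∃ s : ℤ, ¬ (ℓ : ℤ) ∣ s ∧ IsIntegral ℤ ((s : ℂ) * x)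

/-- The arithmetic progression `Mℤ + β`. -/
def arithProg (M : ℕ) (β : ℚ) : Set ℚ := {n | ∃ t : ℤ, n = M * t + β}

/-- `f` has a Ramanujan-type congruence modulo `ℓ` on `Mℤ + β`:
all Fourier coefficients with index in `Mℤ + β` are `ℓ` times an `ℓ`-integral number. -/
def HasRamanujanCongruence (f : ℍ → ℂ) (ℓ M : ℕ) (β : ℚ) : Prop :=
  ∃ c : ℚ → ℂ, IsFourierExpansion f c ∧
    ∀ n ∈ arithProg M β, ∃ x : ℂ, IsEllIntegral ℓ x ∧ c n = ℓ * x

/-- The Fourier coefficients `c` lie in a number field and are `ℓ`-integral. -/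
def HasEllIntegralCoeffs (ℓ : ℕ) (c : ℚ → ℚ → ℂ) : Prop :=
  ∃ K : IntermediateField ℚ ℂ, FiniteDimensional ℚ K ∧
    ∀ n r : ℚ, c n r ∈ K ∧ IsEllIntegral ℓ (c n r)

/-- `φ` explains the Ramanujan-type congruence modulo `ℓ` of `f` on `Mℤ + β`. -/
def Explains (φ : ℍ → ℂ → ℂ) (f : ℍ → ℂ) (ℓ M : ℕ) (β : ℚ) : Prop :=
  ∃ (ν : ℤ) (c : ℚ → ℚ → ℂ), SpecializesTo φ ν f ∧ IsJacobiFourierExpansion φ c ∧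
    HasEllIntegralCoeffs ℓ c ∧
    ∀ n ∈ arithProg M β, CyclotomicDvd ℓ (leadingCoeff c ν n)

/-- `φ` is a weakly holomorphic Jacobi form (of some weight and index) with possible singularities
at `ℤ + τℤ` for the preimage of some `Γ₀(N)` and character `χ χ_θ` (where `4 ∣ N`, as `χ_θ` is a
character of the preimage of `Γ₀(4)`) or `χ χ_η`, with `χ` a Dirichlet character modulo `N`. -/
def IsAdmissibleJacobiForm (φ : ℍ → ℂ → ℂ) : Prop :=
  ∃ (w : ℤ) (m : ℂ) (N : ℕ) (χ : DirichletCharacter ℂ N), 0 < N ∧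
    ((4 ∣ N ∧ IsWeaklyHolomorphicJacobiForm w m (Gamma0Tilde N)
        (fun g => dirichletChar χ g * thetaChar g) φ) ∨
      IsWeaklyHolomorphicJacobiForm w m (Gamma0Tilde N)
        (fun g => dirichletChar χ g * etaChar g) φ)

/-- The set of arithmetic progressions `Mℤ + β` on which `f` has a Ramanujan-type congruence
modulo `ℓ` explained by some `φ`. -/
def explainableProgressions (f : ℍ → ℂ) (ℓ : ℕ) : Set (Set ℚ) :=
  {A | ∃ (M : ℕ) (β : ℚ), 0 < M ∧ A = arithProg M β ∧ HasRamanujanCongruence f ℓ M β ∧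
    ∃ φ : ℍ → ℂ → ℂ, IsAdmissibleJacobiForm φ ∧ Explains φ f ℓ M β}

/-- The order of a rational number at the prime `p`, with `ord_p(0) = ∞`. -/
noncomputable def ordAt (p : ℕ) (x : ℚ) : WithTop ℤ :=
  if x = 0 then ⊤ else (padicValRat p x : ℤ)

end ExplainableRC

open ExplainableRC

/-!
Congruences that are explained by a Jacobi form propagate along multiplication by squares.

Let `φ` explain the congruence of `f` on `Mℤ + β`, and let `-ν` be its order at `z = 0`. The
function `(e(z) - 1)^ν φ(τ, z)` is regular at `z = 0` with value `f(τ)`, and its Fourier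
expansion, unlike that of `φ`, is valid for all real `z`: shifting a contour across the real line
shows that its coefficients inherit the parity of `φ`, and together with the elliptic
transformation law this leaves only finitely many nonzero coefficients for each power of `e(τ)`
(`ExpandsOn.regCoeff_symm`, `ExpandsOn.finite_support_regCoeff`, `ExpandsOn.hasSum_regSlice`).
Hence the coefficient of `e(nτ)` is a trigonometric polynomial in `z`, which up to a power of
`e(z/2)` is the leading coefficient `c̃(φ; n; z)`. It is divisible by the `ℓ`-th cyclotomic
polynomial exactly if it vanishes at all `z = j/ℓ` with `ℓ ∤ j`. In that case its value at
`z = 0`, which is the coefficient `c(f; n)`, is `ℓ` times an `ℓ`-integral number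
(`exists_ellIntegral_of_trigSum_eq_zero`), so it is enough to study the torsion values
`φ(τ, j/ℓ)`.

For `g` in a deep congruence subgroup, with lower right entry `d`, these values transform by
`φ(gτ, j/ℓ) = ω(τ)^{2k} χ(g) φ(τ, dj/ℓ)`. The vanishing of the coefficients on `Mℤ + β` is a
linear relation between the translates of the torsion values by multiples `λ/M`. Applying it at
`gτ` and using that `t_{λ/M} g t_{-d²λ/M}` is again integral, where `t_x` is translation by `x`,
one obtains the corresponding relation for translates by `d²λ/M`, that is, the vanishing of all
coefficients with `d²n ∈ Mℤ + β` (`coeff_torsion_eq_zero`). This requires that `χ` takes the same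
value at `g` and at `t_{λ/M} g t_{-d²λ/M}`. For the multipliers of `θ` and `η` this follows from
the transformation law of theta series with periodic coefficients, the eta function being such a
series by the pentagonal number theorem (`theta_shift`, `eta_shift`, `multiplier_eq_of_shift`).

Finally, if `M` violates the bound at the prime `p`, then every element of `(M/p)ℤ + β` is carried
into `Mℤ + β` by the square of some `d` prime to any given integer
(`exists_sq_mul_mem_arithProg`). Thus `φ` explains a congruence on the larger progression
`(M/p)ℤ + β`, and `Mℤ + β` is not maximal.
-/

namespace ExplainableRC

/-! ### The exponential and uniqueness of expansions -/

theorem e_add (x y : ℂ) : e (x + y) = e x * e y := by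
  rw [e, e, e, ← Complex.exp_add, mul_add]

@[simp] theorem e_zero : e 0 = 1 := by simp [e]

theorem e_ne_zero (x : ℂ) : e x ≠ 0 := Complex.exp_ne_zero _

theorem e_neg (x : ℂ) : e (-x) = (e x)⁻¹ := by
  rw [e, e, ← Complex.exp_neg, mul_neg]

theorem e_sub (x y : ℂ) : e (x - y) = e x / e y := by
  rw [sub_eq_add_neg, e_add, e_neg, div_eq_mul_inv]

theorem e_int_mul (n : ℤ) (x : ℂ) : e (n * x) = e x ^ n := by
  rw [e, e, ← Complex.exp_int_mul]
  ring_nf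

theorem e_nat_mul (n : ℕ) (x : ℂ) : e (n * x) = e x ^ n := by
  exact_mod_cast e_int_mul n x

theorem e_eq_one_iff (x : ℂ) : e x = 1 ↔ ∃ n : ℤ, x = n := by
  rw [e, Complex.exp_eq_one_iff]
  have h : (2 * π * Complex.I : ℂ) ≠ 0 := by simp
  refine exists_congr fun n => ⟨fun hn => ?_, fun hn => by rw [hn]; ring⟩
  refine mul_left_cancel₀ h ?_
  rw [hn]
  ring

@[simp] theorem e_int (n : ℤ) : e n = 1 := (e_eq_one_iff _).2 ⟨n, rfl⟩

@[simp] theorem e_one : e 1 = 1 := by simpa using e_int 1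

@[simp] theorem e_add_int (x : ℂ) (n : ℤ) : e (x + n) = e x := by simp [e_add]

theorem norm_e (x : ℂ) : ‖e x‖ = Real.exp (-2 * π * x.im) := by
  rw [e, Complex.norm_exp]
  congr 1
  simp

theorem norm_e_of_im_eq_zero {x : ℂ} (hx : x.im = 0) : ‖e x‖ = 1 := by simp [norm_e, hx]

@[fun_prop] theorem continuous_e : Continuous e := by
  unfold e
  fun_prop

@[fun_prop] theorem differentiable_e : Differentiable ℂ e := by
  unfold e
  fun_prop

theorem norm_e_lt_one {z : ℂ} (hz : 0 < z.im) : ‖e z‖ < 1 := by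
  rw [norm_e, Real.exp_lt_one_iff]
  have := mul_pos Real.pi_pos hz
  linarith

theorem e_eq_one_iff_of_re {x : ℝ} : e x = 1 ↔ ∃ n : ℤ, x = n := by
  rw [e_eq_one_iff]
  exact exists_congr fun n => by exact_mod_cast Iff.rfl

/-- The Cesàro means of the powers of `x` on the unit circle detect whether `x = 1`. -/
theorem tendsto_mean_pow (x : ℂ) (hx : ‖x‖ = 1) :
    Tendsto (fun K : ℕ => (K : ℂ)⁻¹ * ∑ k ∈ Finset.range K, x ^ k) atTop
      (𝓝 (if x = 1 then 1 else 0)) := by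
  split_ifs with h
  · refine tendsto_const_nhds.congr' ?_
    filter_upwards [eventually_gt_atTop 0] with K hK
    have : (K : ℂ) ≠ 0 := by exact_mod_cast hK.ne'
    simp [h, this]
  · have h1 : Tendsto (fun K : ℕ => (K : ℝ)⁻¹ * (2 / ‖x - 1‖)) atTop (𝓝 0) := by
      simpa using tendsto_natCast_atTop_atTop.inv_tendsto_atTop.mul_const (2 / ‖x - 1‖)
    refine squeeze_zero_norm (fun K => ?_) h1
    rw [geom_sum_eq h, norm_mul, norm_inv, Complex.norm_natCast, norm_div]
    gcongr
    calc ‖x ^ K - 1‖ ≤ ‖x ^ K‖ + ‖(1 : ℂ)‖ := norm_sub_le _ _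
      _ = 2 := by rw [norm_pow, hx]; norm_num

/-- Absolutely summable coefficients are determined by the power moments at distinct points of the
unit circle: averaging the moments isolates one coefficient. -/
theorem eq_zero_of_tsum_mul_pow_eq_zero {ι : Type*} (ξ : ι → ℂ) (hξ : Function.Injective ξ)
    (h1 : ∀ i, ‖ξ i‖ = 1) (b : ι → ℂ) (hb : Summable fun i => ‖b i‖)
    (h : ∀ k : ℕ, ∑' i, b i * ξ i ^ k = 0) (i₀ : ι) : b i₀ = 0 := by
  have hne : ∀ i, ξ i ≠ 0 := fun i hi => by simpa [hi] using h1 i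
  have hq : ∀ i, ‖ξ i / ξ i₀‖ = 1 := fun i => by simp [h1]
  have hsum : ∀ k : ℕ, Summable fun i => b i * (ξ i / ξ i₀) ^ k := fun k => by
    refine Summable.of_norm ?_
    simpa only [norm_mul, norm_pow, hq, one_pow, mul_one] using hb
  have hmom : ∀ k : ℕ, ∑' i, b i * (ξ i / ξ i₀) ^ k = 0 := fun k => by
    have : ∀ i, b i * (ξ i / ξ i₀) ^ k = b i * ξ i ^ k * (ξ i₀ ^ k)⁻¹ := fun i => by
      rw [div_pow]; ring
    simp_rw [this, tsum_mul_right, h k, zero_mul]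
  have hlim : Tendsto (fun K : ℕ => ∑' i, b i * ((K : ℂ)⁻¹ * ∑ k ∈ Finset.range K,
      (ξ i / ξ i₀) ^ k)) atTop (𝓝 (∑' i, b i * (if ξ i / ξ i₀ = 1 then 1 else 0))) := by
    refine tendsto_tsum_of_dominated_convergence hb
      (fun i => (tendsto_mean_pow _ (hq i)).const_mul _) ?_
    refine Eventually.of_forall fun K i => ?_
    rw [norm_mul]
    refine mul_le_of_le_one_right (norm_nonneg _) ?_
    rw [norm_mul, norm_inv, Complex.norm_natCast]
    rcases Nat.eq_zero_or_pos K with rfl | hK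
    · simp
    · rw [inv_mul_le_iff₀ (by exact_mod_cast hK), mul_one]
      refine (norm_sum_le _ _).trans ?_
      simp only [norm_pow, hq, one_pow]
      simp
  have hzero : ∀ K : ℕ, ∑' i, b i * ((K : ℂ)⁻¹ * ∑ k ∈ Finset.range K, (ξ i / ξ i₀) ^ k) = 0 := by
    intro K
    have : ∀ i, b i * ((K : ℂ)⁻¹ * ∑ k ∈ Finset.range K, (ξ i / ξ i₀) ^ k) =
        ∑ k ∈ Finset.range K, (K : ℂ)⁻¹ * (b i * (ξ i / ξ i₀) ^ k) := fun i => by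
      rw [Finset.mul_sum, Finset.mul_sum]
      exact Finset.sum_congr rfl fun k _ => by ring
    simp_rw [this]
    rw [Summable.tsum_finsetSum fun k _ => (hsum k).mul_left _]
    simp_rw [tsum_mul_left, hmom, mul_zero, Finset.sum_const_zero]
  simp_rw [hzero] at hlim
  have h2 : ∑' i, b i * (if ξ i / ξ i₀ = 1 then (1 : ℂ) else 0) = b i₀ := by
    rw [tsum_eq_single i₀ fun i hi => ?_]
    · simp [hne]
    · have : ξ i / ξ i₀ ≠ 1 := fun h => hi (hξ ((div_eq_one_iff_eq (hne _)).1 h))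
      simp [this]
  rw [h2] at hlim
  exact (tendsto_nhds_unique hlim tendsto_const_nhds)

/-- A generalized Fourier series with rational frequencies that vanishes on a horizontal line has
vanishing coefficients. -/
theorem coeff_eq_zero_of_hasSum_zero {b : ℚ → ℂ} {τ₀ : ℂ}
    (h : ∀ x : ℝ, HasSum (fun n : ℚ => b n * e (n * (x + τ₀))) 0) : b = 0 := by
  funext n₀
  -- The step `√2` makes the points `e(√2 n)`, `n ∈ ℚ`, distinct.
  have key := eq_zero_of_tsum_mul_pow_eq_zero (fun n : ℚ => e ((n : ℂ) * (√2 : ℝ))) ?_ ?_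
    (fun n : ℚ => b n * e (n * τ₀)) ?_ ?_ n₀
  · exact (mul_eq_zero.1 key).resolve_right (e_ne_zero _)
  · intro n n' hn
    have h1 : e (((n - n' : ℚ) * √2 : ℝ) : ℂ) = 1 := by
      have : (((n - n' : ℚ) * √2 : ℝ) : ℂ) = (n : ℂ) * (√2 : ℝ) - (n' : ℂ) * (√2 : ℝ) := by
        push_cast; ring
      rw [this, e_sub]
      exact (div_eq_one_iff_eq (e_ne_zero _)).2 hn
    obtain ⟨k, hk⟩ := e_eq_one_iff_of_re.1 h1
    by_contra hne
    have h2 : (n - n' : ℚ) ≠ 0 := sub_ne_zero.2 hne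
    refine (irrational_sqrt_two.ratCast_mul h2) ⟨k, ?_⟩
    rw [hk]
    simp
  · intro n
    refine norm_e_of_im_eq_zero ?_
    rw [← Complex.ofReal_ratCast, ← Complex.ofReal_mul, Complex.ofReal_im]
  · simpa using (h 0).summable.norm
  · intro k
    have := (h (k * √2)).tsum_eq
    rw [← this]
    refine tsum_congr fun n => ?_
    rw [mul_add, e_add, ← e_nat_mul]
    push_cast
    ring_nf

theorem coeff_eq_of_hasSum {b b' : ℚ → ℂ} {τ₀ : ℂ} {F : ℝ → ℂ}
    (h : ∀ x : ℝ, HasSum (fun n : ℚ => b n * e (n * (x + τ₀))) (F x))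
    (h' : ∀ x : ℝ, HasSum (fun n : ℚ => b' n * e (n * (x + τ₀))) (F x)) : b = b' := by
  rw [← sub_eq_zero]
  refine coeff_eq_zero_of_hasSum_zero (τ₀ := τ₀) fun x => ?_
  simpa [sub_mul] using (h x).sub (h' x)

/-- Two-variable version of `coeff_eq_zero_of_hasSum_zero`. -/
theorem coeff_eq_zero_of_hasSum_zero₂ {a : ℚ → ℚ → ℂ} {τ₀ z₀ : ℂ}
    (h : ∀ x y : ℝ, HasSum (fun p : ℚ × ℚ => a p.1 p.2 * e (p.1 * (x + τ₀) + p.2 * (y + z₀))) 0)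
    (n r : ℚ) : a n r = 0 := by
  have h1 : ∀ y : ℝ, ∀ n, HasSum (fun r : ℚ => a n r * e (r * (y + z₀))) 0 := by
    intro y n
    have hs : ∀ n, Summable fun r : ℚ => a n r * e (r * (y + z₀)) := fun n => by
      have := (h 0 y).summable.comp_injective (Prod.mk_right_injective n)
      refine (summable_mul_left_iff (e_ne_zero (n * ((0 : ℝ) + τ₀)))).1 (this.congr fun r => ?_)
      simp only [Function.comp, e_add]
      ring
    have h2 : (fun n => ∑' r : ℚ, a n r * e (r * (y + z₀))) = 0 := by
      refine coeff_eq_zero_of_hasSum_zero (τ₀ := τ₀) fun x => ?_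
      refine (h x y).prod_fiberwise fun n => ?_
      refine ((hs n).hasSum.mul_right (e (n * (x + τ₀)))).congr_fun fun r => ?_
      simp only [e_add]
      ring
    have h3 : ∑' r : ℚ, a n r * e (r * (y + z₀)) = 0 := congrFun h2 n
    exact h3 ▸ (hs n).hasSum
  exact congrFun (coeff_eq_zero_of_hasSum_zero fun y => h1 y n) r

/-! ### Fourier coefficients and shifts of the contour -/

theorem integral_e_int_mul (k : ℤ) :
    ∫ x in (0 : ℝ)..1, e (k * x) = if k = 0 then 1 else 0 := by
  split_ifs with h
  · simp [h]
  · have hc : (2 * π * Complex.I * k : ℂ) ≠ 0 := by simp [h]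
    have := integral_exp_mul_complex (a := 0) (b := 1) hc
    simp only [e]
    simp_rw [← mul_assoc]
    rw [this]
    have h1 : Complex.exp (2 * π * Complex.I * k * (1 : ℝ)) = 1 := by
      have := e_int k
      rw [e] at this
      simpa using this
    rw [h1]
    simp

/-- The Fourier coefficients in `z` of an absolutely convergent double series in `e(nτ + tz)`. -/
theorem hasSum_fourierCoeff {D : ℚ → ℤ → ℂ} {τ : ℂ} {y : ℝ} {F : ℂ → ℂ}
    (h : ∀ x : ℝ, HasSum (fun p : ℚ × ℤ => D p.1 p.2 * e (p.1 * τ + p.2 * (x + y * Complex.I)))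
      (F (x + y * Complex.I))) (t : ℤ) :
    HasSum (fun n : ℚ => D n t * e (n * τ))
      (∫ x in (0 : ℝ)..1, F (x + y * Complex.I) * e (-t * (x + y * Complex.I))) := by
  set B : ℚ × ℤ → ℂ := fun p =>
    D p.1 p.2 * e (p.1 * τ + ((p.2 - t : ℤ) : ℂ) * (y * Complex.I)) with hB
  have hterm : ∀ (p : ℚ × ℤ) (x : ℝ),
      D p.1 p.2 * e (p.1 * τ + p.2 * (x + y * Complex.I)) * e (-t * (x + y * Complex.I)) =
      B p * e (((p.2 - t : ℤ) : ℂ) * x) := fun p x => by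
    rw [hB, mul_assoc, ← e_add, mul_assoc, ← e_add]
    congr 2
    push_cast
    ring
  have hn : ∀ (k : ℤ) (x : ℝ), ‖e ((k : ℂ) * x)‖ = 1 := fun k x =>
    norm_e_of_im_eq_zero (by simp)
  have hsB : Summable fun p => ‖B p‖ := by
    have := ((h 0).mul_right (e (-t * ((0 : ℝ) + y * Complex.I)))).summable.norm
    refine this.congr fun p => ?_
    rw [hterm, norm_mul, hn, mul_one]
  have h1 : HasSum (fun p : ℚ × ℤ => ∫ x in (0 : ℝ)..1, B p * e (((p.2 - t : ℤ) : ℂ) * x))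
      (∫ x in (0 : ℝ)..1, F (x + y * Complex.I) * e (-t * (x + y * Complex.I))) := by
    refine intervalIntegral.hasSum_integral_of_dominated_convergence (fun p _ => ‖B p‖)
      (fun p => ?_) (fun p => ?_) ?_ ?_ ?_
    · exact (Continuous.aestronglyMeasurable (by fun_prop))
    · refine Eventually.of_forall fun x _ => ?_
      rw [norm_mul, hn, mul_one]
    · exact Eventually.of_forall fun x _ => hsB
    · exact intervalIntegrable_const
    · refine Eventually.of_forall fun x _ => ?_
      simpa only [hterm] using (h x).mul_right (e (-t * (x + y * Complex.I)))
  have h2 : ∀ p : ℚ × ℤ, ∫ x in (0 : ℝ)..1, B p * e (((p.2 - t : ℤ) : ℂ) * x) =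
      if p.2 = t then D p.1 t * e (p.1 * τ) else 0 := fun p => by
    rw [intervalIntegral.integral_const_mul, integral_e_int_mul]
    by_cases hp : p.2 = t
    · simp [hp, hB]
    · simp [hp, sub_eq_zero]
  simp_rw [h2] at h1
  have h3 := (Function.Injective.hasSum_iff (Prod.mk_left_injective (α := ℚ) t) ?_).2 h1
  · simpa [Function.comp_def] using h3
  · rintro ⟨n, s⟩ hs
    have : s ≠ t := fun hst => hs ⟨n, by simp [hst]⟩
    simp [this]

/-- Cauchy's theorem on a rectangle of width `1`: the vertical sides cancel by periodicity. -/
theorem integral_line_eq_of_periodic {F : ℂ → ℂ} {y₁ y₂ : ℝ}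
    (hF : DifferentiableOn ℂ F {z | z.im ∈ Set.uIcc y₁ y₂})
    (hp : ∀ z : ℂ, z.im ∈ Set.uIcc y₁ y₂ → F (z + 1) = F z) :
    ∫ x in (0 : ℝ)..1, F (x + y₁ * Complex.I) = ∫ x in (0 : ℝ)..1, F (x + y₂ * Complex.I) := by
  have h := Complex.integral_boundary_rect_eq_zero_of_differentiableOn F (y₁ * Complex.I)
    (1 + y₂ * Complex.I) (hF.mono fun z hz => by
      have := hz.2
      simpa using this)
  have hv : ∫ y in y₁..y₂, F ((1 : ℝ) + y * Complex.I) =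
      ∫ y in y₁..y₂, F ((0 : ℝ) + y * Complex.I) := by
    refine intervalIntegral.integral_congr fun y hy => ?_
    have := hp ((0 : ℝ) + y * Complex.I) (by simpa using hy)
    rw [← this]
    congr 1
    push_cast
    ring
  simp only [Complex.add_re, Complex.mul_re, Complex.ofReal_re, Complex.I_re, mul_zero,
    Complex.ofReal_im, Complex.I_im, mul_one, sub_self, Complex.one_re, add_zero,
    Complex.add_im, Complex.mul_im, Complex.one_im, zero_add, hv] at h
  simpa [sub_eq_zero] using h

/-! ### The Jacobi slash action and lifts to the metaplectic group -/

theorem coe_smul_eq (g : SL(2, ℤ)) (τ : ℍ) : ((g • τ : ℍ) : ℂ) =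
    (((g 0 0 : ℤ) : ℂ) * τ + ((g 0 1 : ℤ) : ℂ)) / (((g 1 0 : ℤ) : ℂ) * τ + ((g 1 1 : ℤ) : ℂ)) := by
  simpa using UpperHalfPlane.coe_specialLinearGroup_apply g τ

theorem factor_ne_zero (g : SL(2, ℤ)) (τ : ℍ) :
    ((g 1 0 : ℤ) : ℂ) * τ + ((g 1 1 : ℤ) : ℂ) ≠ 0 := by
  rw [Mp1Z.denom_eq]
  exact denom_ne_zero (g : GL (Fin 2) ℝ) τ

theorem det_eq (g : SL(2, ℤ)) : g 0 0 * g 1 1 - g 0 1 * g 1 0 = 1 := by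
  have := g.det_coe
  rwa [Matrix.det_fin_two] at this

theorem jacobiSlash_mul (w : ℤ) (m : ℂ) (φ : ℍ → ℂ → ℂ) (g h : Mp1Z) :
    jacobiSlash w m φ (g * h) = jacobiSlash w m (jacobiSlash w m φ g) h := by
  funext τ z
  have hc : ((((g * h).mat 1 0 : ℤ)) : ℂ) * τ + (((g * h).mat 1 1 : ℤ) : ℂ) =
      (((g.mat 1 0 : ℤ) : ℂ) * (h.mat • τ : ℍ) + ((g.mat 1 1 : ℤ) : ℂ)) *
        (((h.mat 1 0 : ℤ) : ℂ) * τ + ((h.mat 1 1 : ℤ) : ℂ)) := by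
    rw [Mp1Z.denom_eq, Mp1Z.denom_eq, Mp1Z.denom_eq, Mp1Z.mul_mat, Mp1Z.cocycle]
  have hg := factor_ne_zero g.mat (h.mat • τ)
  have hh := factor_ne_zero h.mat τ
  have hdet : ((h.mat 0 0 : ℤ) : ℂ) * ((h.mat 1 1 : ℤ) : ℂ) -
      ((h.mat 0 1 : ℤ) : ℂ) * ((h.mat 1 0 : ℤ) : ℂ) = 1 := by exact_mod_cast det_eq h.mat
  have h10 : (((g * h).mat 1 0 : ℤ) : ℂ) = ((g.mat 1 0 : ℤ) : ℂ) * ((h.mat 0 0 : ℤ) : ℂ) +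
      ((g.mat 1 1 : ℤ) : ℂ) * ((h.mat 1 0 : ℤ) : ℂ) := by
    simp [Matrix.mul_apply, Fin.sum_univ_two]
  simp only [jacobiSlash]
  rw [hc, Mp1Z.mul_root, mul_zpow, Mp1Z.mul_mat, mul_smul, ← Mp1Z.mul_mat, div_div, h10]
  set c := ((g.mat 1 0 : ℤ) : ℂ)
  set d := ((g.mat 1 1 : ℤ) : ℂ)
  set a' := ((h.mat 0 0 : ℤ) : ℂ)
  set b' := ((h.mat 0 1 : ℤ) : ℂ)
  set c' := ((h.mat 1 0 : ℤ) : ℂ)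
  set d' := ((h.mat 1 1 : ℤ) : ℂ)
  have hσ : ((h.mat • τ : ℍ) : ℂ) * (c' * τ + d') = a' * τ + b' := by
    rw [coe_smul_eq, div_mul_cancel₀ _ hh]
  set σ := ((h.mat • τ : ℍ) : ℂ)
  have hexp : m * (-(c * a' + d * c') * z ^ 2 / ((c * σ + d) * (c' * τ + d'))) =
      m * (-c' * z ^ 2 / (c' * τ + d')) + m * (-c * (z / (c' * τ + d')) ^ 2 / (c * σ + d)) := by
    field_simp
    linear_combination (m * z ^ 2 * c') * (c * hσ) - m * z ^ 2 * c * hdet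
  rw [hexp, e_add, mul_comm ((c' : ℂ) * τ + d') (c * σ + d)]
  ring

/-- For `c > 0` the principal branch of the square root of `cτ + d` is holomorphic on `ℍ`. -/
theorem exists_mp1Z_of_pos (γ : SL(2, ℤ)) (hc : 0 < γ 1 0) : ∃ g : Mp1Z, g.mat = γ := by
  have him : ∀ τ : ℂ, 0 < τ.im → ((γ 1 0 : ℤ) : ℂ) * τ + ((γ 1 1 : ℤ) : ℂ) ∈ slitPlane := by
    intro τ hτ
    refine Or.inr ?_
    have : 0 < ((γ 1 0 : ℤ) : ℝ) * τ.im := mul_pos (by exact_mod_cast hc) hτ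
    simpa using this.ne'
  refine ⟨⟨γ, fun τ => (((γ 1 0 : ℤ) : ℂ) * τ + ((γ 1 1 : ℤ) : ℂ)) ^ (1 / 2 : ℂ), ?_, ?_⟩, rfl⟩
  · rw [UpperHalfPlane.mdifferentiable_iff]
    have : DifferentiableOn ℂ
        (fun τ : ℂ => (((γ 1 0 : ℤ) : ℂ) * τ + ((γ 1 1 : ℤ) : ℂ)) ^ (1 / 2 : ℂ))
        {z | 0 < z.im} := by
      intro τ hτ
      have hd : DifferentiableAt ℂ (fun τ : ℂ => ((γ 1 0 : ℤ) : ℂ) * τ + ((γ 1 1 : ℤ) : ℂ)) τ := by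
        fun_prop
      exact (hd.cpow (differentiableAt_const _) (him τ hτ)).differentiableWithinAt
    refine this.congr fun τ hτ => ?_
    simp [Function.comp, ofComplex_apply_of_im_pos hτ]
  · intro τ
    rw [← Complex.cpow_nat_mul]
    simp

/-! ### The theta function as a Jacobi form -/

/-- The Jacobi theta series `Θ(τ, z) = ∑ₙ e(n²τ + nz)`, of weight and index `1/2` and `1/4`. -/
noncomputable def thetaForm (τ : ℍ) (z : ℂ) : ℂ := jacobiTheta₂ z (2 * τ)

theorem im_two_mul_pos (τ : ℍ) : 0 < (2 * (τ : ℂ)).im := by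
  simpa using τ.im_pos

theorem hasSum_thetaForm (τ : ℍ) (z : ℂ) :
    HasSum (fun n : ℤ => e ((n : ℂ) ^ 2 * τ + n * z)) (thetaForm τ z) := by
  refine (hasSum_jacobiTheta₂_term z (im_two_mul_pos τ)).congr_fun fun n => ?_
  rw [e, jacobiTheta₂_term]
  ring_nf

theorem theta_eq_thetaForm (τ : ℍ) : theta τ = thetaForm τ 0 := jacobiTheta_eq_jacobiTheta₂ _

/-- The stabilizer of the line spanned by `Θ` under the Jacobi slash action of weight `1/2` and
index `1/4`. -/
noncomputable def thetaStabilizer : Subgroup Mp1Z where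
  carrier := {g | ∃ κ : ℂ, κ ≠ 0 ∧ ∀ τ z, jacobiSlash 1 (1 / 4) thetaForm g τ z = κ * thetaForm τ z}
  one_mem' := ⟨1, one_ne_zero, fun τ z => by simp [jacobiSlash]⟩
  mul_mem' := by
    rintro g h ⟨κ, hκ, hg⟩ ⟨κ', hκ', hh⟩
    refine ⟨κ * κ', mul_ne_zero hκ hκ', fun τ z => ?_⟩
    have : jacobiSlash 1 (1 / 4) thetaForm g = fun τ z => κ * thetaForm τ z := by
      funext τ z; exact hg τ z
    rw [jacobiSlash_mul, this, mul_assoc, ← hh]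
    simp only [jacobiSlash]
    ring
  inv_mem' := by
    rintro g ⟨κ, hκ, hg⟩
    refine ⟨κ⁻¹, inv_ne_zero hκ, fun τ z => ?_⟩
    have h1 : jacobiSlash 1 (1 / 4) thetaForm g = fun τ z => κ * thetaForm τ z := by
      funext τ z; exact hg τ z
    have h2 := congrFun (congrFun (jacobiSlash_mul 1 (1 / 4) thetaForm g g⁻¹) τ) z
    rw [h1, mul_inv_cancel] at h2
    have h3 : thetaForm τ z = κ * jacobiSlash 1 (1 / 4) thetaForm g⁻¹ τ z := by
      have : jacobiSlash 1 (1 / 4) thetaForm 1 τ z = thetaForm τ z := by simp [jacobiSlash]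
      rw [← this, h2]
      simp only [jacobiSlash]
      ring
    rw [h3]
    field_simp

/-- A holomorphic square root of `1` on the connected space `ℍ` is `1` or `-1`. -/
theorem mem_thetaStabilizer_of_mat_eq_one {g : Mp1Z} (hg : g.mat = 1) : g ∈ thetaStabilizer := by
  have hsq : ∀ τ : ℍ, g.root τ ^ 2 = 1 := fun τ => by simpa [hg] using g.sq τ
  have hcont : Continuous g.root := g.holo.continuous
  have h := (isPreconnected_univ (α := ℍ)).eq_or_eq_neg_of_sq_eq (f := g.root) (g := fun _ => 1)
    hcont.continuousOn continuousOn_const (fun τ _ => by simpa using hsq τ) (by simp)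
  have : ∃ s : ℂ, s ≠ 0 ∧ ∀ τ, g.root τ = s := by
    rcases h with h | h
    · exact ⟨1, one_ne_zero, fun τ => h (Set.mem_univ τ)⟩
    · exact ⟨-1, by simp, fun τ => h (Set.mem_univ τ)⟩
  obtain ⟨s, hs, hs'⟩ := this
  refine ⟨s⁻¹, inv_ne_zero hs, fun τ z => ?_⟩
  simp [jacobiSlash, hs', hg]

theorem exists_thetaStabilizer_T : ∃ g ∈ thetaStabilizer, g.mat = ModularGroup.T := by
  refine ⟨⟨ModularGroup.T, fun _ => 1, mdifferentiable_const, fun τ => by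
    simp [ModularGroup.coe_T]⟩, ⟨1, one_ne_zero, fun τ z => ?_⟩, rfl⟩
  have h : ((ModularGroup.T • τ : ℍ) : ℂ) = 1 + τ := by
    rw [modular_T_smul, coe_vadd]; simp
  simp only [jacobiSlash, thetaForm, h]
  rw [mul_add, mul_one, add_comm (2 : ℂ), jacobiTheta₂_add_right]
  simp [ModularGroup.coe_T]

theorem exists_thetaStabilizer_neg_one : ∃ g ∈ thetaStabilizer, g.mat = -1 := by
  refine ⟨⟨-1, fun _ => Complex.I, mdifferentiable_const, fun τ => by simp⟩,
    ⟨Complex.I⁻¹, by simp, fun τ z => ?_⟩, rfl⟩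
  simp [jacobiSlash, thetaForm, div_neg]

/-- The lower unipotent matrix with lower left entry `4`. -/
def lowerFour : SL(2, ℤ) := ⟨!![1, 0; 4, 1], by simp [Matrix.det_fin_two]⟩

/-- The transformation behaviour under the lower unipotent generator is that under `τ ↦ τ - 2`,
conjugated by the functional equation. -/
theorem exists_thetaStabilizer_lowerFour : ∃ g ∈ thetaStabilizer, g.mat = lowerFour := by
  have hA : ∀ τ : ℂ, 0 < τ.im → -Complex.I * τ ∈ slitPlane := fun τ hτ =>
    Or.inl (by simpa using hτ)
  have h0 : ∀ τ : ℂ, 0 < τ.im → 4 * τ + 1 ≠ 0 := fun τ hτ h => by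
    have := congrArg Complex.im h
    simp at this
    linarith
  have hB : ∀ τ : ℂ, 0 < τ.im → 0 < (2 * τ / (4 * τ + 1)).im := fun τ hτ => by
    have h1 := coe_smul_eq lowerFour ⟨τ, hτ⟩
    simp only [lowerFour, Matrix.SpecialLinearGroup.coe_mk, Matrix.cons_val', Matrix.cons_val_zero,
      Matrix.cons_val_one, Matrix.of_apply, Matrix.cons_val_fin_one] at h1
    have h2 : 2 * τ / (4 * τ + 1) = 2 * ((lowerFour • (⟨τ, hτ⟩ : ℍ) : ℍ) : ℂ) := by
      rw [show lowerFour = ⟨!![1, 0; 4, 1], by simp [Matrix.det_fin_two]⟩ from rfl, h1]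
      push_cast
      ring
    rw [h2]
    exact im_two_mul_pos _
  have h2 : ∀ τ : ℂ, 0 < τ.im → 0 < (2 * τ).im := fun τ hτ => im_two_mul_pos ⟨τ, hτ⟩
  -- The square root of `4τ + 1` that comes from applying the functional equation twice.
  set J : ℂ → ℂ := fun τ => (-Complex.I * (2 * τ)) ^ (1 / 2 : ℂ) /
    (-Complex.I * (2 * τ / (4 * τ + 1))) ^ (1 / 2 : ℂ) with hJ
  have hsqrt : ∀ x : ℂ, (x ^ (1 / 2 : ℂ)) ^ 2 = x := fun x => by
    rw [← Complex.cpow_nat_mul]; simp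
  have hne : ∀ τ : ℂ, 0 < τ.im → (-Complex.I * τ) ^ (1 / 2 : ℂ) ≠ 0 := fun τ hτ h => by
    have := hsqrt (-Complex.I * τ)
    rw [h] at this
    have h3 : τ = 0 := by simpa using this.symm
    simp [h3] at hτ
  have hJsq : ∀ τ : ℂ, 0 < τ.im → J τ ^ 2 = 4 * τ + 1 := fun τ hτ => by
    have h3 : τ ≠ 0 := fun h => by simp [h] at hτ
    have h4 := h0 τ hτ
    rw [hJ, div_pow, hsqrt, hsqrt]
    field_simp
  refine ⟨⟨lowerFour, fun τ => J τ, ?_, fun τ => ?_⟩, ⟨1, one_ne_zero, fun τ z => ?_⟩, rfl⟩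
  · rw [UpperHalfPlane.mdifferentiable_iff]
    have : DifferentiableOn ℂ J {z | 0 < z.im} := fun τ hτ => by
      have h4 := h0 τ hτ
      refine DifferentiableAt.differentiableWithinAt ?_
      refine DifferentiableAt.div ?_ ?_ (hne _ (hB τ hτ))
      · exact DifferentiableAt.cpow (by fun_prop) (differentiableAt_const _) (hA _ (h2 τ hτ))
      · refine DifferentiableAt.cpow ?_ (differentiableAt_const _) (hA _ (hB τ hτ))
        have hd : DifferentiableAt ℂ (fun τ : ℂ => 4 * τ + 1) τ := by fun_prop
        exact (DifferentiableAt.div (differentiableAt_id.const_mul 2) hd h4).const_mul _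
    refine this.congr fun τ hτ => ?_
    simp [Function.comp, ofComplex_apply_of_im_pos hτ]
  · rw [hJsq τ τ.im_pos]
    simp [lowerFour]
  · have hτ := τ.im_pos
    have h3 : (τ : ℂ) ≠ 0 := τ.ne_zero
    have h4 := h0 τ hτ
    have hsm : 2 * ((lowerFour • τ : ℍ) : ℂ) = 2 * τ / (4 * τ + 1) := by
      rw [coe_smul_eq]
      simp [lowerFour]
      ring
    have e1 := jacobiTheta₂_functional_equation z (2 * τ)
    have e2 := jacobiTheta₂_functional_equation (z / (4 * τ + 1)) (2 * τ / (4 * τ + 1))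
    have e3 : -1 / (2 * (τ : ℂ) / (4 * τ + 1)) + 2 = -1 / (2 * τ) := by
      field_simp
      ring
    have e4 : z / (4 * τ + 1) / (2 * τ / (4 * τ + 1)) = z / (2 * (τ : ℂ)) := by
      field_simp
    rw [e4, ← jacobiTheta₂_add_right (z / (2 * (τ : ℂ))), e3] at e2
    have hr1 := hne _ (h2 τ hτ)
    have hr2 := hne _ (hB τ hτ)
    simp only [jacobiSlash, thetaForm, hsm]
    have c10 : ((lowerFour 1 0 : ℤ) : ℂ) = 4 := by simp [lowerFour]
    have c11 : ((lowerFour 1 1 : ℤ) : ℂ) = 1 := by simp [lowerFour]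
    rw [c10, c11, e2, e1]
    set W := jacobiTheta₂ (z / (2 * (τ : ℂ))) (-1 / (2 * τ))
    set r1 := (-Complex.I * (2 * (τ : ℂ))) ^ (1 / 2 : ℂ)
    set r2 := (-Complex.I * (2 * (τ : ℂ) / (4 * τ + 1))) ^ (1 / 2 : ℂ)
    have e5 : e (1 / 4 * (-4 * z ^ 2 / (4 * τ + 1))) *
        Complex.exp (-π * Complex.I * (z / (4 * τ + 1)) ^ 2 / (2 * τ / (4 * τ + 1))) =
        Complex.exp (-π * Complex.I * z ^ 2 / (2 * τ)) := by
      rw [e, ← Complex.exp_add]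
      congr 1
      field_simp
      ring
    rw [← e5, show J τ = r1 / r2 from rfl, zpow_neg, zpow_one]
    set E1 := e (1 / 4 * (-4 * z ^ 2 / (4 * (τ : ℂ) + 1)))
    field_simp

/-- Division with a remainder of least absolute value. -/
theorem exists_two_mul_abs_add_le (x : ℤ) {y : ℤ} (hy : y ≠ 0) :
    ∃ k : ℤ, 2 * |x + k * y| ≤ |y| := by
  have h1 := Int.emod_nonneg x hy
  have h2 := Int.emod_lt_abs x hy
  have h3 := Int.emod_add_mul_ediv x y
  rcases le_total (2 * (x % y)) |y| with h | h
  · refine ⟨-(x / y), ?_⟩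
    have : x + -(x / y) * y = x % y := by linarith [mul_comm y (x / y)]
    rw [this, abs_of_nonneg h1]
    exact h
  · rcases abs_cases y with ⟨hy1, _⟩ | ⟨hy1, _⟩
    · refine ⟨-(x / y) - 1, ?_⟩
      have : x + (-(x / y) - 1) * y = x % y - y := by linarith [mul_comm y (x / y)]
      rw [this, abs_of_nonpos (by linarith)]
      linarith
    · refine ⟨-(x / y) + 1, ?_⟩
      have : x + (-(x / y) + 1) * y = x % y + y := by linarith [mul_comm y (x / y)]
      rw [this, abs_of_nonpos (by linarith)]
      linarith

theorem lowerFour_zpow (k : ℤ) : (lowerFour ^ k : SL(2, ℤ)).1 = !![1, 0; 4 * k, 1] := by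
  have hn : ∀ n : ℕ, (lowerFour ^ n : SL(2, ℤ)).1 = !![1, 0; 4 * (n : ℤ), 1] := fun n => by
    induction n with
    | zero => simp [Matrix.one_fin_two]
    | succ n ih =>
      rw [pow_succ, Matrix.SpecialLinearGroup.coe_mul, ih]
      simp [lowerFour]
      ring
  rcases k.eq_nat_or_neg with ⟨n, rfl | rfl⟩
  · rw [zpow_natCast, hn]
  · rw [zpow_neg, zpow_natCast, Matrix.SpecialLinearGroup.coe_inv, hn, Matrix.adjugate_fin_two_of]
    simp

/-- `Γ₀(4)` is generated by `-1` and the two unipotent matrices, by the Euclidean algorithm on the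
lower row. -/
theorem Gamma0_four_le (H : Subgroup SL(2, ℤ)) (hT : ModularGroup.T ∈ H) (hL : lowerFour ∈ H)
    (hneg : (-1 : SL(2, ℤ)) ∈ H) : CongruenceSubgroup.Gamma0 4 ≤ H := by
  suffices h : ∀ (n : ℕ) (γ : SL(2, ℤ)), (γ 1 0).natAbs = n → (4 : ℤ) ∣ γ 1 0 → γ ∈ H by
    intro γ hγ
    refine h _ γ rfl ?_
    rw [CongruenceSubgroup.Gamma0_mem] at hγ
    exact_mod_cast (ZMod.intCast_zmod_eq_zero_iff_dvd _ 4).1 hγ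
  intro n
  induction n using Nat.strong_induction_on with
  | _ n ih =>
    intro γ hn h4
    have hdet := det_eq γ
    by_cases hc : γ 1 0 = 0
    · rw [hc, mul_zero, sub_zero] at hdet
      have hγ : γ = ModularGroup.T ^ (γ 0 1) ∨ γ = -1 * ModularGroup.T ^ (-γ 0 1) := by
        rcases Int.mul_eq_one_iff_eq_one_or_neg_one.1 hdet with ⟨h1, h2⟩ | ⟨h1, h2⟩
        · left
          ext i j
          fin_cases i <;> fin_cases j <;> simp [ModularGroup.coe_T_zpow, h1, h2, hc]
        · right
          ext i j
          fin_cases i <;> fin_cases j <;> simp [ModularGroup.coe_T_zpow, h1, h2, hc]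
      rcases hγ with h | h
      · rw [h]; exact H.zpow_mem hT _
      · rw [h]; exact H.mul_mem hneg (H.zpow_mem hT _)
    · -- Reduce `d` modulo `c` by a power of `T`, then `c` modulo `4d` by a power of `lowerFour`.
      obtain ⟨k, hk⟩ := exists_two_mul_abs_add_le (γ 1 1) hc
      set d := γ 1 1 + k * γ 1 0 with hd
      have hd0 : d ≠ 0 := by
        intro h0
        have h1 : γ 1 0 * (-(γ 0 0 * k) - γ 0 1) = 1 := by
          have : γ 1 1 = -(k * γ 1 0) := by linarith
          rw [this] at hdet
          linarith
        obtain ⟨x, hx⟩ := h4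
        rw [hx, mul_assoc] at h1
        omega
      obtain ⟨j, hj⟩ := exists_two_mul_abs_add_le (γ 1 0)
        (mul_ne_zero (by norm_num : (4 : ℤ) ≠ 0) hd0)
      set γ' := γ * ModularGroup.T ^ k * lowerFour ^ j with hγ'
      have h10 : γ' 1 0 = γ 1 0 + j * (4 * d) := by
        rw [hγ', Matrix.SpecialLinearGroup.coe_mul, Matrix.SpecialLinearGroup.coe_mul,
          ModularGroup.coe_T_zpow, lowerFour_zpow]
        simp [Matrix.mul_apply, Fin.sum_univ_two, hd]
        ring
      have hodd : 2 * |d| ≠ |γ 1 0| := by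
        -- `d` is odd, while `4` divides the lower left entry. This makes the descent strict.
        intro h2
        have h5 : Odd d := by
          have h6 : γ 0 0 * d - (γ 0 1 + γ 0 0 * k) * γ 1 0 = 1 := by rw [hd]; linarith
          by_contra hev
          rw [Int.not_odd_iff_even] at hev
          obtain ⟨u, hu⟩ := hev
          obtain ⟨x, hx⟩ := h4
          rw [hu, hx] at h6
          have h7 : 2 * (γ 0 0 * u - (γ 0 1 + γ 0 0 * k) * (2 * x)) = 1 := by linarith
          omega
        obtain ⟨u, hu⟩ := h5
        obtain ⟨x, hx⟩ := h4
        rw [hx, abs_mul] at h2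
        have h8 : |d| = 2 * |x| := by
          have : |(4 : ℤ)| = 4 := by norm_num
          rw [this] at h2; linarith
        rcases abs_cases d with ⟨h9, _⟩ | ⟨h9, _⟩ <;> omega
      have hlt : |γ' 1 0| < |γ 1 0| := by
        rw [h10]
        have : |4 * d| = 4 * |d| := by rw [abs_mul]; norm_num
        rw [this] at hj
        have h11 := lt_of_le_of_ne hk hodd
        linarith
      have hmem : γ' ∈ H := by
        refine ih (γ' 1 0).natAbs ?_ γ' rfl ?_
        · rw [← hn]
          exact Int.natAbs_lt_iff_sq_lt.2 (sq_lt_sq.2 hlt)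
        · rw [h10]
          exact dvd_add h4 ⟨j * d, by ring⟩
      have : γ = γ' * (lowerFour ^ j)⁻¹ * (ModularGroup.T ^ k)⁻¹ := by
        rw [hγ']; group
      rw [this]
      exact H.mul_mem (H.mul_mem hmem (H.inv_mem (H.zpow_mem hL _))) (H.inv_mem (H.zpow_mem hT _))

theorem Gamma0Tilde_four_le_thetaStabilizer : Gamma0Tilde 4 ≤ thetaStabilizer := by
  intro g hg
  have h := Gamma0_four_le (thetaStabilizer.map Mp1Z.proj) ?_ ?_ ?_ hg
  · obtain ⟨h, hh, hgh⟩ := h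
    have hk : h⁻¹ * g ∈ thetaStabilizer := by
      refine mem_thetaStabilizer_of_mat_eq_one ?_
      have : h.mat = g.mat := hgh
      simp [this]
    simpa using thetaStabilizer.mul_mem hh hk
  · obtain ⟨g, hg, h⟩ := exists_thetaStabilizer_T
    exact ⟨g, hg, h⟩
  · obtain ⟨g, hg, h⟩ := exists_thetaStabilizer_lowerFour
    exact ⟨g, hg, h⟩
  · obtain ⟨g, hg, h⟩ := exists_thetaStabilizer_neg_one
    exact ⟨g, hg, h⟩

/-! ### Theta series with periodic coefficients -/

theorem sum_range_e_mul {L : ℕ} {x : ℂ} (hx : e (L * x) = 1) :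
    ∑ j ∈ Finset.range L, e (j * x) = if e x = 1 then (L : ℂ) else 0 := by
  simp_rw [e_nat_mul] at hx ⊢
  split_ifs with h
  · simp [h]
  · rw [geom_sum_eq h, hx]
    simp

/-- The finite Fourier expansion of a function on `ℤ` of period `L`. -/
theorem exists_finite_fourier {L : ℕ} (hL : 0 < L) {v : ℤ → ℂ} (hv : ∀ n, v (n + L) = v n) :
    ∃ w : ℕ → ℂ, ∀ n : ℤ, v n = ∑ j ∈ Finset.range L, w j * e (n * (j / L)) := by
  have hL0 : (L : ℂ) ≠ 0 := by exact_mod_cast hL.ne'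
  have hvm : ∀ n, v n = v (n % L) := fun n => by
    have hp : Function.Periodic v (L : ℤ) := hv
    have := hp.int_mul (n / L) (n % L)
    rw [← this]
    congr 1
    have := Int.emod_add_mul_ediv n L
    simp only [Int.cast_id]
    linarith
  refine ⟨fun j => (L : ℂ)⁻¹ * ∑ h ∈ Finset.range L, v h * e (-(h * (j / L))), fun n => ?_⟩
  have h1 : ∀ j ∈ Finset.range L, (L : ℂ)⁻¹ * (∑ h ∈ Finset.range L, v h * e (-(h * (j / L)))) *
      e (n * (j / L)) = ∑ h ∈ Finset.range L,
        (L : ℂ)⁻¹ * v h * e (j * (((n - h : ℤ) : ℂ) / L)) := fun j _ => by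
    rw [Finset.mul_sum, Finset.sum_mul]
    refine Finset.sum_congr rfl fun h _ => ?_
    rw [mul_assoc, mul_assoc, ← e_add, mul_assoc]
    congr 3
    push_cast
    ring
  rw [Finset.sum_congr rfl h1, Finset.sum_comm]
  simp_rw [← Finset.mul_sum]
  have hnn := Int.emod_nonneg n (by exact_mod_cast hL.ne' : (L : ℤ) ≠ 0)
  have hlt := Int.emod_lt_of_pos n (by exact_mod_cast hL : (0 : ℤ) < L)
  have hmod : (((n % L).toNat : ℕ) : ℤ) = n % L := Int.toNat_of_nonneg hnn
  rw [Finset.sum_eq_single (n % L).toNat]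
  · have h2 : e (((n - ((n % L).toNat : ℕ) : ℤ) : ℂ) / L) = 1 := by
      rw [e_eq_one_iff]
      refine ⟨n / L, ?_⟩
      rw [div_eq_iff hL0, hmod]
      have := Int.emod_add_mul_ediv n L
      have h3 : n - n % L = n / L * L := by linarith
      exact_mod_cast h3
    rw [sum_range_e_mul, if_pos h2, hmod, ← hvm]
    · field_simp
    · rw [mul_div_cancel₀ _ hL0, e_int]
  · intro h hh hne
    rw [sum_range_e_mul, if_neg, mul_zero]
    · intro h2
      obtain ⟨k, hk⟩ := (e_eq_one_iff _).1 h2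
      rw [div_eq_iff hL0] at hk
      have hk' : n - h = k * L := by exact_mod_cast hk
      apply hne
      have h4 : n % L = h := by
        have : n = h + k * L := by linarith
        rw [this, Int.add_mul_emod_self_right, Int.emod_eq_of_lt (by positivity)]
        exact_mod_cast Finset.mem_range.1 hh
      omega
    · rw [mul_div_cancel₀ _ hL0, e_int]
  · intro h
    exact absurd (Finset.mem_range.2 (by omega)) h

/-- The theta series `∑ₙ v(n) e(n²τ)`. -/
noncomputable def thetaSeries (v : ℤ → ℂ) (τ : ℍ) : ℂ := ∑' n : ℤ, v n * e ((n : ℂ) ^ 2 * τ)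

theorem thetaSeries_eq_sum {L : ℕ} {v : ℤ → ℂ} {w : ℕ → ℂ}
    (hw : ∀ n : ℤ, v n = ∑ j ∈ Finset.range L, w j * e (n * (j / L))) (d : ℤ) (τ : ℍ) :
    thetaSeries (fun n => v (d * n)) τ =
      ∑ j ∈ Finset.range L, w j * thetaForm τ (d * (j / L)) := by
  refine HasSum.tsum_eq ?_
  refine (hasSum_sum fun (j : ℕ) _ => (hasSum_thetaForm τ (d * (j / L))).mul_left (w j)).congr_fun
    fun n => ?_
  change v (d * n) * _ = _
  rw [hw, Finset.sum_mul]
  refine Finset.sum_congr rfl fun j _ => ?_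
  rw [mul_assoc, ← e_add]
  push_cast
  ring_nf

theorem thetaForm_add_two_mul (τ : ℍ) (z : ℂ) (ν : ℤ) :
    thetaForm τ (z + 2 * ν * τ) = e (-(ν : ℂ) ^ 2 * τ - ν * z) * thetaForm τ z := by
  refine (hasSum_thetaForm τ (z + 2 * ν * τ)).unique ?_
  have h := ((Equiv.addRight ν).hasSum_iff.2 (hasSum_thetaForm τ z)).mul_left
    (e (-(ν : ℂ) ^ 2 * τ - ν * z))
  refine h.congr_fun fun n => ?_
  simp only [Function.comp, Equiv.coe_addRight]
  rw [← e_add]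
  push_cast
  ring_nf

/-- A matrix in a deep enough `Γ₀` permutes the values of `Θ` at the points `j/L`, with a factor
independent of `j`. -/
theorem thetaForm_smul {g : Mp1Z} {L : ℕ} (hL : 0 < L) (hc : (4 * L ^ 2 : ℤ) ∣ g.mat 1 0) :
    ∃ κ : ℂ, ∀ (τ : ℍ) (j : ℕ), thetaForm (g.mat • τ) (j / L) =
      κ * g.root τ * thetaForm τ ((g.mat 1 1 : ℤ) * (j / L)) := by
  have hg : g ∈ thetaStabilizer := by
    refine Gamma0Tilde_four_le_thetaStabilizer ?_
    change g.mat ∈ CongruenceSubgroup.Gamma0 4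
    rw [CongruenceSubgroup.Gamma0_mem, ZMod.intCast_zmod_eq_zero_iff_dvd]
    exact (Dvd.intro _ rfl).trans hc
  obtain ⟨κ, -, h⟩ := hg
  obtain ⟨c₁, hc₁⟩ := hc
  have hL0 : (L : ℂ) ≠ 0 := by exact_mod_cast hL.ne'
  refine ⟨κ, fun τ j => ?_⟩
  have hj := factor_ne_zero g.mat τ
  have hr := g.root_ne_zero τ
  have h1 := h τ ((((g.mat 1 0 : ℤ) : ℂ) * τ + ((g.mat 1 1 : ℤ) : ℂ)) * (j / L))
  rw [jacobiSlash, mul_div_cancel_left₀ _ hj] at h1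
  have h2 : (((g.mat 1 0 : ℤ) : ℂ) * τ + ((g.mat 1 1 : ℤ) : ℂ)) * (j / L) =
      ((g.mat 1 1 : ℤ) : ℂ) * (j / L) + 2 * ((2 * L * c₁ * j : ℤ) : ℂ) * τ := by
    rw [hc₁]
    push_cast
    field_simp
    ring
  have h3 : e (1 / 4 * (-((g.mat 1 0 : ℤ) : ℂ) *
      ((((g.mat 1 0 : ℤ) : ℂ) * τ + ((g.mat 1 1 : ℤ) : ℂ)) * (j / L)) ^ 2 /
        (((g.mat 1 0 : ℤ) : ℂ) * τ + ((g.mat 1 1 : ℤ) : ℂ)))) =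
      e (-((2 * L * c₁ * j : ℤ) : ℂ) ^ 2 * τ -
        ((2 * L * c₁ * j : ℤ) : ℂ) * (((g.mat 1 1 : ℤ) : ℂ) * (j / L))) := by
    have h4 : 1 / 4 * (-((g.mat 1 0 : ℤ) : ℂ) *
        ((((g.mat 1 0 : ℤ) : ℂ) * τ + ((g.mat 1 1 : ℤ) : ℂ)) * (j / L)) ^ 2 /
        (((g.mat 1 0 : ℤ) : ℂ) * τ + ((g.mat 1 1 : ℤ) : ℂ))) =
        1 / 4 * (-((g.mat 1 0 : ℤ) : ℂ) *
        ((((g.mat 1 0 : ℤ) : ℂ) * τ + ((g.mat 1 1 : ℤ) : ℂ)) * (j / L) ^ 2)) := by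
      field_simp
    rw [h4, ← e_add_int _ (-(c₁ * g.mat 1 1 * j ^ 2)), hc₁]
    congr 1
    push_cast
    field_simp
    ring
  rw [h3, h2, thetaForm_add_two_mul] at h1
  have h5 := e_ne_zero (-((2 * L * c₁ * j : ℤ) : ℂ) ^ 2 * τ -
        ((2 * L * c₁ * j : ℤ) : ℂ) * (((g.mat 1 1 : ℤ) : ℂ) * (j / L)))
  rw [zpow_neg, zpow_one] at h1
  refine mul_left_cancel₀ (mul_ne_zero (inv_ne_zero hr) h5) ?_
  rw [h1]
  field_simp

/-- The transformation law of theta series with periodic coefficients: up to an automorphy factor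
independent of the coefficients, the coefficient function `v` becomes `n ↦ v(dn)`. -/
theorem thetaSeries_smul {g : Mp1Z} {L : ℕ} (hL : 0 < L) (hc : (4 * L ^ 2 : ℤ) ∣ g.mat 1 0) :
    ∃ κ : ℂ, ∀ v : ℤ → ℂ, (∀ n, v (n + L) = v n) → ∀ τ : ℍ,
      thetaSeries v (g.mat • τ) =
        κ * g.root τ * thetaSeries (fun n => v (g.mat 1 1 * n)) τ := by
  obtain ⟨κ, h⟩ := thetaForm_smul hL hc
  refine ⟨κ, fun v hv τ => ?_⟩
  obtain ⟨w, hw⟩ := exists_finite_fourier hL hv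
  have h1 := thetaSeries_eq_sum hw 1 (g.mat • τ)
  simp only [one_mul, Int.cast_one] at h1
  rw [h1, thetaSeries_eq_sum hw, Finset.mul_sum]
  refine Finset.sum_congr rfl fun j _ => ?_
  rw [h]
  ring

theorem theta_vadd (x : ℝ) (τ : ℍ) :
    theta (x +ᵥ τ) = thetaSeries (fun n => e ((n : ℂ) ^ 2 * x)) τ := by
  rw [theta_eq_thetaForm, thetaSeries, ← (hasSum_thetaForm _ 0).tsum_eq]
  refine tsum_congr fun n => ?_
  rw [← e_add, coe_vadd]
  ring_nf

/-- For every `x = λ/M`, a matrix of `Γ₀(4M²)` carries `θ(· + x)` to `θ(· + d²x)`, with an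
automorphy factor independent of `λ`. -/
theorem theta_shift {g : Mp1Z} {M : ℕ} (hM : 0 < M) (hc : (4 * M ^ 2 : ℤ) ∣ g.mat 1 0) :
    ∃ κ : ℂ, ∀ (k : ℤ) (τ : ℍ), theta ((k / M : ℝ) +ᵥ g.mat • τ) =
      κ * g.root τ * theta (((g.mat 1 1 : ℤ) ^ 2 * k / M : ℝ) +ᵥ τ) := by
  obtain ⟨κ, h⟩ := thetaSeries_smul hM hc
  have hM0 : (M : ℂ) ≠ 0 := by exact_mod_cast hM.ne'
  refine ⟨κ, fun k τ => ?_⟩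
  rw [theta_vadd, theta_vadd, h]
  · congr 2
    funext n
    push_cast
    ring_nf
  · intro n
    rw [← e_add_int (((n : ℤ) : ℂ) ^ 2 * ((k / M : ℝ) : ℂ)) (2 * n * k + M * k)]
    congr 1
    push_cast
    field_simp
    ring

/-! ### The Dedekind eta function as a theta series -/

theorem norm_prod_one_sub_pow_le {x : ℂ} (hx : ‖x‖ < 1) (k n : ℕ) :
    ‖∏ i ∈ Finset.range n, (1 - x ^ (k + i + 1))‖ ≤ Real.exp (1 - ‖x‖)⁻¹ := by
  rw [norm_prod]
  calc ∏ i ∈ Finset.range n, ‖1 - x ^ (k + i + 1)‖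
      ≤ ∏ i ∈ Finset.range n, Real.exp (‖x‖ ^ i) := by
        refine Finset.prod_le_prod (fun _ _ => norm_nonneg _) fun i _ => ?_
        have h1 : ‖x‖ ^ (k + i + 1) ≤ ‖x‖ ^ i :=
          pow_le_pow_of_le_one (norm_nonneg _) hx.le (by omega)
        calc ‖1 - x ^ (k + i + 1)‖ ≤ 1 + ‖x‖ ^ (k + i + 1) := by
              refine (norm_sub_le _ _).trans ?_
              rw [norm_one, norm_pow]
          _ ≤ ‖x‖ ^ i + 1 := by linarith
          _ ≤ _ := Real.add_one_le_exp _
    _ = Real.exp (∑ i ∈ Finset.range n, ‖x‖ ^ i) := (Real.exp_sum _ _).symm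
    _ ≤ _ := by
        rw [Real.exp_le_exp, ← tsum_geometric_of_lt_one (norm_nonneg _) hx]
        exact (summable_geometric_of_lt_one (norm_nonneg _) hx).sum_le_tsum _
          fun _ _ => by positivity

theorem le_pentagonal_neg (k : ℕ) : k ≤ pentagonal (-(k : ℤ)) := by
  have h := two_mul_natCast_pentagonal_neg (k : ℤ)
  zify
  nlinarith [sq_nonneg (k : ℤ), Int.natCast_nonneg k]

theorem le_pentagonal_succ (k : ℕ) : k ≤ pentagonal ((k : ℤ) + 1) := by
  have h := two_mul_natCast_pentagonal ((k : ℤ) + 1)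
  zify
  nlinarith [Int.natCast_nonneg k]

/-- Euler's pentagonal number theorem for complex numbers. -/
theorem tprod_one_sub_pow_eq_pentagonal {x : ℂ} (hx : ‖x‖ < 1) :
    ∏' n : ℕ, (1 - x ^ (n + 1)) =
      ∑' k : ℕ, (-1) ^ k * (x ^ pentagonal (-(k : ℤ)) - x ^ pentagonal ((k : ℤ) + 1)) := by
  have hgeo := summable_geometric_of_lt_one (norm_nonneg _) hx
  have hterm : ∀ k n : ℕ, ‖x ^ ((k + 1) * n) * ∏ i ∈ Finset.range (n + 1), (1 - x ^ (k + i + 1))‖ ≤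
      ‖x‖ ^ n * Real.exp (1 - ‖x‖)⁻¹ := fun k n => by
    rw [norm_mul, norm_pow]
    refine mul_le_mul ?_ (norm_prod_one_sub_pow_le hx _ _) (norm_nonneg _) (by positivity)
    exact pow_le_pow_of_le_one (norm_nonneg _) hx.le (by nlinarith)
  refine Pentagonal.tprod_one_sub_pow ?_ (fun k => ?_) (fun k => ?_) ?_ ?_
  · exact tendsto_pow_atTop_nhds_zero_of_norm_lt_one hx
  · exact Summable.of_norm_bounded (hgeo.mul_right _) (hterm k)
  · simp_rw [sub_eq_add_neg]
    refine multipliable_one_add_of_summable ?_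
    refine Summable.of_nonneg_of_le (fun _ => norm_nonneg _) (fun n => ?_) hgeo
    rw [norm_neg, norm_pow]
    exact pow_le_pow_of_le_one (norm_nonneg _) hx.le (by omega)
  · refine Summable.of_norm_bounded (hgeo.mul_right 2) fun k => ?_
    rw [norm_mul, norm_pow, norm_neg, norm_one, one_pow, one_mul]
    refine (norm_sub_le _ _).trans ?_
    rw [norm_pow, norm_pow, mul_two]
    exact add_le_add (pow_le_pow_of_le_one (norm_nonneg _) hx.le (le_pentagonal_neg k))
      (pow_le_pow_of_le_one (norm_nonneg _) hx.le (le_pentagonal_succ k))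
  · have h0 : Tendsto (fun k : ℕ => ‖x‖ ^ k * ((1 - ‖x‖)⁻¹ * Real.exp (1 - ‖x‖)⁻¹)) atTop
        (𝓝 0) := by
      simpa using (tendsto_pow_atTop_nhds_zero_of_lt_one (norm_nonneg _) hx).mul_const
        ((1 - ‖x‖)⁻¹ * Real.exp (1 - ‖x‖)⁻¹)
    refine squeeze_zero_norm (fun k => ?_) h0
    rw [norm_mul, norm_mul, norm_pow, norm_neg, norm_one, one_pow, one_mul, norm_pow]
    refine mul_le_mul ?_ ?_ (norm_nonneg _) (by positivity)
    · refine pow_le_pow_of_le_one (norm_nonneg _) hx.le ?_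
      rw [Nat.le_div_iff_mul_le (by norm_num)]
      nlinarith
    · refine tsum_of_norm_bounded ?_ (hterm k)
      exact (hasSum_geometric_of_lt_one (norm_nonneg _) hx).mul_right _

/-- `η(τ) = ∑ₖ (-1)ᵏ e((6k+1)²τ/24)`. -/
theorem hasSum_eta (τ : ℍ) :
    HasSum (fun k : ℤ => (-1 : ℂ) ^ k * e ((6 * k + 1) ^ 2 * (τ / 24))) (eta τ) := by
  set x := e τ with hx
  have hx1 : ‖x‖ < 1 := norm_e_lt_one τ.im_pos
  have hA : ∀ k : ℕ, e ((6 * ((k : ℤ) : ℂ) + 1) ^ 2 * (τ / 24)) =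
      e (τ / 24) * x ^ pentagonal (-(k : ℤ)) := fun k => by
    have h : 2 * ((pentagonal (-(k : ℤ)) : ℕ) : ℂ) = k * (3 * k + 1) := by
      exact_mod_cast two_mul_natCast_pentagonal_neg (k : ℤ)
    rw [hx, ← e_nat_mul, ← e_add]
    congr 1
    push_cast
    linear_combination (-(τ : ℂ) / 2) * h
  have hB : ∀ k : ℕ, e ((6 * ((-((k : ℤ) + 1) : ℤ) : ℂ) + 1) ^ 2 * (τ / 24)) =
      e (τ / 24) * x ^ pentagonal ((k : ℤ) + 1) := fun k => by
    have h : 2 * ((pentagonal ((k : ℤ) + 1) : ℕ) : ℂ) = (k + 1) * (3 * (k + 1) - 1) := by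
      exact_mod_cast two_mul_natCast_pentagonal ((k : ℤ) + 1)
    rw [hx, ← e_nat_mul, ← e_add]
    congr 1
    push_cast
    linear_combination (-(τ : ℂ) / 2) * h
  have hgeo := summable_geometric_of_lt_one (norm_nonneg _) hx1
  have hsA : Summable fun k : ℕ => (-1 : ℂ) ^ k * (e (τ / 24) * x ^ pentagonal (-(k : ℤ))) := by
    refine Summable.of_norm_bounded (hgeo.mul_left ‖e (τ / 24)‖) fun k => ?_
    rw [norm_mul, norm_pow, norm_neg, norm_one, one_pow, one_mul, norm_mul, norm_pow]
    gcongr ?_ * ?_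
    exact pow_le_pow_of_le_one (norm_nonneg _) hx1.le (le_pentagonal_neg k)
  have hsB : Summable fun k : ℕ => (-1 : ℂ) ^ k * (e (τ / 24) * x ^ pentagonal ((k : ℤ) + 1)) := by
    refine Summable.of_norm_bounded (hgeo.mul_left ‖e (τ / 24)‖) fun k => ?_
    rw [norm_mul, norm_pow, norm_neg, norm_one, one_pow, one_mul, norm_mul, norm_pow]
    gcongr ?_ * ?_
    exact pow_le_pow_of_le_one (norm_nonneg _) hx1.le (le_pentagonal_succ k)
  have heta : eta τ = ∑' k : ℕ, (-1 : ℂ) ^ k * (e (τ / 24) * x ^ pentagonal (-(k : ℤ))) +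
      -∑' k : ℕ, (-1 : ℂ) ^ k * (e (τ / 24) * x ^ pentagonal ((k : ℤ) + 1)) := by
    have h1 : ∏' n : ℕ, (1 - ModularForm.eta_q n τ) = ∏' n : ℕ, (1 - x ^ (n + 1)) := by
      refine tprod_congr fun n => ?_
      rw [ModularForm.eta_q_eq_pow, hx, e]
    rw [eta, ModularForm.eta, h1, tprod_one_sub_pow_eq_pentagonal hx1, ← sub_eq_add_neg,
      ← hsA.tsum_sub hsB, ← tsum_mul_left]
    refine tsum_congr fun k => ?_
    have h2 : Function.Periodic.qParam 24 (τ : ℂ) = e (τ / 24) := by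
      rw [Function.Periodic.qParam, e]
      push_cast
      ring_nf
    rw [h2]
    ring
  rw [heta]
  refine HasSum.of_nat_of_neg_add_one ?_ ?_
  · refine hsA.hasSum.congr_fun fun k => ?_
    rw [hA, zpow_natCast]
  · refine hsB.hasSum.neg.congr_fun fun k => ?_
    rw [hB]
    have : (-1 : ℂ) ^ (-((k : ℤ) + 1)) = -(-1) ^ k := by
      rw [zpow_neg, ← inv_zpow, show (-1 : ℂ)⁻¹ = -1 by norm_num,
        zpow_add₀ (by norm_num), zpow_natCast, zpow_one]
      ring
    rw [this]
    ring

/-- The coefficients of `η` as a theta series in `e(n²τ/24)`: the function supported on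
`6k + 1` with value `(-1)ᵏ`. -/
noncomputable def etaCoeff (n : ℤ) : ℂ := if n % 12 = 1 then 1 else if n % 12 = 7 then -1 else 0

theorem etaCoeff_eq_of_emod_eq {n n' : ℤ} (h : n % 12 = n' % 12) : etaCoeff n = etaCoeff n' := by
  rw [etaCoeff, etaCoeff, h]

theorem etaCoeff_six_mul_add_one (k : ℤ) : etaCoeff (6 * k + 1) = (-1) ^ k := by
  rcases Int.even_or_odd k with h | h
  · rw [h.neg_one_zpow]
    obtain ⟨j, rfl⟩ := h
    rw [etaCoeff, if_pos (by omega)]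
  · rw [h.neg_one_zpow]
    obtain ⟨j, rfl⟩ := h
    rw [etaCoeff, if_neg (by omega), if_pos (by omega)]

/-- The translates of `η` are theta series with periodic coefficients, evaluated at `τ/24`. -/
theorem eta_vadd (x : ℝ) (τ : ℍ) : eta (x +ᵥ τ) = thetaSeries (fun n => etaCoeff n *
    e ((n : ℂ) ^ 2 * (x / 24))) ((⟨1 / 24, by norm_num⟩ : {x : ℝ // 0 < x}) • τ) := by
  refine (HasSum.tsum_eq ?_).symm
  have hinj : Function.Injective fun k : ℤ => 6 * k + 1 := fun k k' h => by
    simpa using h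
  refine (hinj.hasSum_iff ?_).1 ((hasSum_eta (x +ᵥ τ)).congr_fun fun k => ?_)
  · intro n hn
    have : etaCoeff n = 0 := by
      rw [etaCoeff, if_neg, if_neg]
      · exact fun h => hn ⟨(n - 1) / 6, by simp only; omega⟩
      · exact fun h => hn ⟨(n - 1) / 6, by simp only; omega⟩
    simp [this]
  · simp only [Function.comp]
    rw [etaCoeff_six_mul_add_one, mul_assoc, ← e_add, coe_vadd, coe_pos_real_smul]
    congr 2
    simp
    ring

/-- Conjugation by `diag(24, 1)` of an element whose upper right entry is divisible by `24`. -/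
theorem exists_conj_twentyFour {g : Mp1Z} (hb : 24 ∣ g.mat 0 1) :
    ∃ h : Mp1Z, h.mat 1 0 = 24 * g.mat 1 0 ∧ h.mat 1 1 = g.mat 1 1 ∧
      ∀ τ : ℍ, h.root ((⟨1 / 24, by norm_num⟩ : {x : ℝ // 0 < x}) • τ) = g.root τ ∧
        h.mat • ((⟨1 / 24, by norm_num⟩ : {x : ℝ // 0 < x}) • τ) =
          (⟨1 / 24, by norm_num⟩ : {x : ℝ // 0 < x}) • (g.mat • τ) := by
  obtain ⟨b, hb⟩ := hb
  have hdet := det_eq g.mat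
  have hs : ∀ τ : ℂ, 0 < τ.im → 0 < (24 * τ).im := fun τ hτ => by simpa using hτ
  refine ⟨⟨⟨!![g.mat 0 0, b; 24 * g.mat 1 0, g.mat 1 1], ?_⟩,
    fun τ => g.root ⟨24 * τ, hs τ τ.im_pos⟩, ?_, fun τ => ?_⟩, rfl, rfl, fun τ => ⟨?_, ?_⟩⟩
  · rw [Matrix.det_fin_two_of]
    linear_combination hdet + g.mat 1 0 * hb
  · have hg := UpperHalfPlane.mdifferentiable_iff.1 g.holo
    rw [UpperHalfPlane.mdifferentiable_iff]
    have h1 : DifferentiableOn ℂ (fun τ : ℂ => 24 * τ) {z | 0 < z.im} := by fun_prop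
    refine (hg.comp h1 fun τ hτ => hs τ hτ).congr fun τ hτ => ?_
    simp only [Function.comp, ofComplex_apply_of_im_pos hτ, ofComplex_apply_of_im_pos (hs τ hτ)]
  · rw [g.sq]
    simp
    ring
  · simp only
    congr 1
    ext1
    simp
  · have h2 := factor_ne_zero g.mat τ
    ext1
    rw [coe_pos_real_smul, coe_smul_eq, coe_smul_eq, coe_pos_real_smul]
    simp only [Matrix.of_apply, Matrix.cons_val', Matrix.cons_val_zero, Matrix.cons_val_one,
      Matrix.cons_val_fin_one, hb]
    push_cast
    have h3 : (24 : ℂ) * ((g.mat 1 0 : ℤ) : ℂ) * ((1 / 24 : ℝ) • (τ : ℂ)) + ((g.mat 1 1 : ℤ) : ℂ) =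
        ((g.mat 1 0 : ℤ) : ℂ) * τ + ((g.mat 1 1 : ℤ) : ℂ) := by
      simp
      ring
    rw [h3]
    simp
    field_simp

/-- The analogue of `theta_shift` for the eta function. -/
theorem eta_shift {g : Mp1Z} {M : ℕ} (hM : 0 < M) (hc : (96 * M ^ 2 : ℤ) ∣ g.mat 1 0)
    (hb : 24 ∣ g.mat 0 1) (hd : g.mat 1 1 % 12 = 1) :
    ∃ κ : ℂ, ∀ (k : ℤ) (τ : ℍ), eta ((k / M : ℝ) +ᵥ g.mat • τ) =
      κ * g.root τ * eta (((g.mat 1 1 : ℤ) ^ 2 * k / M : ℝ) +ᵥ τ) := by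
  obtain ⟨h, h10, h11, hh⟩ := exists_conj_twentyFour hb
  obtain ⟨κ, hκ⟩ := thetaSeries_smul (g := h) (L := 24 * M) (by positivity) (by
    rw [h10]
    obtain ⟨c, hc⟩ := hc
    exact ⟨c, by rw [hc]; push_cast; ring⟩)
  have hM0 : (M : ℂ) ≠ 0 := by exact_mod_cast hM.ne'
  refine ⟨κ, fun k τ => ?_⟩
  rw [eta_vadd, eta_vadd, ← (hh τ).2, hκ, (hh τ).1, h11]
  · congr 2
    funext n
    have : etaCoeff (g.mat 1 1 * n) = etaCoeff n := by
      refine etaCoeff_eq_of_emod_eq ?_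
      rw [Int.mul_emod, hd, one_mul, Int.emod_emod]
    rw [this]
    push_cast
    ring_nf
  · intro n
    have : etaCoeff (n + (24 * M : ℕ)) = etaCoeff n :=
      etaCoeff_eq_of_emod_eq (by push_cast; omega)
    rw [this, ← e_add_int (((n : ℤ) : ℂ) ^ 2 * (((k / M : ℝ) : ℂ) / 24)) (2 * n * k + 24 * M * k)]
    congr 2
    push_cast
    field_simp
    ring

/-! ### Conjugation by rational translations -/

/-- The identity of Möbius transformations `A ∘ t_s = t_t ∘ B`, where `t_x` is the translation by
`x`, with denominators cleared. -/
theorem smul_vadd_eq {A B : SL(2, ℤ)} {s t : ℝ} {τ : ℍ}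
    (h : (((A 0 0 : ℤ) : ℂ) * (s + τ) + ((A 0 1 : ℤ) : ℂ)) *
        (((B 1 0 : ℤ) : ℂ) * τ + ((B 1 1 : ℤ) : ℂ)) =
      (t * (((B 1 0 : ℤ) : ℂ) * τ + ((B 1 1 : ℤ) : ℂ)) +
        (((B 0 0 : ℤ) : ℂ) * τ + ((B 0 1 : ℤ) : ℂ))) *
        (((A 1 0 : ℤ) : ℂ) * (s + τ) + ((A 1 1 : ℤ) : ℂ))) :
    A • (s +ᵥ τ) = t +ᵥ (B • τ) := by
  have h1 := factor_ne_zero B τ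
  have h2 := factor_ne_zero A (s +ᵥ τ)
  ext1
  rw [coe_smul_eq, coe_vadd t, coe_smul_eq]
  rw [coe_vadd] at h2 ⊢
  rw [div_eq_iff h2, add_mul, div_mul_eq_mul_div, ← mul_left_inj' h1, h]
  rw [add_mul _ _ (((B 1 0 : ℤ) : ℂ) * τ + ((B 1 1 : ℤ) : ℂ)), div_mul_cancel₀ _ h1]
  ring

/-- The element `t g t'` where `t` is the translation by `k/M`, `t'` is the translation by
`-d²k/M`, and `d` is the lower right entry of `g`; it is integral if `M²` divides the lower left
entry. -/
theorem exists_twist {g : Mp1Z} {M : ℕ} (hM : 0 < M) {c₁ : ℤ} (hc : g.mat 1 0 = M ^ 2 * c₁)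
    (k : ℤ) :
    ∃ h : Mp1Z, h.mat 1 0 = g.mat 1 0 ∧ h.mat 1 1 = g.mat 1 1 - M * c₁ * g.mat 1 1 ^ 2 * k ∧
      ∀ τ : ℍ, h.root ((((g.mat 1 1 : ℤ) ^ 2 * k / M : ℝ)) +ᵥ τ) = g.root τ ∧
        h.mat • ((((g.mat 1 1 : ℤ) ^ 2 * k / M : ℝ)) +ᵥ τ) = (k / M : ℝ) +ᵥ (g.mat • τ) := by
  have hdet := det_eq g.mat
  have hM0 : (M : ℂ) ≠ 0 := by exact_mod_cast hM.ne'
  set s : ℝ := ((g.mat 1 1 : ℤ) ^ 2 * k / M : ℝ) with hs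
  have hsc : (M : ℂ) * (s : ℂ) = ((g.mat 1 1 : ℤ) : ℂ) ^ 2 * k := by
    rw [hs]; push_cast; field_simp
  clear_value s
  have hcc : ((g.mat 1 0 : ℤ) : ℂ) = (M : ℂ) ^ 2 * c₁ := by rw [hc]; push_cast; ring
  refine ⟨⟨⟨!![g.mat 0 0 + M * c₁ * k,
      g.mat 0 1 - g.mat 1 1 * g.mat 0 1 * M * c₁ * k - c₁ * g.mat 1 1 ^ 2 * k ^ 2;
      g.mat 1 0, g.mat 1 1 - M * c₁ * g.mat 1 1 ^ 2 * k], ?_⟩,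
    fun τ => g.root ((-s) +ᵥ τ), ?_, fun τ => ?_⟩, rfl, rfl, fun τ => ⟨?_, ?_⟩⟩
  · rw [Matrix.det_fin_two_of]
    rw [hc] at hdet ⊢
    linear_combination (1 - M * c₁ * g.mat 1 1 * k) * hdet
  · have hg := UpperHalfPlane.mdifferentiable_iff.1 g.holo
    rw [UpperHalfPlane.mdifferentiable_iff]
    have him : ∀ τ : ℂ, 0 < τ.im → 0 < ((-s : ℝ) + τ : ℂ).im := fun τ hτ => by simpa using hτ
    have h1 : DifferentiableOn ℂ (fun τ : ℂ => ((-s : ℝ) : ℂ) + τ) {z | 0 < z.im} := by fun_prop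
    refine (hg.comp h1 fun τ hτ => him τ hτ).congr fun τ hτ => ?_
    simp only [Function.comp, ofComplex_apply_of_im_pos hτ, ofComplex_apply_of_im_pos (him τ hτ)]
    congr 1
  · rw [g.sq, coe_vadd]
    simp only [Matrix.of_apply, Matrix.cons_val', Matrix.cons_val_zero, Matrix.cons_val_one,
      Matrix.cons_val_fin_one]
    push_cast
    rw [hcc]
    linear_combination (-(M : ℂ) * c₁) * hsc
  · simp only
    rw [vadd_vadd, neg_add_cancel, zero_vadd]
  · have h2 := factor_ne_zero g.mat τ
    have hdetc : ((g.mat 0 0 : ℤ) : ℂ) * ((g.mat 1 1 : ℤ) : ℂ) -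
      ((g.mat 0 1 : ℤ) : ℂ) * ((g.mat 1 0 : ℤ) : ℂ) = 1 := by exact_mod_cast hdet
    refine smul_vadd_eq ?_
    simp only [Matrix.of_apply, Matrix.cons_val', Matrix.cons_val_zero, Matrix.cons_val_one,
      Matrix.cons_val_fin_one]
    push_cast
    generalize ((g.mat 0 0 : ℤ) : ℂ) = a at *
    generalize ((g.mat 0 1 : ℤ) : ℂ) = b at *
    generalize ((g.mat 1 0 : ℤ) : ℂ) = c at *
    generalize ((g.mat 1 1 : ℤ) : ℂ) = d at *
    generalize (s : ℂ) = s at *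
    have h3 : c * (s + τ) + (d - M * c₁ * d ^ 2 * k) = c * τ + d := by
      rw [hcc]
      linear_combination ((M : ℂ) * c₁) * hsc
    have h4 : (M : ℂ) * ((a + M * c₁ * k) * (s + τ) +
        (b - d * b * M * c₁ * k - c₁ * d ^ 2 * k ^ 2)) = k * (c * τ + d) + M * (a * τ + b) := by
      rw [hcc] at hdetc ⊢
      linear_combination (a + M * c₁ * k) * hsc + (d * k) * hdetc
    rw [h3]
    field_simp
    linear_combination (c * τ + d) * h4

/-- If the translates of `X` are carried to translates by a common automorphy factor, then the
multiplier of `X` does not change under the twist by translations. -/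
theorem multiplier_eq_of_shift {X : ℍ → ℂ} {g h : Mp1Z} {M : ℕ} {κ : ℂ}
    (hX : ∀ (k : ℤ) (τ : ℍ), X ((k / M : ℝ) +ᵥ g.mat • τ) =
      κ * g.root τ * X (((g.mat 1 1 : ℤ) ^ 2 * k / M : ℝ) +ᵥ τ)) {k : ℤ}
    (hh : ∀ τ : ℍ, h.root ((((g.mat 1 1 : ℤ) ^ 2 * k / M : ℝ)) +ᵥ τ) = g.root τ ∧
        h.mat • ((((g.mat 1 1 : ℤ) ^ 2 * k / M : ℝ)) +ᵥ τ) = (k / M : ℝ) +ᵥ (g.mat • τ)) :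
    slash 1 X h UpperHalfPlane.I / X UpperHalfPlane.I =
      slash 1 X g UpperHalfPlane.I / X UpperHalfPlane.I := by
  have h1 : ∀ σ, slash 1 X h σ = κ * X σ := fun σ => by
    obtain ⟨τ, rfl⟩ : ∃ τ : ℍ, ((g.mat 1 1 : ℤ) ^ 2 * k / M : ℝ) +ᵥ τ = σ :=
      ⟨(-((g.mat 1 1 : ℤ) ^ 2 * k / M : ℝ)) +ᵥ σ, by
        rw [vadd_vadd, add_neg_cancel, zero_vadd]⟩
    have := g.root_ne_zero τ
    rw [slash, (hh τ).1, (hh τ).2, hX, zpow_neg, zpow_one]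
    field_simp
  have h2 : ∀ σ, slash 1 X g σ = κ * X σ := fun σ => by
    have := g.root_ne_zero σ
    have h3 := hX 0 σ
    simp only [Int.cast_zero, zero_div, mul_zero, zero_vadd] at h3
    rw [slash, h3, zpow_neg, zpow_one]
    field_simp
  rw [h1, h2]

/-! ### Symmetries of a Jacobi form -/

/-- The symmetries of a Jacobi form `φ` of integral index `m` that enter the analysis of its
Fourier expansion: periodicity in `z`, the parity `κ` and the multiplier `α` of `τ ↦ τ + 1`. -/
structure HasJacobiSymmetries (φ : ℍ → ℂ → ℂ) (m : ℤ) (κ α : ℂ) : Prop where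
  differentiableOn : ∀ τ : ℍ, DifferentiableOn ℂ (φ τ) (latticePoints τ)ᶜ
  add_one : ∀ (τ : ℍ) (z : ℂ), z ∉ latticePoints τ → φ τ (z + 1) = φ τ z
  add_tau : ∀ (τ : ℍ) (z : ℂ), z ∉ latticePoints τ → φ τ (z + τ) = e (-(m * (τ + 2 * z))) * φ τ z
  neg : ∀ (τ : ℍ) (z : ℂ), z ∉ latticePoints τ → φ τ (-z) = κ * φ τ z
  sq_eq_one : κ ^ 2 = 1
  vadd_one : ∀ (τ : ℍ) (z : ℂ), z ∉ latticePoints τ → φ ((1 : ℝ) +ᵥ τ) z = α * φ τ z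
  pow_eq_one : α ^ 24 = 1

theorem notMem_latticePoints_of_im {τ z : ℂ} (h0 : 0 < z.im) (h1 : z.im < τ.im) :
    z ∉ latticePoints τ := by
  rintro ⟨a, b, rfl⟩
  simp only [Complex.add_im, Complex.mul_im, Complex.intCast_re, Complex.intCast_im, zero_mul,
    add_zero] at h0 h1
  have hτ : 0 < τ.im := h0.trans h1
  have ha : (0 : ℝ) < a := pos_of_mul_pos_left h0 hτ.le
  have ha1 : (a : ℝ) < 1 := by
    by_contra h
    nlinarith
  have : 0 < a := by exact_mod_cast ha
  have : a < 1 := by exact_mod_cast ha1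
  omega

theorem notMem_latticePoints_of_e_ne_one {τ z : ℂ} (h1 : |z.im| < τ.im) (hz : e z ≠ 1) :
    z ∉ latticePoints τ := by
  rintro ⟨a, b, rfl⟩
  simp only [Complex.add_im, Complex.mul_im, Complex.intCast_re, Complex.intCast_im, zero_mul,
    add_zero] at h1
  have hτ : 0 < τ.im := (abs_nonneg _).trans_lt h1
  rw [abs_mul, abs_of_pos hτ] at h1
  have h2 : |(a : ℝ)| < 1 := by
    by_contra h
    nlinarith
  have h3 : |a| < 1 := by exact_mod_cast h2
  have h4 : a = 0 := Int.abs_lt_one_iff.1 h3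
  exact hz (by simp [h4])

theorem neg_mem_latticePoints {τ z : ℂ} : -z ∈ latticePoints τ ↔ z ∈ latticePoints τ := by
  constructor <;> rintro ⟨a, b, h⟩ <;> refine ⟨-a, -b, ?_⟩ <;> push_cast
  · linear_combination -h
  · linear_combination -h

theorem add_int_mem_latticePoints {τ z : ℂ} (k : ℤ) :
    z + k ∈ latticePoints τ ↔ z ∈ latticePoints τ := by
  constructor <;> rintro ⟨a, b, h⟩
  · exact ⟨a, b - k, by push_cast; linear_combination h⟩
  · exact ⟨a, b + k, by push_cast; linear_combination h⟩

/-! ### Rationality of the exponents and the reflection of the coefficients -/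

/-- The Fourier expansion of `φ`, valid for `0 < Im z < ε Im τ`. -/
def ExpandsOn (φ : ℍ → ℂ → ℂ) (c : ℚ → ℚ → ℂ) (ε : ℝ) : Prop :=
  ∀ (τ : ℍ) (z : ℂ), 0 < z.im → z.im < ε * τ.im →
    HasSum (fun p : ℚ × ℚ => c p.1 p.2 * e (p.1 * τ + p.2 * z)) (φ τ z)

section Reflection

variable {φ : ℍ → ℂ → ℂ} {m : ℤ} {κ α : ℂ} {c : ℚ → ℚ → ℂ} {ε : ℝ}

/-- Invariance under `z ↦ z + 1` forces `r` to be integral, and invariance under `τ ↦ τ + 1` up to a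
24th root of unity forces `24n` to be integral. -/
theorem ExpandsOn.exponents (hc : ExpandsOn φ c ε) (h : HasJacobiSymmetries φ m κ α) (hε : 0 < ε)
    (hε1 : ε ≤ 1 / 2) {n r : ℚ} (hne : c n r ≠ 0) : (∃ k : ℤ, r = k) ∧ ∃ k : ℤ, 24 * n = k := by
  have hI : ∀ x : ℝ, ((x +ᵥ UpperHalfPlane.I : ℍ) : ℂ).im = 1 := fun x => by
    rw [coe_vadd]; simp
  have him : ∀ (y : ℝ), ((y : ℂ) + (ε / 2 : ℝ) * Complex.I).im = ε / 2 := fun y => by simp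
  have hs : ∀ (x y : ℝ), HasSum (fun p : ℚ × ℚ =>
      c p.1 p.2 * e (p.1 * (x + (UpperHalfPlane.I : ℍ)) + p.2 * (y + (ε / 2 : ℝ) * Complex.I)))
      (φ (x +ᵥ UpperHalfPlane.I) (y + (ε / 2 : ℝ) * Complex.I)) := fun x y => by
    have := hc (x +ᵥ UpperHalfPlane.I) (y + (ε / 2 : ℝ) * Complex.I) (by rw [him]; positivity)
      (by rw [him, ← coe_im, hI]; linarith)
    simpa only [coe_vadd] using this
  have hL : ∀ x y : ℝ, ((y : ℂ) + (ε / 2 : ℝ) * Complex.I) ∉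
      latticePoints ((x +ᵥ UpperHalfPlane.I : ℍ) : ℂ) := fun x y =>
    notMem_latticePoints_of_im (by rw [him]; positivity) (by rw [him, hI]; linarith)
  constructor
  · have h0 := coeff_eq_zero_of_hasSum_zero₂ (a := fun n r => c n r * (e r - 1))
      (τ₀ := (UpperHalfPlane.I : ℍ)) (z₀ := (ε / 2 : ℝ) * Complex.I) (fun x y => ?_) n r
    · have h1 : e r = 1 := by
        rcases mul_eq_zero.1 h0 with h | h
        · exact absurd h hne
        · exact sub_eq_zero.1 h
      obtain ⟨k, hk⟩ := (e_eq_one_iff _).1 h1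
      exact ⟨k, by exact_mod_cast hk⟩
    · have h1 := hs x (y + 1)
      have h2 : ((y + 1 : ℝ) : ℂ) + (ε / 2 : ℝ) * Complex.I =
          (y + (ε / 2 : ℝ) * Complex.I) + 1 := by push_cast; ring
      rw [h2, h.add_one _ _ (hL x y)] at h1
      have h3 := h1.sub (hs x y)
      rw [sub_self] at h3
      refine h3.congr_fun fun p => ?_
      rw [mul_add (p.2 : ℂ) _ 1, ← add_assoc, e_add _ ((p.2 : ℂ) * 1), mul_one]
      ring
  · have h0 := coeff_eq_zero_of_hasSum_zero₂ (a := fun n r => c n r * (e n - α))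
      (τ₀ := (UpperHalfPlane.I : ℍ)) (z₀ := (ε / 2 : ℝ) * Complex.I) (fun x y => ?_) n r
    · have h1 : e n = α := by
        rcases mul_eq_zero.1 h0 with h | h
        · exact absurd h hne
        · exact sub_eq_zero.1 h
      have h2 : e ((24 : ℕ) * n) = 1 := by rw [e_nat_mul, h1, h.pow_eq_one]
      obtain ⟨k, hk⟩ := (e_eq_one_iff _).1 h2
      exact ⟨k, by exact_mod_cast hk⟩
    · have h1 := hs (x + 1) y
      have h2 : ((x + 1 : ℝ) +ᵥ UpperHalfPlane.I : ℍ) = (1 : ℝ) +ᵥ (x +ᵥ UpperHalfPlane.I) := by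
        rw [vadd_vadd, add_comm]
      rw [h2, h.vadd_one _ _ (hL x y)] at h1
      have h3 := h1.sub ((hs x y).mul_left α)
      rw [sub_self] at h3
      refine h3.congr_fun fun p => ?_
      have h4 : (p.1 : ℂ) * (((x + 1 : ℝ) : ℂ) + (UpperHalfPlane.I : ℍ)) +
          p.2 * (y + (ε / 2 : ℝ) * Complex.I) = p.1 + (p.1 * (x + (UpperHalfPlane.I : ℍ)) +
          p.2 * (y + (ε / 2 : ℝ) * Complex.I)) := by push_cast; ring
      rw [h4, e_add (p.1 : ℂ)]
      ring

theorem ExpandsOn.hasSum_int (hc : ExpandsOn φ c ε) (h : HasJacobiSymmetries φ m κ α) (hε : 0 < ε)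
    (hε1 : ε ≤ 1 / 2) {τ : ℍ} {z : ℂ} (h0 : 0 < z.im) (h1 : z.im < ε * τ.im) :
    HasSum (fun p : ℚ × ℤ => c p.1 p.2 * e (p.1 * τ + p.2 * z)) (φ τ z) := by
  have hinj : Function.Injective fun p : ℚ × ℤ => ((p.1, (p.2 : ℚ)) : ℚ × ℚ) := by
    rintro ⟨a, b⟩ ⟨a', b'⟩ h
    simpa using h
  refine ((hinj.hasSum_iff ?_).2 (hc τ z h0 h1)).congr_fun fun p => ?_
  · rintro ⟨n, r⟩ hp
    have : c n r = 0 := by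
      by_contra hne
      obtain ⟨⟨k, hk⟩, -⟩ := hc.exponents h hε hε1 hne
      exact hp ⟨(n, k), by simp [hk]⟩
    simp [this]
  · simp

/-- The reflection `z ↦ τ - z` of the strip `0 < Im z < Im τ`, which combines the parity of `φ`
with its quasi-periodicity, yields a symmetry of the Fourier coefficients. -/
theorem ExpandsOn.coeff_reflect (hc : ExpandsOn φ c ε) (h : HasJacobiSymmetries φ m κ α)
    (hε : 0 < ε) (hε1 : ε ≤ 1 / 2) (n : ℚ) (r : ℤ) :
    c n r = κ * c (n + r + m) ((-r - 2 * m : ℤ) : ℚ) := by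
  have key : ∀ τ : ℍ, ∃ A : ℂ, HasSum (fun n : ℚ => c n r * e (n * τ)) A ∧
      HasSum (fun n : ℚ => κ * c (n + r + m) ((-r - 2 * m : ℤ) : ℚ) * e (n * τ)) A := by
    intro τ
    have hτ := τ.im_pos
    set y : ℝ := ε / 2 * τ.im with hy
    have hy0 : 0 < y := by positivity
    have hy1 : y < ε * τ.im := by rw [hy]; nlinarith
    have hy2 : y < τ.im := by nlinarith
    have him : ∀ (x y' : ℝ), ((x : ℂ) + y' * Complex.I).im = y' := fun x y' => by simp
    have H1 := hasSum_fourierCoeff (D := fun n r => c n r) (τ := τ) (y := y) (F := φ τ)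
      (fun x => hc.hasSum_int h hε hε1 (by rw [him]; exact hy0) (by rw [him]; exact hy1)) r
    have H2 := hasSum_fourierCoeff
      (D := fun n r => κ * c (n + r + m) ((-r - 2 * m : ℤ) : ℚ)) (τ := τ)
      (y := τ.im - y) (F := φ τ) (fun x => ?_) r
    · refine ⟨_, H1, ?_⟩
      have hI := integral_line_eq_of_periodic (F := fun z => φ τ z * e (-r * z)) (y₁ := y)
        (y₂ := τ.im - y) ?_ ?_
      · rw [hI]
        exact H2
      · have hd : Differentiable ℂ fun z => e (-r * z) := by fun_prop
        refine ((h.differentiableOn τ).mono fun z hz => ?_).mul hd.differentiableOn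
        have hz' := Set.uIcc_of_le (show y ≤ τ.im - y by nlinarith) ▸ hz
        exact notMem_latticePoints_of_im (hy0.trans_le hz'.1) (by rw [coe_im]; linarith [hz'.2])
      · intro z hz
        have hz' := Set.uIcc_of_le (show y ≤ τ.im - y by nlinarith) ▸ hz
        rw [h.add_one τ z
          (notMem_latticePoints_of_im (hy0.trans_le hz'.1) (by rw [coe_im]; linarith [hz'.2]))]
        congr 1
        rw [mul_add, mul_one]
        exact_mod_cast e_add_int (-r * z) (-r)
    · set z : ℂ := x + ((τ.im - y : ℝ) : ℂ) * Complex.I with hz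
      have hzim : z.im = τ.im - y := him _ _
      have hzL : -z ∉ latticePoints τ := by
        rw [neg_mem_latticePoints]
        exact notMem_latticePoints_of_im (by linarith) (by rw [coe_im]; linarith)
      have hw : (τ - z : ℂ).im = y := by rw [Complex.sub_im, hzim, coe_im]; ring
      have h3 := hc.hasSum_int h hε hε1 (τ := τ) (z := τ - z) (by rw [hw]; exact hy0)
        (by rw [hw]; exact hy1)
      have h4 : φ τ z = κ * e (m * (τ - 2 * z)) * φ τ (τ - z) := by
        have h5 := h.add_tau τ (-z) hzL
        rw [h.neg τ z (fun h => hzL (neg_mem_latticePoints.2 h)), neg_add_eq_sub, e_neg] at h5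
        rw [h5, show (m : ℂ) * (τ + 2 * -z) = m * (τ - 2 * z) by ring]
        have := e_ne_zero (m * (τ - 2 * z))
        field_simp
        rw [h.sq_eq_one, mul_one]
      rw [h4]
      have hinv : Function.Involutive fun p : ℚ × ℤ =>
          ((p.1 + p.2 + m, -p.2 - 2 * m) : ℚ × ℤ) := fun p => by
        ext
        · push_cast; ring
        · simp only; ring
      refine ((hinv.toPerm.hasSum_iff.2 h3).mul_left (κ * e (m * (τ - 2 * z)))).congr_fun
        fun p => ?_
      simp only [Function.comp, Function.Involutive.coe_toPerm]
      rw [mul_assoc, mul_assoc, mul_left_comm (e (m * (τ - 2 * z))), ← e_add]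
      congr 3
      push_cast
      ring
  choose A hA using key
  have := coeff_eq_of_hasSum (b := fun n : ℚ => c n r)
    (b' := fun n : ℚ => κ * c (n + r + m) ((-r - 2 * m : ℤ) : ℚ)) (τ₀ := (UpperHalfPlane.I : ℍ))
    (F := fun x => A (x +ᵥ UpperHalfPlane.I))
    (fun x => by simpa only [coe_vadd] using (hA (x +ᵥ UpperHalfPlane.I)).1)
    (fun x => by simpa only [coe_vadd] using (hA (x +ᵥ UpperHalfPlane.I)).2)
  exact congrFun this n

end Reflection

/-! ### Multiplication by a power of `e(z) - 1` -/

/-- For every integer `ν`, the power series of `(X - 1)^ν` at `0` has integral coefficients. -/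
theorem exists_binomial_series (ν : ℤ) : ∃ b : ℕ → ℤ, ∀ x : ℂ, ‖x‖ < 1 →
    HasSum (fun k => (b k : ℂ) * x ^ k) ((x - 1) ^ ν) := by
  have hmul : ∀ {F G : ℂ → ℂ} {b b' : ℕ → ℤ},
      (∀ x : ℂ, ‖x‖ < 1 → HasSum (fun k => (b k : ℂ) * x ^ k) (F x)) →
      (∀ x : ℂ, ‖x‖ < 1 → HasSum (fun k => (b' k : ℂ) * x ^ k) (G x)) →
      ∃ b'' : ℕ → ℤ, ∀ x : ℂ, ‖x‖ < 1 → HasSum (fun k => (b'' k : ℂ) * x ^ k) (F x * G x) := by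
    intro F G b b' hF hG
    refine ⟨fun n => ∑ p ∈ Finset.HasAntidiagonal.antidiagonal n, b p.1 * b' p.2, fun x hx => ?_⟩
    have h1 := (hF x hx).summable.norm
    have h2 := (hG x hx).summable.norm
    have h3 := tsum_mul_tsum_eq_tsum_sum_antidiagonal_of_summable_norm h1 h2
    rw [(hF x hx).tsum_eq, (hG x hx).tsum_eq] at h3
    have h4 := (summable_norm_sum_mul_antidiagonal_of_summable_norm h1 h2).of_norm
    rw [h3]
    refine h4.hasSum.congr_fun fun n => ?_
    push_cast
    rw [Finset.sum_mul]
    refine Finset.sum_congr rfl fun p hp => ?_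
    rw [← Finset.HasAntidiagonal.mem_antidiagonal.1 hp, pow_add]
    ring
  have hx1 : ∀ {x : ℂ}, ‖x‖ < 1 → x - 1 ≠ 0 := fun {x} hx h => by
    rw [sub_eq_zero.1 h, norm_one] at hx
    exact lt_irrefl _ hx
  induction ν using Int.induction_on with
  | zero =>
    refine ⟨fun k => if k = 0 then 1 else 0, fun x _ => ?_⟩
    rw [zpow_zero]
    refine (hasSum_ite_eq 0 (1 : ℂ)).congr_fun fun k => ?_
    split_ifs with hk <;> simp [hk]
  | succ n ih =>
    obtain ⟨b, hb⟩ := ih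
    obtain ⟨b', hb'⟩ := hmul (G := fun x => x - 1)
      (b' := fun k => if k = 1 then 1 else if k = 0 then -1 else 0) hb fun x _ => by
        have := (hasSum_ite_eq 1 x).add (hasSum_ite_eq 0 (-1 : ℂ))
        rw [← sub_eq_add_neg] at this
        refine this.congr_fun fun k => ?_
        rcases k with _ | _ | k <;> simp
    exact ⟨b', fun x hx => by rw [zpow_add_one₀ (hx1 hx)]; exact hb' x hx⟩
  | pred n ih =>
    obtain ⟨b, hb⟩ := ih
    obtain ⟨b', hb'⟩ := hmul (G := fun x => (x - 1)⁻¹) (b' := fun _ => -1) hb fun x hx => by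
      have := (hasSum_geometric_of_norm_lt_one hx).neg
      rw [← neg_sub x 1, inv_neg, neg_neg] at this
      refine this.congr_fun fun k => ?_
      simp
    exact ⟨b', fun x hx => by rw [zpow_sub_one₀ (hx1 hx)]; exact hb' x hx⟩

/-- The coefficients of the product of `∑ₖ b(k) Xᵏ` and `∑ᵣ a(r) Xʳ`. -/
noncomputable def convCoeff (b : ℕ → ℤ) (a : ℤ → ℂ) (t : ℤ) : ℂ := ∑' k : ℕ, (b k : ℂ) * a (t - k)

theorem hasSum_convCoeff {ι : Type*} {b : ℕ → ℤ} {B z : ℂ} {a : ι → ℤ → ℂ} {q : ι → ℂ} {A : ℂ}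
    (hq : ∀ i, q i ≠ 0) (hb : HasSum (fun k => (b k : ℂ) * e z ^ k) B)
    (ha : HasSum (fun p : ι × ℤ => a p.1 p.2 * (q p.1 * e (p.2 * z))) A) :
    HasSum (fun p : ι × ℤ => convCoeff b (a p.1) p.2 * (q p.1 * e (p.2 * z))) (B * A) := by
  set f : ι × ℤ → ℂ := fun p => a p.1 p.2 * (q p.1 * e (p.2 * z)) with hf
  set g : ℕ → ℂ := fun k => (b k : ℂ) * e z ^ k with hg
  have h1 : HasSum (fun x : (ι × ℤ) × ℕ => f x.1 * g x.2) (A * B) :=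
    ha.mul hb (summable_mul_of_summable_norm ha.summable.norm hb.summable.norm)
  let E : (ι × ℤ) × ℕ ≃ (ι × ℤ) × ℕ :=
    { toFun := fun p => ((p.1.1, p.1.2 - p.2), p.2)
      invFun := fun p => ((p.1.1, p.1.2 + p.2), p.2)
      left_inv := fun p => by simp
      right_inv := fun p => by simp }
  set F : (ι × ℤ) × ℕ → ℂ := fun p =>
    (b p.2 : ℂ) * a p.1.1 (p.1.2 - p.2) * (q p.1.1 * e (p.1.2 * z)) with hF
  have hFE : F = (fun x : (ι × ℤ) × ℕ => f x.1 * g x.2) ∘ E := by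
    funext ⟨⟨i, t⟩, k⟩
    have : e (t * z) = e (((t - k : ℤ) : ℂ) * z) * e z ^ k := by
      rw [← e_nat_mul, ← e_add]
      push_cast
      ring_nf
    simp only [hF, hf, hg, Function.comp_apply, E, Equiv.coe_fn_mk, this]
    ring
  have h2 : HasSum F (B * A) := by
    rw [mul_comm B, hFE]
    exact E.hasSum_iff.2 h1
  refine h2.prod_fiberwise fun p => ?_
  have h3 : Summable fun k : ℕ => F (p, k) :=
    h2.summable.comp_injective (Prod.mk_right_injective p)
  have h4 : q p.1 * e (p.2 * z) ≠ 0 := mul_ne_zero (hq _) (e_ne_zero _)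
  have h5 : Summable fun k : ℕ => (b k : ℂ) * a p.1 (p.2 - k) :=
    (summable_mul_right_iff h4).1 h3
  exact h5.hasSum.mul_right (q p.1 * e (p.2 * z))

/-! ### Removing the singularities at the integers -/

/-- The function `(e(z) - 1)^ν φ(τ, z)`, extended to the integers by the leading Laurent
coefficient `f` of `φ`. -/
noncomputable def regularized (φ : ℍ → ℂ → ℂ) (ν : ℤ) (f : ℍ → ℂ) (τ : ℍ) (z : ℂ) : ℂ :=
  if e z = 1 then f τ else (e z - 1) ^ ν * φ τ z

theorem tendsto_e_sub_one_div :
    Tendsto (fun z : ℂ => (e z - 1) / (2 * π * Complex.I * z)) (𝓝[≠] 0) (𝓝 1) := by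
  have h1 : HasDerivAt e (2 * π * Complex.I) 0 := by
    have h2 : HasDerivAt (fun x : ℂ => 2 * π * Complex.I * x) (2 * π * Complex.I) 0 := by
      simpa using (hasDerivAt_id (0 : ℂ)).const_mul (2 * π * Complex.I)
    have h3 := h2.cexp
    rw [mul_zero, Complex.exp_zero, one_mul] at h3
    exact h3
  have h3 := (hasDerivAt_iff_tendsto_slope.1 h1).div_const (2 * π * Complex.I)
  have h4 : (2 * π * Complex.I : ℂ) ≠ 0 := by simp
  rw [div_self h4] at h3
  refine h3.congr fun z => ?_
  rw [slope_def_field, e_zero, sub_zero, div_div, mul_comm z]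

theorem eventually_e_ne_one : ∀ᶠ z : ℂ in 𝓝[≠] 0, e z ≠ 1 := by
  have h1 : ∀ᶠ z : ℂ in 𝓝[≠] 0, z ∈ Metric.ball (0 : ℂ) 1 :=
    nhdsWithin_le_nhds (Metric.ball_mem_nhds _ one_pos)
  filter_upwards [h1, self_mem_nhdsWithin] with z hz hz0 h
  obtain ⟨n, rfl⟩ := (e_eq_one_iff z).1 h
  rw [Metric.mem_ball, dist_zero_right, Complex.norm_intCast] at hz
  have h2 : |n| < 1 := by exact_mod_cast hz
  exact hz0 (by simp [Int.abs_lt_one_iff.1 h2])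

section Regularized

variable {φ : ℍ → ℂ → ℂ} {m : ℤ} {κ α : ℂ} {c : ℚ → ℚ → ℂ} {ε : ℝ} {ν : ℤ} {f : ℍ → ℂ}

theorem HasJacobiSymmetries.add_int (h : HasJacobiSymmetries φ m κ α) {τ : ℍ} {z : ℂ}
    (hz : z ∉ latticePoints τ) (k : ℤ) : φ τ (z + k) = φ τ z := by
  have hk : ∀ k : ℤ, z + k ∉ latticePoints τ := fun k => by rwa [add_int_mem_latticePoints]
  induction k using Int.induction_on with
  | zero => simp
  | succ n ih =>
    rw [← ih, ← h.add_one τ _ (hk n)]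
    push_cast
    ring_nf
  | pred n ih =>
    rw [← ih, ← h.add_one τ _ (hk _)]
    push_cast
    ring_nf

theorem regularized_add_int (h : HasJacobiSymmetries φ m κ α) {τ : ℍ} {z : ℂ}
    (hz : |z.im| < τ.im) (k : ℤ) : regularized φ ν f τ (z + k) = regularized φ ν f τ z := by
  rw [regularized, regularized, e_add_int]
  split_ifs with h1
  · rfl
  · rw [h.add_int (notMem_latticePoints_of_e_ne_one hz h1)]

/-- The leading Laurent coefficient in powers of `e(z) - 1` is that in powers of `2πiz`. -/
theorem tendsto_regularized (hf : SpecializesTo φ ν f) (τ : ℍ) :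
    Tendsto (regularized φ ν f τ) (𝓝[≠] 0) (𝓝 (f τ)) := by
  have h1 := (tendsto_e_sub_one_div.zpow₀ ν (Or.inl one_ne_zero)).mul (hf.2 τ)
  rw [one_zpow, one_mul] at h1
  refine h1.congr' ?_
  filter_upwards [eventually_e_ne_one, self_mem_nhdsWithin] with z hz hz0
  have h2 : (2 * π * Complex.I * z : ℂ) ≠ 0 := by
    have : z ≠ 0 := hz0
    simp [this]
  rw [regularized, if_neg hz, div_zpow, ← mul_assoc, div_mul_cancel₀ _ (zpow_ne_zero _ h2)]

/-- The singularities at the integers are removable, by continuity. -/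
theorem differentiableAt_regularized (h : HasJacobiSymmetries φ m κ α) (hf : SpecializesTo φ ν f)
    {τ : ℍ} {z : ℂ} (hz : |z.im| < τ.im) : DifferentiableAt ℂ (regularized φ ν f τ) z := by
  have hopen : IsOpen {w : ℂ | |w.im| < τ.im ∧ e w ≠ 1} :=
    (isOpen_lt (f := fun w : ℂ => |w.im|) (g := fun _ => τ.im) (by fun_prop) (by fun_prop)).inter
      (isOpen_ne_fun (f := e) (g := fun _ => 1) continuous_e (by fun_prop))
  have hreg : ∀ w : ℂ, |w.im| < τ.im → e w ≠ 1 →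
      DifferentiableAt ℂ (regularized φ ν f τ) w := by
    intro w hw hw1
    have hmem := hopen.mem_nhds (show w ∈ {w : ℂ | |w.im| < τ.im ∧ e w ≠ 1} from ⟨hw, hw1⟩)
    have h1 : DifferentiableAt ℂ (φ τ) w := ((h.differentiableOn τ).mono fun v hv =>
      notMem_latticePoints_of_e_ne_one hv.1 hv.2).differentiableAt hmem
    have h2 : DifferentiableAt ℂ (fun w => (e w - 1) ^ ν * φ τ w) w := by
      refine DifferentiableAt.mul ?_ h1
      exact DifferentiableAt.zpow (differentiable_e w |>.sub_const 1) (Or.inl (sub_ne_zero.2 hw1))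
    refine h2.congr_of_eventuallyEq ?_
    filter_upwards [hmem] with v hv
    rw [regularized, if_neg hv.2]
  by_cases hz1 : e z = 1
  · obtain ⟨k, rfl⟩ := (e_eq_one_iff z).1 hz1
    have h0 : ContinuousAt (regularized φ ν f τ) 0 := by
      rw [continuousAt_iff_punctured_nhds]
      simpa [regularized] using tendsto_regularized hf τ
    have hd0 : DifferentiableAt ℂ (regularized φ ν f τ) 0 := by
      refine (analyticAt_of_differentiable_on_punctured_nhds_of_continuousAt ?_ h0).differentiableAt
      have h3 : ∀ᶠ w : ℂ in 𝓝[≠] 0, |w.im| < τ.im :=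
        nhdsWithin_le_nhds ((isOpen_lt (by fun_prop) (by fun_prop)).mem_nhds
          (by simpa using τ.im_pos))
      filter_upwards [h3, eventually_e_ne_one] with w hw hw1 using hreg w hw hw1
    have hd1 : DifferentiableAt ℂ (fun w => regularized φ ν f τ (w - k)) k := by
      have h4 : DifferentiableAt ℂ (regularized φ ν f τ) ((k : ℂ) - k) := by simpa using hd0
      exact DifferentiableAt.comp (g := regularized φ ν f τ) (f := fun w : ℂ => w - k) (k : ℂ) h4
        (by fun_prop)
    refine hd1.congr_of_eventuallyEq ?_
    filter_upwards [(isOpen_lt (f := fun w : ℂ => |w.im|) (g := fun _ => τ.im) (by fun_prop)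
      (by fun_prop)).mem_nhds hz] with w hw
    have := regularized_add_int (ν := ν) (f := f) h (z := w - k) (by simpa using hw) k
    rw [← this, sub_add_cancel]
  · exact hreg z hz hz1

/-! ### The expansion of the regularized form -/

/-- The Fourier coefficients of `(e(z) - 1)^ν φ`, where `b` is the sequence of coefficients of
`(X - 1)^ν`. -/
noncomputable def regCoeff (b : ℕ → ℤ) (c : ℚ → ℚ → ℂ) (n : ℚ) (t : ℤ) : ℂ :=
  convCoeff b (fun r => c n r) t

variable {b : ℕ → ℤ} {n₀ : ℚ}

theorem exists_of_regCoeff_ne_zero {n : ℚ} {t : ℤ} (h : regCoeff b c n t ≠ 0) :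
    ∃ k : ℕ, c n ((t - k : ℤ) : ℚ) ≠ 0 := by
  by_contra! hk
  exact h (by simp only [regCoeff, convCoeff, hk, mul_zero, tsum_zero])

/-- A coefficient `c(n, r)` can be nonzero only if `n + r + m ≥ n₀`. -/
theorem ExpandsOn.coeff_eq_zero (hc : ExpandsOn φ c ε) (h : HasJacobiSymmetries φ m κ α)
    (hε : 0 < ε) (hε1 : ε ≤ 1 / 2) (hn₀ : ∀ n < n₀, ∀ r, c n r = 0) {n : ℚ} {r : ℤ}
    (hr : n + r + m < n₀) : c n r = 0 := by
  rw [hc.coeff_reflect h hε hε1, hn₀ _ hr, mul_zero]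

theorem ExpandsOn.regCoeff_eq_zero (hc : ExpandsOn φ c ε) (h : HasJacobiSymmetries φ m κ α)
    (hε : 0 < ε) (hε1 : ε ≤ 1 / 2) (hn₀ : ∀ n < n₀, ∀ r, c n r = 0) {n : ℚ} {t : ℤ}
    (ht : n + t + m < n₀) : regCoeff b c n t = 0 := by
  by_contra hne
  obtain ⟨k, hk⟩ := exists_of_regCoeff_ne_zero hne
  refine hk (hc.coeff_eq_zero h hε hε1 hn₀ ?_)
  have : (0 : ℚ) ≤ k := by positivity
  push_cast
  linarith

theorem ExpandsOn.hasSum_regularized (hc : ExpandsOn φ c ε) (h : HasJacobiSymmetries φ m κ α)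
    (hε : 0 < ε) (hε1 : ε ≤ 1 / 2)
    (hb : ∀ x : ℂ, ‖x‖ < 1 → HasSum (fun k => (b k : ℂ) * x ^ k) ((x - 1) ^ ν))
    {τ : ℍ} {z : ℂ} (h0 : 0 < z.im) (h1 : z.im < ε * τ.im) :
    HasSum (fun p : ℚ × ℤ => regCoeff b c p.1 p.2 * e (p.1 * τ + p.2 * z))
      (regularized φ ν f τ z) := by
  have hz := norm_e_lt_one h0
  have hz1 : e z ≠ 1 := fun h => by simp [h] at hz
  rw [regularized, if_neg hz1]
  have h2 := hasSum_convCoeff (ι := ℚ) (a := fun n r => c n r) (q := fun n => e (n * τ))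
    (fun n => e_ne_zero _) (hb _ hz) ((hc.hasSum_int h hε hε1 h0 h1).congr_fun fun p => by
      rw [← e_add])
  refine h2.congr_fun fun p => ?_
  rw [← e_add]
  rfl

/-- For `Im z < 0` the regularized function is expanded by means of the parity of `φ`. -/
theorem ExpandsOn.hasSum_regularized_of_neg (hc : ExpandsOn φ c ε)
    (h : HasJacobiSymmetries φ m κ α) (hε : 0 < ε) (hε1 : ε ≤ 1 / 2)
    (hb : ∀ x : ℂ, ‖x‖ < 1 → HasSum (fun k => (b k : ℂ) * x ^ k) ((x - 1) ^ ν))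
    {τ : ℍ} {z : ℂ} (h0 : z.im < 0) (h1 : -z.im < ε * τ.im) :
    HasSum (fun p : ℚ × ℤ => κ * (-1) ^ ν * regCoeff b c p.1 (ν - p.2) * e (p.1 * τ + p.2 * z))
      (regularized φ ν f τ z) := by
  have hzn := norm_e_lt_one (z := -z) (by simpa using h0)
  have hz1' : e (-z) ≠ 1 := fun h => by simp [h] at hzn
  have hz1 : e z ≠ 1 := fun h => hz1' (by simp [e_neg, h])
  have hτ := τ.im_pos
  have hzL : z ∉ latticePoints τ :=
    notMem_latticePoints_of_e_ne_one (by rw [abs_of_neg h0, coe_im]; nlinarith) hz1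
  have h2 := hc.hasSum_regularized (f := f) h hε hε1 hb (τ := τ) (z := -z) (by simpa using h0)
    (by simpa using h1)
  have h3 : regularized φ ν f τ z = κ * (-1) ^ ν * e (ν * z) * regularized φ ν f τ (-z) := by
    rw [regularized, regularized, if_neg hz1, if_neg hz1', h.neg τ z hzL]
    have h4 : e z - 1 = (-1) * e z * (e (-z) - 1) := by
      rw [e_neg]
      have := e_ne_zero z
      field_simp
      ring
    rw [e_int_mul, h4, mul_zpow, mul_zpow]
    linear_combination (-(-1) ^ ν * e z ^ ν * (e (-z) - 1) ^ ν * φ τ z) * h.sq_eq_one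
  rw [h3]
  have hinv : Function.Involutive fun p : ℚ × ℤ => ((p.1, ν - p.2) : ℚ × ℤ) := fun p => by simp
  refine ((hinv.toPerm.hasSum_iff.2 h2).mul_left (κ * (-1) ^ ν * e (ν * z))).congr_fun fun p => ?_
  simp only [Function.comp, Function.Involutive.coe_toPerm]
  have h5 : e (p.1 * τ + p.2 * z) = e (ν * z) * e (p.1 * τ + ((ν - p.2 : ℤ) : ℂ) * -z) := by
    rw [← e_add]
    push_cast
    ring_nf
  rw [h5]
  ring

/-- Shifting the contour across the real line shows that the coefficients of `(e(z) - 1)^ν φ`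
inherit the parity of `φ`. -/
theorem ExpandsOn.regCoeff_symm (hc : ExpandsOn φ c ε) (h : HasJacobiSymmetries φ m κ α)
    (hε : 0 < ε) (hε1 : ε ≤ 1 / 2) (hf : SpecializesTo φ ν f)
    (hb : ∀ x : ℂ, ‖x‖ < 1 → HasSum (fun k => (b k : ℂ) * x ^ k) ((x - 1) ^ ν)) (n : ℚ) (t : ℤ) :
    regCoeff b c n t = κ * (-1) ^ ν * regCoeff b c n (ν - t) := by
  have key : ∀ τ : ℍ, ∃ A : ℂ, HasSum (fun n : ℚ => regCoeff b c n t * e (n * τ)) A ∧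
      HasSum (fun n : ℚ => κ * (-1) ^ ν * regCoeff b c n (ν - t) * e (n * τ)) A := by
    intro τ
    have hτ := τ.im_pos
    set y : ℝ := ε / 2 * τ.im with hy
    have hy0 : 0 < y := by positivity
    have hy1 : y < ε * τ.im := by rw [hy]; nlinarith
    have hy2 : y < τ.im := by nlinarith
    have him : ∀ (x y' : ℝ), ((x : ℂ) + y' * Complex.I).im = y' := fun x y' => by simp
    have H1 := hasSum_fourierCoeff (D := regCoeff b c) (τ := τ) (y := y)
      (F := regularized φ ν f τ) (fun x => hc.hasSum_regularized h hε hε1 hb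
        (by rw [him]; exact hy0) (by rw [him]; exact hy1)) t
    have H2 := hasSum_fourierCoeff (D := fun n t => κ * (-1) ^ ν * regCoeff b c n (ν - t)) (τ := τ)
      (y := -y) (F := regularized φ ν f τ) (fun x => hc.hasSum_regularized_of_neg h hε hε1 hb
        (by rw [him]; linarith) (by rw [him]; linarith)) t
    refine ⟨_, H1, ?_⟩
    have hI := integral_line_eq_of_periodic (F := fun z => regularized φ ν f τ z * e (-t * z))
      (y₁ := y) (y₂ := -y) ?_ ?_
    · rw [hI]
      exact H2
    · have hd : Differentiable ℂ fun z => e (-t * z) := by fun_prop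
      intro z hz
      have hz' := Set.uIcc_of_ge (show -y ≤ y by linarith) ▸ hz
      exact ((differentiableAt_regularized h hf
        (abs_lt.2 ⟨by linarith [hz'.1], by linarith [hz'.2]⟩)).mul (hd z)).differentiableWithinAt
    · intro z hz
      have hz' := Set.uIcc_of_ge (show -y ≤ y by linarith) ▸ hz
      have h1 := regularized_add_int (ν := ν) (f := f) h (z := z) (τ := τ)
        (abs_lt.2 ⟨by linarith [hz'.1], by linarith [hz'.2]⟩) 1
      rw [Int.cast_one] at h1
      rw [h1]
      congr 1
      rw [mul_add, mul_one]
      exact_mod_cast e_add_int (-t * z) (-t)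
  choose A hA using key
  have := coeff_eq_of_hasSum (b := fun n : ℚ => regCoeff b c n t)
    (b' := fun n : ℚ => κ * (-1) ^ ν * regCoeff b c n (ν - t)) (τ₀ := (UpperHalfPlane.I : ℍ))
    (F := fun x => A (x +ᵥ UpperHalfPlane.I))
    (fun x => by simpa only [coe_vadd] using (hA (x +ᵥ UpperHalfPlane.I)).1)
    (fun x => by simpa only [coe_vadd] using (hA (x +ᵥ UpperHalfPlane.I)).2)
  exact congrFun this n

/-- For fixed `n` only finitely many coefficients of `(e(z) - 1)^ν φ` are nonzero. -/
theorem ExpandsOn.finite_support_regCoeff (hc : ExpandsOn φ c ε)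
    (h : HasJacobiSymmetries φ m κ α) (hε : 0 < ε) (hε1 : ε ≤ 1 / 2) (hf : SpecializesTo φ ν f)
    (hb : ∀ x : ℂ, ‖x‖ < 1 → HasSum (fun k => (b k : ℂ) * x ^ k) ((x - 1) ^ ν))
    (hn₀ : ∀ n < n₀, ∀ r, c n r = 0) (n : ℚ) : (Function.support (regCoeff b c n)).Finite := by
  have h1 : ∀ t, regCoeff b c n t ≠ 0 → ⌈n₀ - n - m⌉ ≤ t := fun t ht => by
    rw [Int.ceil_le]
    by_contra hlt
    exact ht (hc.regCoeff_eq_zero h hε hε1 hn₀ (by linarith))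
  refine (Set.finite_Icc ⌈n₀ - n - m⌉ (ν - ⌈n₀ - n - m⌉)).subset fun t ht => ⟨h1 t ht, ?_⟩
  have h2 : regCoeff b c n (ν - t) ≠ 0 := fun h0 => ht (by
    rw [hc.regCoeff_symm h hε hε1 hf hb, h0, mul_zero])
  have := h1 _ h2
  omega

/-- The expansion of `(e(z) - 1)^ν φ` is valid on the real line. -/
theorem ExpandsOn.hasSum_regularized_real (hc : ExpandsOn φ c ε)
    (h : HasJacobiSymmetries φ m κ α) (hε : 0 < ε) (hε1 : ε ≤ 1 / 2) (hf : SpecializesTo φ ν f)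
    (hb : ∀ x : ℂ, ‖x‖ < 1 → HasSum (fun k => (b k : ℂ) * x ^ k) ((x - 1) ^ ν)) (τ : ℍ) (x : ℝ) :
    HasSum (fun p : ℚ × ℤ => regCoeff b c p.1 p.2 * e (p.1 * τ + p.2 * x))
      (regularized φ ν f τ x) := by
  have hτ := τ.im_pos
  set y : ℝ := ε / 2 * τ.im with hy
  have hy0 : 0 < y := by positivity
  have hy1 : y < ε * τ.im := by rw [hy]; nlinarith
  have him : ∀ (x y' : ℝ), ((x : ℂ) + y' * Complex.I).im = y' := fun x y' => by simp
  have H1 := hc.hasSum_regularized (f := f) h hε hε1 hb (τ := τ) (z := x + y * Complex.I)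
    (by rw [him]; exact hy0) (by rw [him]; exact hy1)
  have H2 := hc.hasSum_regularized_of_neg (f := f) h hε hε1 hb (τ := τ)
    (z := x + (-y : ℝ) * Complex.I) (by rw [him]; linarith) (by rw [him]; linarith)
  simp_rw [← hc.regCoeff_symm h hε hε1 hf hb] at H2
  have hbound := H1.summable.norm.add H2.summable.norm
  -- The terms at height `η ∈ [0, y]` are dominated by those at the heights `y` and `-y`.
  have hle : ∀ η ∈ Set.Icc 0 y, ∀ p : ℚ × ℤ,
      ‖regCoeff b c p.1 p.2 * e (p.1 * τ + p.2 * (x + η * Complex.I))‖ ≤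
      ‖regCoeff b c p.1 p.2 * e (p.1 * τ + p.2 * (x + y * Complex.I))‖ +
      ‖regCoeff b c p.1 p.2 * e (p.1 * τ + p.2 * (x + (-y : ℝ) * Complex.I))‖ := by
    intro η hη p
    have him2 : ∀ y' : ℝ, ((p.1 : ℂ) * τ + p.2 * (x + y' * Complex.I)).im =
        p.1 * τ.im + p.2 * y' := fun y' => by simp
    simp only [norm_mul, norm_e, him2]
    rw [← mul_add]
    refine mul_le_mul_of_nonneg_left ?_ (norm_nonneg _)
    have hπ := Real.pi_pos
    rcases le_total 0 (p.2 : ℝ) with hp | hp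
    · refine le_add_of_nonneg_of_le (Real.exp_nonneg _) (Real.exp_le_exp.2 ?_)
      have : (p.2 : ℝ) * -y ≤ p.2 * η := mul_le_mul_of_nonneg_left (by linarith [hη.1]) hp
      nlinarith
    · refine le_add_of_le_of_nonneg (Real.exp_le_exp.2 ?_) (Real.exp_nonneg _)
      have : (p.2 : ℝ) * y ≤ p.2 * η := mul_le_mul_of_nonpos_left hη.2 hp
      nlinarith
  have hsum : Summable fun p : ℚ × ℤ => regCoeff b c p.1 p.2 * e (p.1 * τ + p.2 * x) := by
    refine Summable.of_norm_bounded hbound fun p => ?_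
    simpa using hle 0 ⟨le_rfl, hy0.le⟩ p
  have hev : ∀ᶠ η : ℝ in 𝓝[>] 0, η ∈ Set.Ioo 0 y := Ioo_mem_nhdsGT hy0
  have hlim1 : Tendsto (fun η : ℝ => ∑' p : ℚ × ℤ, regCoeff b c p.1 p.2 *
      e (p.1 * τ + p.2 * (x + η * Complex.I))) (𝓝[>] 0)
      (𝓝 (∑' p : ℚ × ℤ, regCoeff b c p.1 p.2 * e (p.1 * τ + p.2 * x))) := by
    refine tendsto_tsum_of_dominated_convergence hbound (fun p => ?_) ?_
    · have hcont : Continuous fun η : ℝ => regCoeff b c p.1 p.2 *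
          e (p.1 * τ + p.2 * (x + η * Complex.I)) := by fun_prop
      have := (hcont.tendsto 0).mono_left (nhdsWithin_le_nhds (s := Set.Ioi 0))
      simpa using this
    · filter_upwards [hev] with η hη p using hle η ⟨hη.1.le, hη.2.le⟩ p
  have hlim2 : Tendsto (fun η : ℝ => regularized φ ν f τ (x + η * Complex.I)) (𝓝[>] 0)
      (𝓝 (regularized φ ν f τ x)) := by
    have h1 : ContinuousAt (regularized φ ν f τ) ((x : ℂ) + (0 : ℝ) * Complex.I) :=
      (differentiableAt_regularized h hf (by rw [him]; simpa using hτ)).continuousAt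
    have hcont : Continuous fun η : ℝ => (x : ℂ) + η * Complex.I := by fun_prop
    have h2 := (h1.tendsto.comp (hcont.tendsto 0)).mono_left
      (nhdsWithin_le_nhds (s := Set.Ioi 0))
    simpa [Function.comp_def] using h2
  have heq : ∀ᶠ η : ℝ in 𝓝[>] 0, ∑' p : ℚ × ℤ, regCoeff b c p.1 p.2 *
      e (p.1 * τ + p.2 * (x + η * Complex.I)) = regularized φ ν f τ (x + η * Complex.I) := by
    filter_upwards [hev] with η hη
    exact (hc.hasSum_regularized h hε hε1 hb (by rw [him]; exact hη.1)
      (by rw [him]; linarith [hη.2])).tsum_eq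
  rw [← tendsto_nhds_unique (hlim1.congr' heq) hlim2]
  exact hsum.hasSum

/-- The trigonometric polynomial `∑ₜ D(n, t) e(tz)`, where `D` are the coefficients of
`(e(z) - 1)^ν φ`. -/
noncomputable def regSlice (b : ℕ → ℤ) (c : ℚ → ℚ → ℂ) (n : ℚ) (z : ℂ) : ℂ :=
  ∑' t : ℤ, regCoeff b c n t * e (t * z)

/-- The expansion of the regularized function in powers of `e(τ)`, for real `z`. -/
theorem ExpandsOn.hasSum_regSlice (hc : ExpandsOn φ c ε)
    (h : HasJacobiSymmetries φ m κ α) (hε : 0 < ε) (hε1 : ε ≤ 1 / 2) (hf : SpecializesTo φ ν f)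
    (hb : ∀ x : ℂ, ‖x‖ < 1 → HasSum (fun k => (b k : ℂ) * x ^ k) ((x - 1) ^ ν)) (τ : ℍ) (x : ℝ) :
    HasSum (fun n : ℚ => regSlice b c n x * e (n * τ)) (regularized φ ν f τ x) := by
  have H := hc.hasSum_regularized_real h hε hε1 hf hb τ x
  refine H.prod_fiberwise (g := fun n : ℚ => regSlice b c n x * e (n * τ)) fun n => ?_
  have h1 : Summable fun t : ℤ => regCoeff b c n t * e (n * τ + t * x) :=
    H.summable.prod_factor n
  have h2 : ∀ t : ℤ, regCoeff b c n t * e (n * τ + t * x) =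
      regCoeff b c n t * e (t * x) * e (n * τ) := fun t => by
    rw [add_comm, e_add]; ring
  have h3 : Summable fun t : ℤ => regCoeff b c n t * e (t * x) :=
    (summable_mul_right_iff (e_ne_zero (n * τ))).1 (h1.congr h2)
  exact (h3.hasSum.mul_right (e (n * τ))).congr_fun h2

/-- Up to a power of `e(z/2)`, the leading Fourier coefficient of `φ` is a trigonometric
polynomial. -/
theorem ExpandsOn.leadingCoeff_eq (hc : ExpandsOn φ c ε)
    (h : HasJacobiSymmetries φ m κ α) (hε : 0 < ε) (hε1 : ε ≤ 1 / 2)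
    (hb : ∀ x : ℂ, ‖x‖ < 1 → HasSum (fun k => (b k : ℂ) * x ^ k) ((x - 1) ^ ν)) (n : ℚ) {z : ℂ}
    (hz : 0 < z.im) : leadingCoeff c ν n z = e (-(ν * (z / 2))) * regSlice b c n z := by
  -- Choose `τ` high enough for the expansion to converge at `(τ, z)`.
  have hy : 0 < 2 * z.im / ε := by positivity
  have H := hc.hasSum_int h hε hε1
    (τ := ⟨(2 * z.im / ε : ℝ) * Complex.I, by simpa using hy⟩) (z := z) hz
    (by simp [UpperHalfPlane.im]; field_simp; linarith)
  set τ : ℍ := ⟨(2 * z.im / ε : ℝ) * Complex.I, by simpa using hy⟩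
  have h1 : Summable fun r : ℤ => c n r * e (n * τ + r * z) :=
    H.summable.prod_factor n
  have h2 : Summable fun r : ℤ => c n r * e (r * z) := by
    refine (summable_mul_right_iff (e_ne_zero (n * τ))).1 (h1.congr fun r => ?_)
    rw [add_comm, e_add]; ring
  have h3 : ∑' r : ℚ, c n r * e (r * z) = ∑' r : ℤ, c n r * e (r * z) := by
    have hinj : Function.Injective (fun r : ℤ => (r : ℚ)) := Int.cast_injective
    refine (((hinj.hasSum_iff (f := fun r : ℚ => c n r * e (r * z)) ?_).1 ?_).tsum_eq)
    · intro r hr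
      have : c n r = 0 := by
        by_contra hne
        obtain ⟨⟨k, hk⟩, -⟩ := hc.exponents h hε hε1 hne
        exact hr ⟨k, hk.symm⟩
      simp [this]
    · simpa [Function.comp_def] using h2.hasSum
  have h4 := hasSum_convCoeff (ι := Unit) (a := fun _ r => c n r) (q := fun _ => 1) (z := z)
    (A := ∑' r : ℤ, c n r * e (r * z)) (fun _ => one_ne_zero) (hb _ (norm_e_lt_one hz)) (by
      rw [← (Equiv.punitProd ℤ).symm.hasSum_iff]
      simpa [Function.comp_def] using h2.hasSum)
  have h5 : regSlice b c n z = (e z - 1) ^ ν * ∑' r : ℤ, c n r * e (r * z) := by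
    rw [← (Equiv.punitProd ℤ).symm.hasSum_iff] at h4
    refine HasSum.tsum_eq ?_
    simpa [Function.comp_def, regCoeff] using h4
  rw [leadingCoeff, h3, h5, ← mul_assoc]
  congr 1
  have h6 : e (z / 2) - e (-z / 2) = e (-(z / 2)) * (e z - 1) := by
    rw [mul_sub, ← e_add, mul_one]
    ring_nf
  rw [h6, mul_zpow, ← e_int_mul]
  ring_nf

end Regularized

/-! ### Divisibility by a cyclotomic polynomial and vanishing at torsion points -/

open Polynomial in
/-- A trigonometric polynomial is, up to a power of `e(z)`, a polynomial in `e(z)`. -/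
theorem exists_polynomial_of_finite_support {D : ℤ → ℂ} (hD : (Function.support D).Finite) :
    ∃ (k : ℤ) (Q : ℂ[X]), (∀ i : ℕ, Q.coeff i = D (i + k)) ∧
      ∀ z : ℂ, ∑' t : ℤ, D t * e (t * z) = e (k * z) * Q.eval (e z) := by
  obtain ⟨k, hk⟩ := hD.bddBelow
  have hk' : ∀ t, D t ≠ 0 → k ≤ t := fun t ht => hk ht
  refine ⟨k, ∑ t ∈ hD.toFinset, monomial (t - k).toNat (D t), fun i => ?_, fun z => ?_⟩
  · rw [finsetSum_coeff]
    simp only [coeff_monomial]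
    rw [Finset.sum_eq_single (i + k)]
    · simp
    · intro t ht hne
      have := hk' t (by simpa using ht)
      rw [if_neg]
      omega
    · intro h
      simp only [Set.Finite.mem_toFinset, Function.mem_support, not_not] at h
      simp [h]
  · rw [tsum_eq_sum (s := hD.toFinset) (fun t ht => by
      simp only [Set.Finite.mem_toFinset, Function.mem_support, not_not] at ht
      simp [ht]), eval_finsetSum, Finset.mul_sum]
    refine Finset.sum_congr rfl fun t ht => ?_
    have h1 := hk' t (by simpa using ht)
    rw [eval_monomial, ← e_nat_mul, mul_left_comm, ← e_add]
    have h2 : (((t - k).toNat : ℕ) : ℂ) = t - k := by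
      have : (((t - k).toNat : ℤ) : ℂ) = ((t - k : ℤ) : ℂ) := by
        rw [Int.toNat_of_nonneg (by omega)]
      push_cast at this
      simpa using this
    rw [h2]
    ring_nf

theorem laurentEval_T (n : ℤ) (x : ℂ) : laurentEval (LaurentPolynomial.T n) x = e (n * x) := by
  rw [laurentEval, LaurentPolynomial.eval₂_T, e_int_mul]
  exact Units.val_zpow_eq_zpow_val _ _

theorem laurentEval_mul (P Q : ℂ[T;T⁻¹]) (x : ℂ) :
    laurentEval (P * Q) x = laurentEval P x * laurentEval Q x := by
  simp [laurentEval]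

theorem laurentEval_aeval_T (n : ℤ) (p : Polynomial ℂ) (x : ℂ) :
    laurentEval (Polynomial.aeval (LaurentPolynomial.T n : ℂ[T;T⁻¹]) p) x = p.eval (e (n * x)) := by
  induction p using Polynomial.induction_on' with
  | add p q hp hq =>
    rw [map_add, Polynomial.eval_add, ← hp, ← hq]
    simp [laurentEval]
  | monomial k a =>
    have h1 : Polynomial.aeval (LaurentPolynomial.T n : ℂ[T;T⁻¹]) (Polynomial.monomial k a) =
        LaurentPolynomial.C a * LaurentPolynomial.T (k * n) := by
      rw [Polynomial.aeval_monomial, LaurentPolynomial.T_pow]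
      rfl
    rw [h1, laurentEval_mul, laurentEval_T, Polynomial.eval_monomial, ← e_nat_mul]
    simp [laurentEval, mul_assoc]

theorem continuous_laurentEval (P : ℂ[T;T⁻¹]) : Continuous (laurentEval P) := by
  induction P using LaurentPolynomial.induction_on' with
  | add p q hp hq =>
    have : laurentEval (p + q) = fun x => laurentEval p x + laurentEval q x := by
      ext x; simp [laurentEval]
    rw [this]
    exact hp.add hq
  | C_mul_T n a =>
    have : laurentEval (LaurentPolynomial.C a * LaurentPolynomial.T n) =
        fun x => a * e (n * x) := by
      ext x
      rw [laurentEval_mul, laurentEval_T]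
      simp [laurentEval]
    rw [this]
    exact continuous_const.mul (continuous_e.comp (by fun_prop))

theorem isPrimitiveRoot_e_div {ℓ : ℕ} (hℓ : ℓ.Prime) {j : ℤ} (hj : ¬(ℓ : ℤ) ∣ j) :
    IsPrimitiveRoot (e (j / ℓ)) ℓ := by
  have := Fact.mk hℓ
  have h0 : (ℓ : ℂ) ≠ 0 := by exact_mod_cast hℓ.ne_zero
  have h1 : e (j / ℓ) ^ ℓ = 1 := by
    rw [← e_nat_mul, mul_div_cancel₀ _ h0, e_int]
  have h2 : e (j / ℓ) ≠ 1 := by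
    intro h
    obtain ⟨n, hn⟩ := (e_eq_one_iff _).1 h
    rw [div_eq_iff h0] at hn
    exact hj ⟨n, by rw [mul_comm]; exact_mod_cast hn⟩
  have := IsPrimitiveRoot.orderOf (e (j / ℓ))
  rwa [orderOf_eq_prime h1 h2] at this

/-- A point of the real line is a limit of points of the upper half plane. -/
theorem eq_of_eq_on_upper {F G : ℂ → ℂ} (hF : Continuous F) (hG : Continuous G)
    (h : ∀ z : ℂ, 0 < z.im → F z = G z) (x : ℝ) : F x = G x := by
  have h1 : Continuous fun η : ℝ => (x : ℂ) + η * Complex.I := by fun_prop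
  have h2 : ∀ {F : ℂ → ℂ}, Continuous F →
      Tendsto (fun η : ℝ => F (x + η * Complex.I)) (𝓝[>] 0) (𝓝 (F x)) := fun hF => by
    have := ((hF.comp h1).tendsto 0).mono_left (nhdsWithin_le_nhds (s := Set.Ioi 0))
    simpa [Function.comp_def] using this
  refine tendsto_nhds_unique ((h2 hF).congr' ?_) (h2 hG)
  filter_upwards [self_mem_nhdsWithin] with η hη
  exact h _ (by simpa using hη)

section TrigonometricPolynomials

variable {ℓ : ℕ} {D : ℤ → ℂ} {F : ℂ → ℂ} {ν : ℤ}

theorem continuous_trigSum (hD : (Function.support D).Finite) :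
    Continuous fun z : ℂ => ∑' t : ℤ, D t * e (t * z) := by
  obtain ⟨k, Q, -, hQ⟩ := exists_polynomial_of_finite_support hD
  simp_rw [hQ]
  exact (continuous_e.comp (by fun_prop)).mul (Q.continuous.comp continuous_e)

/-- The function `F` is only given for `Im z > 0`; its divisibility by the cyclotomic polynomial
gives zeros at the real points `j/ℓ` by continuity. -/
theorem trigSum_eq_zero_of_cyclotomicDvd (hℓ : ℓ.Prime) (hD : (Function.support D).Finite)
    (hF : ∀ z : ℂ, 0 < z.im → F z = e (-(ν * (z / 2))) * ∑' t : ℤ, D t * e (t * z))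
    (hdvd : CyclotomicDvd ℓ F) {j : ℤ} (hj : ¬(ℓ : ℤ) ∣ j) :
    ∑' t : ℤ, D t * e (t * (j / ℓ)) = 0 := by
  obtain ⟨d, P, hd, hP, R, hR⟩ := hdvd
  have h1 := eq_of_eq_on_upper
    (F := fun z => e (-(ν * (z / 2))) * ∑' t : ℤ, D t * e (t * z))
    (G := fun z => laurentEval P (z / d))
    ((continuous_e.comp (by fun_prop)).mul (continuous_trigSum hD))
    ((continuous_laurentEval P).comp (by fun_prop))
    (fun z hz => by rw [← hF z hz, hP z hz]) (j / ℓ : ℝ)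
  have hd0 : (d : ℂ) ≠ 0 := by exact_mod_cast hd.ne'
  have h2 : laurentEval P ((j / ℓ : ℂ) / d) = 0 := by
    rw [hR, laurentEval_mul, laurentEval_aeval_T, Int.cast_natCast, mul_div_cancel₀ _ hd0]
    have := (isPrimitiveRoot_e_div hℓ hj).isRoot_cyclotomic hℓ.pos
    rw [Polynomial.IsRoot] at this
    rw [this, zero_mul]
  push_cast at h1
  rw [h2] at h1
  exact (mul_eq_zero.1 h1).resolve_left (e_ne_zero _)

theorem cyclotomic_dvd_of_forall (hℓ : ℓ.Prime) {Q : Polynomial ℂ}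
    (hQ : ∀ j : ℤ, ¬(ℓ : ℤ) ∣ j → Q.eval (e (j / ℓ)) = 0) : Polynomial.cyclotomic ℓ ℂ ∣ Q := by
  have h0 : (ℓ : ℂ) ≠ 0 := by exact_mod_cast hℓ.ne_zero
  have h1 : ¬(ℓ : ℤ) ∣ 1 := by
    intro h
    exact hℓ.one_lt.ne' (by exact_mod_cast Int.eq_one_of_dvd_one (by positivity) h)
  have hp := isPrimitiveRoot_e_div hℓ h1
  have : NeZero ℓ := ⟨hℓ.ne_zero⟩
  rw [Polynomial.cyclotomic_eq_prod_X_sub_primitiveRoots hp]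
  refine Finset.prod_dvd_of_coprime ?_ fun ζ hζ => ?_
  · intro x _ y _ hxy
    exact Polynomial.pairwise_coprime_X_sub_C Function.injective_id hxy
  · rw [Polynomial.dvd_iff_isRoot]
    rw [mem_primitiveRoots hℓ.pos] at hζ
    obtain ⟨i, -, hi, rfl⟩ := hp.isPrimitiveRoot_iff.1 hζ
    have h2 : e (((1 : ℤ) : ℂ) / ℓ) ^ i = e (((i : ℤ) : ℂ) / ℓ) := by
      rw [← e_nat_mul]
      push_cast
      ring_nf
    rw [Polynomial.IsRoot, h2]
    refine hQ _ fun h => ?_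
    have h3 : ℓ ∣ i := by exact_mod_cast h
    have := Nat.dvd_gcd h3 dvd_rfl
    rw [hi] at this
    exact hℓ.one_lt.ne' (Nat.dvd_one.1 this)

theorem cyclotomicDvd_of_trigSum_eq_zero (hℓ : ℓ.Prime) (hD : (Function.support D).Finite)
    (hF : ∀ z : ℂ, 0 < z.im → F z = e (-(ν * (z / 2))) * ∑' t : ℤ, D t * e (t * z))
    (hzero : ∀ j : ℤ, ¬(ℓ : ℤ) ∣ j → ∑' t : ℤ, D t * e (t * (j / ℓ)) = 0) :
    CyclotomicDvd ℓ F := by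
  obtain ⟨k, Q, -, hQ⟩ := exists_polynomial_of_finite_support hD
  obtain ⟨R, hR⟩ := cyclotomic_dvd_of_forall (Q := Q) hℓ fun j hj => by
    have := hzero j hj
    rw [hQ] at this
    exact (mul_eq_zero.1 this).resolve_left (e_ne_zero _)
  -- `e(z/2)` is needed because of the factor `e(-νz/2)`.
  refine ⟨2, LaurentPolynomial.T (2 * k - ν) * Polynomial.aeval (LaurentPolynomial.T 2) Q, two_pos,
    fun z hz => ?_, ?_⟩
  · rw [hF z hz, hQ, laurentEval_mul, laurentEval_T, laurentEval_aeval_T, ← mul_assoc, ← e_add]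
    push_cast
    ring_nf
  · rw [hR, map_mul, mul_left_comm]
    exact dvd_mul_right _ _

/-- The ring of `ℓ`-integral complex numbers. -/
def ellIntegralSubring (hℓ : ℓ.Prime) : Subring ℂ where
  carrier := {x | IsEllIntegral ℓ x}
  mul_mem' := by
    rintro x y ⟨s, hs, hx⟩ ⟨t, ht, hy⟩
    refine ⟨s * t, (Nat.prime_iff_prime_int.1 hℓ).not_dvd_mul hs ht, ?_⟩
    have h1 : ((s * t : ℤ) : ℂ) * (x * y) = (s * x) * (t * y) := by push_cast; ring
    rw [h1]
    exact hx.mul hy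
  one_mem' := ⟨1, fun h => hℓ.one_lt.ne'
    (by exact_mod_cast Int.eq_one_of_dvd_one (by positivity) h), by simpa using isIntegral_one⟩
  add_mem' := by
    rintro x y ⟨s, hs, hx⟩ ⟨t, ht, hy⟩
    refine ⟨s * t, (Nat.prime_iff_prime_int.1 hℓ).not_dvd_mul hs ht, ?_⟩
    have h1 : ∀ n : ℤ, IsIntegral ℤ (n : ℂ) := fun n => isIntegral_algebraMap (R := ℤ) (A := ℂ)
    have h2 : ((s * t : ℤ) : ℂ) * (x + y) = t * (s * x) + s * (t * y) := by push_cast; ring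
    rw [h2]
    exact ((h1 t).mul hx).add ((h1 s).mul hy)
  zero_mem' := ⟨1, fun h => hℓ.one_lt.ne'
    (by exact_mod_cast Int.eq_one_of_dvd_one (by positivity) h), by simpa using isIntegral_zero⟩
  neg_mem' := by
    rintro x ⟨s, hs, hx⟩
    exact ⟨s, hs, by simpa using hx.neg⟩

/-- A trigonometric polynomial with `ℓ`-integral coefficients that vanishes at all primitive
`ℓ`-torsion points is divisible by the `ℓ`-th cyclotomic polynomial, whose value at `1` is `ℓ`. -/
theorem exists_ellIntegral_of_trigSum_eq_zero (hℓ : ℓ.Prime) (hD : (Function.support D).Finite)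
    (hint : ∀ t, IsEllIntegral ℓ (D t))
    (hzero : ∀ j : ℤ, ¬(ℓ : ℤ) ∣ j → ∑' t : ℤ, D t * e (t * (j / ℓ)) = 0) :
    ∃ x : ℂ, IsEllIntegral ℓ x ∧ ∑' t : ℤ, D t * e (t * 0) = ℓ * x := by
  have := Fact.mk hℓ
  obtain ⟨k, Q, hco, hQ⟩ := exists_polynomial_of_finite_support hD
  have hdvd := cyclotomic_dvd_of_forall (Q := Q) hℓ fun j hj => by
    have := hzero j hj
    rw [hQ] at this
    exact (mul_eq_zero.1 this).resolve_left (e_ne_zero _)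
  set R := ellIntegralSubring hℓ
  obtain ⟨q, rfl⟩ : ∃ q : Polynomial R, q.map R.subtype = Q := by
    have : Q ∈ Polynomial.lifts R.subtype := by
      rw [Polynomial.lifts_iff_coeff_lifts]
      exact fun i => ⟨⟨Q.coeff i, by rw [hco]; exact hint _⟩, rfl⟩
    exact (Polynomial.mem_lifts _).1 this
  have hmonic := Polynomial.cyclotomic.monic ℓ R
  have h1 : q %ₘ Polynomial.cyclotomic ℓ R = 0 := by
    refine Polynomial.map_injective R.subtype R.subtype_injective ?_
    rw [Polynomial.map_modByMonic _ hmonic, Polynomial.map_cyclotomic, Polynomial.map_zero]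
    exact (Polynomial.modByMonic_eq_zero_iff_dvd (Polynomial.cyclotomic.monic ℓ ℂ)).2 hdvd
  obtain ⟨s, hs⟩ := (Polynomial.modByMonic_eq_zero_iff_dvd hmonic).1 h1
  refine ⟨(s.eval 1 : R), (s.eval 1).2, ?_⟩
  rw [hQ, mul_zero, e_zero, one_mul, Polynomial.eval_one_map, hs, Polynomial.eval_mul,
    Polynomial.eval_one_cyclotomic_prime]
  simp

variable {φ : ℍ → ℂ → ℂ} {m : ℤ} {κ α : ℂ} {c : ℚ → ℚ → ℂ} {ε : ℝ} {n₀ : ℚ} {b : ℕ → ℤ}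

/-- The coefficients of `(e(z) - 1)^ν φ` are finite integral combinations of those of `φ`. -/
theorem ExpandsOn.isEllIntegral_regCoeff (hℓ : ℓ.Prime) (hc : ExpandsOn φ c ε)
    (h : HasJacobiSymmetries φ m κ α) (hε : 0 < ε) (hε1 : ε ≤ 1 / 2)
    (hn₀ : ∀ n < n₀, ∀ r, c n r = 0) (hint : ∀ n r, IsEllIntegral ℓ (c n r)) (n : ℚ) (t : ℤ) :
    IsEllIntegral ℓ (regCoeff b c n t) := by
  obtain ⟨K, hK⟩ := exists_nat_gt (n + t + m - n₀)
  rw [regCoeff, convCoeff, tsum_eq_sum (s := Finset.range K) (fun k hk => by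
    rw [hc.coeff_eq_zero h hε hε1 hn₀, mul_zero]
    have : (K : ℚ) ≤ k := by exact_mod_cast not_lt.1 (Finset.mem_range.not.1 hk)
    push_cast
    linarith)]
  refine (ellIntegralSubring hℓ).sum_mem fun k _ => (ellIntegralSubring hℓ).mul_mem ?_ (hint _ _)
  exact intCast_mem _ _

end TrigonometricPolynomials

/-! ### Symmetries of admissible Jacobi forms -/

theorem SpecializesTo.exists_ne_zero {φ : ℍ → ℂ → ℂ} {ν : ℤ} {f : ℍ → ℂ}
    (hf : SpecializesTo φ ν f) : ∃ (τ : ℍ) (z : ℂ), z ∉ latticePoints τ ∧ φ τ z ≠ 0 := by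
  obtain ⟨τ, hτ⟩ := Function.ne_iff.1 hf.1
  have h1 : ∀ᶠ z : ℂ in 𝓝[≠] 0, |z.im| < τ.im :=
    nhdsWithin_le_nhds ((isOpen_lt (f := fun w : ℂ => |w.im|) (g := fun _ => τ.im) (by fun_prop)
      (by fun_prop)).mem_nhds (by simpa using τ.im_pos))
  obtain ⟨z, hz, hz1, hz2⟩ := ((hf.2 τ).eventually_ne hτ |>.and
    (h1.and eventually_e_ne_one)).exists
  exact ⟨τ, z, notMem_latticePoints_of_e_ne_one hz1 hz2, right_ne_zero_of_mul hz⟩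

/-- The lift of the translation `τ ↦ τ + 1` to the metaplectic group. -/
def translation : Mp1Z where
  mat := ModularGroup.T
  root := fun _ => 1
  holo := mdifferentiable_const
  sq := fun τ => by simp [ModularGroup.coe_T]

theorem translation_smul (τ : ℍ) : translation.mat • τ = (1 : ℝ) +ᵥ τ := modular_T_smul τ

/-- A lift of minus the identity matrix to the metaplectic group. -/
def negOne : Mp1Z where
  mat := -1
  root := fun _ => Complex.I
  holo := mdifferentiable_const
  sq := fun τ => by simp

theorem mem_Gamma0Tilde {N : ℕ} {g : Mp1Z} : g ∈ Gamma0Tilde N ↔ (N : ℤ) ∣ g.mat 1 0 := by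
  change g.mat ∈ CongruenceSubgroup.Gamma0 N ↔ _
  rw [CongruenceSubgroup.Gamma0_mem, ZMod.intCast_zmod_eq_zero_iff_dvd]

theorem translation_mem (N : ℕ) : translation ∈ Gamma0Tilde N := by
  simp [mem_Gamma0Tilde, translation, ModularGroup.coe_T]

theorem negOne_mem (N : ℕ) : negOne ∈ Gamma0Tilde N := by
  simp [mem_Gamma0Tilde, negOne]

/-- The centre of the Heisenberg group acts by `e(m)`, so that a nonzero `φ` has integral index. Its
parity comes from minus the identity matrix. -/
theorem IsWeaklyHolomorphicJacobiForm.hasJacobiSymmetries {w : ℤ} {m : ℂ} {N : ℕ}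
    {χ : Mp1Z → ℂ} {φ : ℍ → ℂ → ℂ} (h : IsWeaklyHolomorphicJacobiForm w m (Gamma0Tilde N) χ φ)
    (hne : ∃ (τ : ℍ) (z : ℂ), z ∉ latticePoints τ ∧ φ τ z ≠ 0)
    (hχ : χ translation ≠ 0 → χ translation ^ 24 = 1) :
    ∃ (m' : ℤ) (κ α : ℂ), m = m' ∧ HasJacobiSymmetries φ m' κ α := by
  obtain ⟨τ₀, z₀, hz₀, hφ₀⟩ := hne
  obtain ⟨m', rfl⟩ : ∃ m' : ℤ, m = m' := by
    have := h.heisenberg_eq 0 0 1 τ₀ z₀ hz₀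
    simp only [heisenbergSlash, Int.cast_zero, Int.cast_one, zero_mul, mul_zero, zero_add, add_zero,
      mul_one, ne_eq, OfNat.ofNat_ne_zero, not_false_eq_true, zero_pow] at this
    exact (e_eq_one_iff m).1 (mul_right_cancel₀ hφ₀ (by rw [this, one_mul]))
  have hneg : ∀ (τ : ℍ) (z : ℂ), z ∉ latticePoints τ →
      φ τ (-z) = χ negOne * Complex.I ^ w * φ τ z := fun τ z hz => by
    have := h.slash_eq _ (negOne_mem N) τ z hz
    simp only [jacobiSlash, negOne] at this
    simp only [Matrix.SpecialLinearGroup.coe_neg, Matrix.SpecialLinearGroup.coe_one,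
      ModularGroup.SL_neg_smul, one_smul] at this
    simp only [Matrix.neg_apply, Matrix.one_apply, zpow_neg] at this
    simp [div_neg] at this
    rw [inv_mul_eq_iff_eq_mul₀ (zpow_ne_zero _ Complex.I_ne_zero)] at this
    rw [this]
    simp only [negOne]
    ring
  have hvadd : ∀ (τ : ℍ) (z : ℂ), z ∉ latticePoints τ →
      φ ((1 : ℝ) +ᵥ τ) z = χ translation * φ τ z := fun τ z hz => by
    have := h.slash_eq _ (translation_mem N) τ z hz
    rw [jacobiSlash, translation_smul] at this
    simpa [translation, ModularGroup.coe_T] using this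
  refine ⟨m', χ negOne * Complex.I ^ w, χ translation, rfl, ?_, ?_, ?_, hneg, ?_, hvadd, hχ ?_⟩
  · intro τ
    have hd : DifferentiableOn ℂ (fun z : ℂ => ((τ : ℂ), z)) (latticePoints τ)ᶜ := by fun_prop
    have := h.mero.holo.comp hd fun z hz => ⟨τ.im_pos, hz⟩
    simpa [Function.comp_def] using this
  · intro τ z hz
    have := h.heisenberg_eq 0 1 0 τ z hz
    simpa [heisenbergSlash] using this
  · intro τ z hz
    have := h.heisenberg_eq 1 0 0 τ z hz
    simp only [heisenbergSlash, Int.cast_zero, Int.cast_one, one_pow, one_mul, mul_one,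
      add_zero] at this
    rw [← this, ← mul_assoc, ← e_add, neg_add_cancel, e_zero, one_mul]
  · have h1 := hneg τ₀ (-z₀) (by rwa [neg_mem_latticePoints])
    rw [neg_neg, hneg τ₀ z₀ hz₀, ← mul_assoc, ← pow_two] at h1
    exact (mul_right_cancel₀ hφ₀ (by rw [← h1, one_mul]))
  · intro h0
    -- The point `τ₀` is the image of `-1 + τ₀` under the translation.
    have hz₁ : z₀ ∉ latticePoints ((-1 : ℝ) +ᵥ τ₀ : ℍ) := by
      rintro ⟨a, b, hab⟩
      refine hz₀ ⟨a, b - a, ?_⟩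
      rw [hab, coe_vadd]
      push_cast
      ring
    have := hvadd ((-1 : ℝ) +ᵥ τ₀) z₀ hz₁
    rw [h0, zero_mul, vadd_vadd, add_neg_cancel, zero_vadd] at this
    exact hφ₀ this

theorem dirichletChar_translation {N : ℕ} (χ : DirichletCharacter ℂ N) :
    dirichletChar χ translation = 1 := by
  simp [dirichletChar, translation, ModularGroup.coe_T]

theorem slash_translation (X : ℍ → ℂ) (τ : ℍ) : slash 1 X translation τ = X ((1 : ℝ) +ᵥ τ) := by
  rw [slash, translation_smul]
  simp [translation]

theorem theta_one_vadd (τ : ℍ) : theta ((1 : ℝ) +ᵥ τ) = theta τ := by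
  rw [theta_eq_thetaForm, theta_eq_thetaForm]
  refine (hasSum_thetaForm _ 0).unique ((hasSum_thetaForm τ 0).congr_fun fun n => ?_)
  have : (n : ℂ) ^ 2 * ((1 : ℝ) +ᵥ τ : ℍ) + n * 0 = ((n : ℂ) ^ 2 * τ + n * 0) + (n ^ 2 : ℤ) := by
    rw [coe_vadd]; push_cast; ring
  rw [this, e_add_int]

theorem eta_one_vadd (τ : ℍ) : eta ((1 : ℝ) +ᵥ τ) = e (1 / 24) * eta τ := by
  refine (hasSum_eta _).unique (((hasSum_eta τ).mul_left (e (1 / 24))).congr_fun fun k => ?_)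
  obtain ⟨j, hj⟩ : ∃ j : ℤ, k * (3 * k + 1) = j + j := by
    rcases Int.even_or_odd' k with ⟨i, rfl | rfl⟩
    · exact ⟨i * (3 * (2 * i) + 1), by ring⟩
    · exact ⟨(2 * i + 1) * (3 * i + 2), by ring⟩
  have hj' : (k : ℂ) * (3 * k + 1) = j + j := by exact_mod_cast hj
  have : (6 * (k : ℂ) + 1) ^ 2 * (((1 : ℝ) +ᵥ τ : ℍ) / 24) =
      (1 / 24 + (6 * k + 1) ^ 2 * (τ / 24)) + j := by
    rw [coe_vadd]; push_cast; linear_combination (1 / 2) * hj'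
  rw [this, e_add_int, e_add]
  ring

/-- The hypothesis excludes the junk value `0` that a zero of `θ` at `i` would give. -/
theorem thetaChar_translation_pow (h : thetaChar translation ≠ 0) :
    thetaChar translation ^ 24 = 1 := by
  rw [thetaChar, slash_translation, theta_one_vadd] at h ⊢
  rw [div_self (fun h0 => h (by rw [h0, div_zero])), one_pow]

/-- The hypothesis excludes the junk value `0` that a zero of `η` at `i` would give. -/
theorem etaChar_translation_pow (h : etaChar translation ≠ 0) :
    etaChar translation ^ 24 = 1 := by
  rw [etaChar, slash_translation, eta_one_vadd] at h ⊢
  rw [mul_div_cancel_right₀ _ (fun h0 => h (by rw [h0, div_zero])), ← e_nat_mul]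
  norm_num [e_one]

/-! ### Values at torsion points -/

/-- If `ℓ²` divides the lower left entry of `g`, the slash action of `g` permutes the values at
`ℓ`-torsion points. -/
theorem IsWeaklyHolomorphicJacobiForm.smul_torsion {w : ℤ} {m : ℤ} {N : ℕ}
    {χ : Mp1Z → ℂ} {φ : ℍ → ℂ → ℂ} (h : IsWeaklyHolomorphicJacobiForm w m (Gamma0Tilde N) χ φ)
    {ℓ : ℕ} (hℓ : ℓ ≠ 0) {g : Mp1Z} (hg : g ∈ Gamma0Tilde N) (hc : (ℓ ^ 2 : ℤ) ∣ g.mat 1 0)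
    {j : ℤ} (hj : ¬(ℓ : ℤ) ∣ g.mat 1 1 * j) (τ : ℍ) :
    φ (g.mat • τ) (j / ℓ) = g.root τ ^ w * χ g * φ τ ((g.mat 1 1 * j : ℤ) / ℓ) := by
  obtain ⟨c₁, hc₁⟩ := hc
  have hℓ0 : (ℓ : ℂ) ≠ 0 := by exact_mod_cast hℓ
  have hJ := factor_ne_zero g.mat τ
  have hc₁' : ((g.mat 1 0 : ℤ) : ℂ) = ℓ ^ 2 * c₁ := by rw [hc₁]; push_cast; ring
  set d := g.mat 1 1 with hd
  set x : ℂ := ((d * j : ℤ) : ℂ) / ℓ with hx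
  have hx' : (ℓ : ℂ) * x = d * j := by rw [hx, mul_div_cancel₀ _ hℓ0]; push_cast; ring
  have hxL : x ∉ latticePoints τ := by
    have him : x.im = 0 := by
      have : x = (((d * j : ℤ) / ℓ : ℝ) : ℂ) := by rw [hx]; push_cast; ring
      rw [this, Complex.ofReal_im]
    refine notMem_latticePoints_of_e_ne_one (by rw [him, abs_zero]; exact τ.im_pos) fun h1 => ?_
    obtain ⟨n, hn⟩ := (e_eq_one_iff x).1 h1
    rw [hn] at hx'
    exact hj ⟨n, by exact_mod_cast hx'.symm⟩
  set z : ℂ := (((g.mat 1 0 : ℤ) : ℂ) * τ + (d : ℂ)) * (j / ℓ) with hz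
  have hz' : z = x + (ℓ * c₁ * j : ℤ) * τ + (0 : ℤ) := by
    rw [hz, hx, hc₁']
    push_cast
    field_simp
    ring
  have hzL : z ∉ latticePoints τ := by
    rintro ⟨a, b, hab⟩
    refine hxL ⟨a - ℓ * c₁ * j, b, ?_⟩
    rw [hz'] at hab
    push_cast at hab ⊢
    linear_combination hab
  have h1 := h.slash_eq g hg τ z hzL
  have h2 := h.heisenberg_eq (ℓ * c₁ * j) 0 0 τ x hxL
  rw [heisenbergSlash, ← hz'] at h2
  rw [jacobiSlash, ← hd, mul_div_cancel_left₀ _ hJ] at h1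
  have h3 : ((m : ℂ) * (-((g.mat 1 0 : ℤ) : ℂ) * z ^ 2 / (((g.mat 1 0 : ℤ) : ℂ) * τ + (d : ℂ)))) =
      -(m * (((ℓ * c₁ * j : ℤ) : ℂ) ^ 2 * τ + 2 * (ℓ * c₁ * j : ℤ) * x + (0 : ℤ))) +
        (m * c₁ * d * j ^ 2 : ℤ) := by
    have h4 : z ^ 2 / (((g.mat 1 0 : ℤ) : ℂ) * τ + (d : ℂ)) =
        (((g.mat 1 0 : ℤ) : ℂ) * τ + (d : ℂ)) * (j / ℓ) ^ 2 := by
      rw [hz]; field_simp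
    rw [mul_div_assoc, h4, hc₁', hx]
    push_cast
    field_simp
    ring
  rw [h3, e_add_int] at h1
  rw [← h2]
  have h5 := zpow_ne_zero w (g.root_ne_zero τ)
  rw [zpow_neg, mul_assoc, inv_mul_eq_iff_eq_mul₀ h5, e_neg,
    inv_mul_eq_iff_eq_mul₀ (e_ne_zero _)] at h1
  rw [h1]
  ring

/-! ### Transfer of vanishing coefficients along multiplication by squares -/

theorem e_sub_div_eq_one_iff {M : ℕ} (hM : 0 < M) {x β : ℚ} :
    e (((x : ℂ) - β) / M) = 1 ↔ x ∈ arithProg M β := by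
  have hM0 : (M : ℂ) ≠ 0 := by exact_mod_cast hM.ne'
  rw [e_eq_one_iff]
  refine exists_congr fun t => ?_
  rw [div_eq_iff hM0, sub_eq_iff_eq_add, mul_comm]
  norm_cast

open Classical in
/-- Averaging over translates by multiples of `1/M` isolates the coefficients whose indices `n`
satisfy `sn ∈ Mℤ + β`. -/
theorem hasSum_projection {H : ℍ → ℂ} {a : ℚ → ℂ}
    (hH : ∀ τ : ℍ, HasSum (fun n : ℚ => a n * e (n * τ)) (H τ))
    (ha : ∀ n, a n ≠ 0 → ∃ k : ℤ, 24 * n = k) {M Q : ℕ} (hM : 0 < M) {β : ℚ}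
    (hβ : ∃ k : ℤ, Q * β = k) (hQ : 24 ∣ Q) (s : ℤ) (τ : ℍ) :
    HasSum (fun n : ℚ => ((if s * n ∈ arithProg M β then ((M * Q : ℕ) : ℂ) else 0) * a n) *
      e (n * τ)) (∑ k ∈ Finset.range (M * Q), e (-(k * (β / M))) * H ((s * k / M : ℝ) +ᵥ τ)) := by
  have hM0 : (M : ℂ) ≠ 0 := by exact_mod_cast hM.ne'
  refine (hasSum_sum fun (k : ℕ) _ =>
    (hH ((s * k / M : ℝ) +ᵥ τ)).mul_left (e (-(k * (β / M))))).congr_fun fun n => ?_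
  by_cases h0 : a n = 0
  · simp [h0]
  have hper : e ((M * Q : ℕ) * (((s * n : ℚ) - β : ℂ) / M)) = 1 := by
    obtain ⟨k₁, hk₁⟩ := ha n h0
    obtain ⟨k₂, hk₂⟩ := hβ
    obtain ⟨q, rfl⟩ := hQ
    refine (e_eq_one_iff _).2 ⟨q * s * k₁ - k₂, ?_⟩
    have h1 : (24 : ℂ) * n = k₁ := by exact_mod_cast hk₁
    have h2 : ((24 * q : ℕ) : ℂ) * β = k₂ := by exact_mod_cast hk₂
    push_cast at h2 ⊢
    field_simp
    linear_combination q * s * h1 - h2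
  have h1 := sum_range_e_mul hper
  simp_rw [e_sub_div_eq_one_iff hM] at h1
  rw [← h1, Finset.sum_mul, Finset.sum_mul]
  refine Finset.sum_congr rfl fun k _ => ?_
  have h2 : e (n * ((s * k / M : ℝ) +ᵥ τ : ℍ)) = e (k * (s * n / M)) * e (n * τ) := by
    rw [← e_add, coe_vadd]
    push_cast
    ring_nf
  have h3 : e (k * (((s * n : ℚ) - β : ℂ) / M)) = e (-(k * (β / M))) * e (k * (s * n / M)) := by
    rw [← e_add]
    push_cast
    ring_nf
  rw [h2, h3]
  ring

/-- Invariance of a multiplier under replacing `g` by `t_{k/M} g t_{-d²k/M}`, where `t_x` is the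
translation by `x` and `d` is the lower right entry of `g`. -/
def IsTwistInvariant (χ : Mp1Z → ℂ) (M N : ℕ) : Prop :=
  ∀ (g h : Mp1Z) (k : ℤ), (96 * M ^ 2 : ℤ) ∣ g.mat 1 0 → 24 ∣ g.mat 0 1 → g.mat 1 1 % 12 = 1 →
    (N : ℤ) ∣ h.mat 1 1 - g.mat 1 1 →
    (∀ τ : ℍ, h.root ((((g.mat 1 1 : ℤ) ^ 2 * k / M : ℝ)) +ᵥ τ) = g.root τ ∧
      h.mat • ((((g.mat 1 1 : ℤ) ^ 2 * k / M : ℝ)) +ᵥ τ) = (k / M : ℝ) +ᵥ (g.mat • τ)) → χ h = χ g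

theorem dirichletChar_eq {N : ℕ} (χ : DirichletCharacter ℂ N) {g h : Mp1Z}
    (hN : (N : ℤ) ∣ h.mat 1 1 - g.mat 1 1) : dirichletChar χ h = dirichletChar χ g := by
  rw [dirichletChar, dirichletChar, ((ZMod.intCast_eq_intCast_iff_dvd_sub _ _ N).2 hN).symm]

theorem isTwistInvariant_theta {M N : ℕ} (hM : 0 < M) (χ : DirichletCharacter ℂ N) :
    IsTwistInvariant (fun g => dirichletChar χ g * thetaChar g) M N := by
  intro g h k hc _ _ hN hgh
  obtain ⟨κ, hκ⟩ := theta_shift (g := g) hM (Dvd.dvd.trans ⟨24, by ring⟩ hc)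
  simp only [dirichletChar_eq χ hN, thetaChar, multiplier_eq_of_shift hκ hgh]

theorem isTwistInvariant_eta {M N : ℕ} (hM : 0 < M) (χ : DirichletCharacter ℂ N) :
    IsTwistInvariant (fun g => dirichletChar χ g * etaChar g) M N := by
  intro g h k hc hb hd hN hgh
  obtain ⟨κ, hκ⟩ := eta_shift (g := g) hM hc hb hd
  simp only [dirichletChar_eq χ hN, etaChar, multiplier_eq_of_shift hκ hgh]

/-- A lower row `(c, d)` with `d` prime to `24c` completes to a matrix whose upper right entry is
divisible by `24`. -/
theorem exists_mp1Z_of_isCoprime {c d : ℤ} (hc : 0 < c) (h : IsCoprime d (24 * c)) :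
    ∃ g : Mp1Z, g.mat 1 0 = c ∧ g.mat 1 1 = d ∧ 24 ∣ g.mat 0 1 := by
  obtain ⟨a, b, hab⟩ := h
  obtain ⟨g, hg⟩ := exists_mp1Z_of_pos
    ⟨!![a, -(24 * b); c, d], by rw [Matrix.det_fin_two]; simp; linarith⟩ (by simpa using hc)
  refine ⟨g, ?_, ?_, ?_⟩ <;> rw [hg]
  · simp
  · simp
  · exact ⟨-b, by simp⟩

/-- If the coefficients with index in `Mℤ + β` of the values of `φ` at all nontrivial `ℓ`-torsion
points vanish, then so do those with index in `d⁻²(Mℤ + β)`. -/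
theorem coeff_torsion_eq_zero {w m : ℤ} {N M ℓ : ℕ} {χ : Mp1Z → ℂ} {φ : ℍ → ℂ → ℂ} {κ α : ℂ}
    {β : ℚ} (hφ : IsWeaklyHolomorphicJacobiForm w m (Gamma0Tilde N) χ φ)
    (hsym : HasJacobiSymmetries φ m κ α) (hχ : IsTwistInvariant χ M N) (hM : 0 < M) (hN : 0 < N)
    (hℓ : ℓ.Prime) {a : ℤ → ℚ → ℂ}
    (hexp : ∀ j : ℤ, ¬(ℓ : ℤ) ∣ j → ∀ τ : ℍ, HasSum (fun n : ℚ => a j n * e (n * τ)) (φ τ (j / ℓ)))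
    (ha : ∀ j n, a j n ≠ 0 → ∃ k : ℤ, 24 * n = k)
    (hzero : ∀ j : ℤ, ¬(ℓ : ℤ) ∣ j → ∀ n ∈ arithProg M β, a j n = 0)
    {d : ℤ} (hd : IsCoprime d (24 * (96 * M ^ 2 * N * ℓ ^ 2))) (hd12 : d % 12 = 1)
    {i : ℤ} (hi : ¬(ℓ : ℤ) ∣ i) {n : ℚ} (hn : (d : ℚ) ^ 2 * n ∈ arithProg M β) : a i n = 0 := by
  classical
  have hℓZ : Prime (ℓ : ℤ) := Nat.prime_iff_prime_int.1 hℓ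
  have hℓ0 : (ℓ : ℂ) ≠ 0 := by exact_mod_cast hℓ.ne_zero
  have hMZ : (0 : ℤ) < M := by exact_mod_cast hM
  have hNZ : (0 : ℤ) < N := by exact_mod_cast hN
  have hℓZ0 : (0 : ℤ) < ℓ := by exact_mod_cast hℓ.pos
  obtain ⟨g, hg10, hg11, hg01⟩ := exists_mp1Z_of_isCoprime
    (c := 96 * M ^ 2 * N * ℓ ^ 2) (by positivity) hd
  have hdℓ : IsCoprime d ℓ :=
    hd.of_isCoprime_of_dvd_right ⟨24 * (96 * M ^ 2 * N * ℓ), by ring⟩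
  have hgN : g ∈ Gamma0Tilde N :=
    mem_Gamma0Tilde.2 (by rw [hg10]; exact ⟨96 * M ^ 2 * ℓ ^ 2, by ring⟩)
  have hgℓ : (ℓ ^ 2 : ℤ) ∣ g.mat 1 0 := by rw [hg10]; exact ⟨96 * M ^ 2 * N, by ring⟩
  have hmul : ∀ {d' j : ℤ}, IsCoprime d' ℓ → ¬(ℓ : ℤ) ∣ j → ¬(ℓ : ℤ) ∣ d' * j := fun h1 h2 h3 =>
    h2 (h1.symm.dvd_of_dvd_mul_left h3)
  by_cases hχg : χ g = 0
  · -- In this case the value of `φ` at `i/ℓ` vanishes identically.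
    have h0 : ∀ τ : ℍ, φ τ (i / ℓ) = 0 := fun τ => by
      have := hφ.smul_torsion hℓ.ne_zero hgN hgℓ (j := i) (by rw [hg11]; exact hmul hdℓ hi)
        (g.mat⁻¹ • τ)
      rwa [smul_inv_smul, hχg, mul_zero, zero_mul] at this
    have := coeff_eq_zero_of_hasSum_zero (b := a i) (τ₀ := (UpperHalfPlane.I : ℍ)) fun x => by
      have := hexp i hi (x +ᵥ UpperHalfPlane.I)
      rw [h0] at this
      simpa only [coe_vadd] using this
    exact congrFun this n
  obtain ⟨j, hj⟩ : ∃ j : ℤ, (ℓ : ℤ) ∣ d * j - i := by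
    obtain ⟨u, v, huv⟩ := hdℓ
    exact ⟨u * i, -(v * i), by linear_combination i * huv⟩
  have hjℓ : ¬(ℓ : ℤ) ∣ j := fun h => hi ((dvd_sub_right (h.mul_left d)).1 hj)
  -- A common denominator of `β` and of all indices that occur.
  set Q : ℕ := 24 * β.den with hQ
  have hβ : ∃ k : ℤ, (Q : ℚ) * β = k := ⟨24 * β.num, by
    rw [hQ]; push_cast; rw [mul_assoc, Rat.den_mul_eq_num]⟩
  have hQ24 : 24 ∣ Q := Dvd.intro _ rfl
  have hshift : ∀ (k : ℤ) (τ : ℍ), φ ((k / M : ℝ) +ᵥ g.mat • τ) (j / ℓ) =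
      g.root τ ^ w * χ g * φ ((d ^ 2 * k / M : ℝ) +ᵥ τ) (i / ℓ) := by
    intro k τ
    obtain ⟨h, h10, h11, hh⟩ := exists_twist (g := g) hM (c₁ := 96 * N * ℓ ^ 2)
      (by rw [hg10]; ring) k
    have hχh : χ h = χ g := hχ g h k (by rw [hg10]; exact ⟨N * ℓ ^ 2, by ring⟩) hg01
      (by rw [hg11, hd12])
      (by rw [h11]; exact ⟨-(M * (96 * ℓ ^ 2) * g.mat 1 1 ^ 2 * k), by ring⟩) hh
    have hdk : IsCoprime (h.mat 1 1) ℓ := by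
      rw [h11, hg11]
      have : d - M * (96 * N * ℓ ^ 2) * d ^ 2 * k = d + ℓ * (-(M * (96 * N * ℓ) * d ^ 2 * k)) := by
        ring
      rw [this]
      exact hdℓ.add_mul_left_left _
    have h1 := hφ.smul_torsion hℓ.ne_zero (g := h) (mem_Gamma0Tilde.2 (h10 ▸ mem_Gamma0Tilde.1 hgN))
      (h10 ▸ hgℓ) (j := j) (hmul hdk hjℓ) (((g.mat 1 1 : ℤ) ^ 2 * k / M : ℝ) +ᵥ τ)
    rw [(hh τ).1, (hh τ).2, hχh, hg11] at h1
    rw [h1]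
    congr 1
    obtain ⟨r, hr⟩ := hj
    have h2 : ((h.mat 1 1 * j : ℤ) : ℂ) / ℓ =
        i / ℓ + (r - M * (96 * N * ℓ) * d ^ 2 * k * j : ℤ) := by
      have h3 : h.mat 1 1 * j = i + ℓ * (r - M * (96 * N * ℓ) * d ^ 2 * k * j) := by
        rw [h11, hg11]; linear_combination hr
      rw [h3]
      push_cast
      field_simp
    rw [h2]
    refine hsym.add_int ?_ _
    have him : ((i : ℂ) / ℓ).im = 0 := by
      have : (i : ℂ) / ℓ = ((i / ℓ : ℝ) : ℂ) := by push_cast; ring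
      rw [this, Complex.ofReal_im]
    refine notMem_latticePoints_of_e_ne_one
      (by rw [him, abs_zero]; exact UpperHalfPlane.im_pos _) ?_
    exact (isPrimitiveRoot_e_div hℓ hi).ne_one hℓ.one_lt
  have hsum : ∀ τ : ℍ, ∑ k ∈ Finset.range (M * Q), e (-(k * (β / M))) *
      φ (((d ^ 2 : ℤ) * k / M : ℝ) +ᵥ τ) (i / ℓ) = 0 := by
    intro τ
    have h1 := hasSum_projection (hexp j hjℓ) (ha j) hM hβ hQ24 1 (g.mat • τ)
    have h2 : ∀ n : ℚ, (if ((1 : ℤ) : ℚ) * n ∈ arithProg M β then ((M * Q : ℕ) : ℂ) else 0) *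
        a j n * e (n * (g.mat • τ : ℍ)) = 0 := fun n => by
      split_ifs with h
      · rw [hzero j hjℓ n (by simpa using h)]
        simp
      · simp
    simp_rw [h2] at h1
    have h3 := h1.unique hasSum_zero
    have h4 : ∑ k ∈ Finset.range (M * Q), e (-(k * (β / M))) *
        φ (((1 : ℤ) * k / M : ℝ) +ᵥ g.mat • τ) (j / ℓ) = g.root τ ^ w * χ g *
        ∑ k ∈ Finset.range (M * Q), e (-(k * (β / M))) *
          φ (((d ^ 2 : ℤ) * k / M : ℝ) +ᵥ τ) (i / ℓ) := by
      rw [Finset.mul_sum]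
      refine Finset.sum_congr rfl fun k _ => ?_
      have := hshift k τ
      push_cast at this ⊢
      rw [one_mul, this]
      ring
    rw [h4] at h3
    exact (mul_eq_zero.1 h3).resolve_left
      (mul_ne_zero (zpow_ne_zero _ (g.root_ne_zero τ)) hχg)
  have hcoef := coeff_eq_zero_of_hasSum_zero (τ₀ := (UpperHalfPlane.I : ℍ))
    (b := fun n => (if ((d ^ 2 : ℤ) : ℚ) * n ∈ arithProg M β then ((M * Q : ℕ) : ℂ) else 0) * a i n)
    fun x => by
      have := hasSum_projection (hexp i hi) (ha i) hM hβ hQ24 (d ^ 2) (x +ᵥ UpperHalfPlane.I)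
      rw [hsum] at this
      simpa only [coe_vadd] using this
  have h5 := congrFun hcoef n
  simp only [Pi.zero_apply] at h5
  rw [if_pos (by exact_mod_cast hn)] at h5
  refine (mul_eq_zero.1 h5).resolve_left ?_
  have : 0 < M * Q := Nat.mul_pos hM (by rw [hQ]; have := β.den_pos; omega)
  exact_mod_cast this.ne'

/-! ### Squares in arithmetic progressions -/

/-- The factorization of a nonzero rational number into a power of `p` and a unit at `p`. -/
theorem exists_eq_zpow_mul_div {p : ℕ} (hp : p.Prime) {β : ℚ} (hβ : β ≠ 0) :
    ∃ u q : ℤ, ¬(p : ℤ) ∣ u ∧ ¬(p : ℤ) ∣ q ∧ β = (p : ℚ) ^ padicValRat p β * (u / q) := by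
  have := Fact.mk hp
  have hp0 : (p : ℚ) ≠ 0 := by exact_mod_cast hp.ne_zero
  set v := padicValRat p β
  set γ : ℚ := (p : ℚ) ^ (-v) * β with hγ
  have hγ0 : γ ≠ 0 := mul_ne_zero (zpow_ne_zero _ hp0) hβ
  have hval : padicValRat p γ = 0 := by
    rw [hγ, padicValRat.mul (zpow_ne_zero _ hp0) hβ, padicValRat.zpow, padicValRat.self hp.one_lt]
    ring
  have hcop : Nat.Coprime γ.num.natAbs γ.den := γ.reduced
  rw [padicValRat, sub_eq_zero, padicValInt, Nat.cast_inj] at hval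
  have hiff : p ∣ γ.num.natAbs ↔ p ∣ γ.den := by
    rw [dvd_iff_padicValNat_ne_zero (by simpa using hγ0),
      dvd_iff_padicValNat_ne_zero γ.den_nz, hval]
  have hno : ¬p ∣ γ.den := fun h => hp.one_lt.ne' (Nat.dvd_one.1
    (hcop ▸ Nat.dvd_gcd (hiff.2 h) h))
  refine ⟨γ.num, γ.den, fun h => hno (hiff.1 (Int.natCast_dvd.1 h)), by exact_mod_cast hno, ?_⟩
  rw [Int.cast_natCast, Rat.num_div_den, hγ, ← mul_assoc, ← zpow_add₀ hp0]
  simp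

/-- If `M` is highly divisible by `p` in comparison to `β`, then multiplication by suitable squares
carries every element of `(M/p)ℤ + β` into `Mℤ + β`. -/
theorem exists_sq_mul_mem_arithProg {p M : ℕ} (hp : p.Prime) (hM : 0 < M) {β n : ℚ} (hβ : β ≠ 0)
    (hpM : p ∣ M) (hn : n ∈ arithProg (M / p) β)
    (hv : padicValRat p β + 2 + 2 * padicValNat p 2 ≤ padicValNat p M) {C : ℤ} (hC : C ≠ 0) :
    ∃ d : ℤ, IsCoprime d C ∧ d % 12 = 1 ∧ (d : ℚ) ^ 2 * n ∈ arithProg M β := by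
  have := Fact.mk hp
  have hpZ : Prime (p : ℤ) := Nat.prime_iff_prime_int.1 hp
  have hp0 : (p : ℚ) ≠ 0 := by exact_mod_cast hp.ne_zero
  obtain ⟨t, rfl⟩ := hn
  obtain ⟨u, q, hu, hq, hβ'⟩ := exists_eq_zpow_mul_div hp hβ
  set v := padicValRat p β
  have hq0 : (q : ℚ) ≠ 0 := by
    rintro h0
    exact hq (by rw [Int.cast_eq_zero.1 h0]; exact dvd_zero _)
  -- `M = p^μ M₀` and `2 = p^δ h` with `M₀` and `h` prime to `p`.
  obtain ⟨M₀, hM₀⟩ : p ^ padicValNat p M ∣ M := pow_padicValNat_dvd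
  obtain ⟨h, hh⟩ : p ^ padicValNat p 2 ∣ 2 := pow_padicValNat_dvd
  have hhp : ¬p ∣ h := fun ⟨r, hr⟩ => pow_succ_padicValNat_not_dvd (p := p) two_ne_zero
    ⟨r, by rw [pow_succ, mul_assoc, ← hr, ← hh]⟩
  set δ := padicValNat p 2 with hδ
  set μ := padicValNat p M
  have hμ : 1 ≤ μ := one_le_padicValNat_of_dvd hM.ne' hpM
  obtain ⟨k, hk, hkδ⟩ : ∃ k : ℕ, (μ : ℤ) - 1 = v + δ + k ∧ δ + 1 ≤ k :=
    ⟨((μ : ℤ) - 1 - v - δ).toNat, by omega, by omega⟩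
  obtain ⟨k', rfl⟩ : ∃ k', k = δ + 1 + k' := ⟨k - (δ + 1), by omega⟩
  set k := δ + 1 + k' with hkdef
  have hMp : ((M / p : ℕ) : ℚ) = (p : ℚ) ^ v * p ^ (δ + k) * M₀ := by
    have h1 : M / p = p ^ (μ - 1) * M₀ := by
      refine Nat.div_eq_of_eq_mul_left hp.pos ?_
      rw [hM₀]
      obtain ⟨r, hr⟩ := Nat.exists_eq_add_of_le hμ
      rw [hr, add_tsub_cancel_left]
      ring
    have h2 : (p : ℚ) ^ (μ - 1) = (p : ℚ) ^ v * p ^ (δ + k) := by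
      rw [← zpow_natCast, ← zpow_natCast, ← zpow_add₀ hp0]
      congr 1
      push_cast [Nat.cast_sub hμ]
      omega
    rw [h1, ← h2]
    push_cast
    rfl
  have hMM : (M : ℚ) = p * ((p : ℚ) ^ v * p ^ (δ + k) * M₀) := by
    rw [← hMp, ← Nat.cast_mul, Nat.mul_div_cancel' hpM]
  -- The part `W'` of `12C` prime to `p` takes care of the conditions away from `p`.
  obtain ⟨r, W', hW', hCW⟩ := Nat.exists_eq_pow_mul_and_not_dvd
    (n := 12 * C.natAbs) (by simpa using hC) p hp.one_lt.ne'
  have h12 : (12 : ℤ) ∣ p ^ k * W' := by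
    have h3 : 3 ∣ p ^ k * W' := by
      by_cases h3 : p = 3
      · subst h3
        exact (dvd_pow_self 3 (by omega)).mul_right _
      · have : 3 ∣ p ^ r * W' := hCW ▸ ⟨4 * C.natAbs, by ring⟩
        have hc := (Nat.coprime_primes Nat.prime_three hp).2 (Ne.symm h3)
        exact ((hc.pow_right r).dvd_of_dvd_mul_left this).mul_left _
    have h4 : 4 ∣ p ^ k * W' := by
      by_cases h2 : p = 2
      · subst h2
        have hδ1 : δ = 1 := by rw [hδ]; exact padicValNat.self (by norm_num)
        refine Dvd.dvd.mul_right ?_ _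
        exact pow_dvd_pow 2 (show 2 ≤ k by omega)
      · have : 4 ∣ p ^ r * W' := hCW ▸ ⟨3 * C.natAbs, by ring⟩
        have hc : Nat.Coprime 4 p := by
          have := (Nat.coprime_primes Nat.prime_two hp).2 (Ne.symm h2)
          exact Nat.Coprime.pow_left 2 this
        exact ((hc.pow_right r).dvd_of_dvd_mul_left this).mul_left _
    have : 3 * 4 ∣ p ^ k * W' := Nat.Coprime.mul_dvd_of_dvd_of_dvd (by norm_num) h3 h4
    exact_mod_cast this
  -- The numerator of `n = (M/p)t + β`, up to a power of `p`.
  set u' : ℤ := u + q * (p ^ (δ + k) * M₀ * t) with hu'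
  have hu'p : ¬(p : ℤ) ∣ u' := by
    have : (p : ℤ) ∣ q * (p ^ (δ + k) * M₀ * t) :=
      Dvd.dvd.mul_left (Dvd.dvd.mul_right (Dvd.dvd.mul_right (dvd_pow_self _ (by omega)) _) _) _
    rwa [hu', dvd_add_left this]
  -- Solve `s W' h u' + t ≡ 0` modulo `p`.
  obtain ⟨s, y, hs⟩ : ∃ s y : ℤ, s * W' * h * u' + t = p * y := by
    have hnd : ¬(p : ℤ) ∣ W' * h * u' := by
      rw [hpZ.dvd_mul, hpZ.dvd_mul, Int.natCast_dvd_natCast, Int.natCast_dvd_natCast]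
      tauto
    obtain ⟨a, b, hab⟩ := ((Prime.coprime_iff_not_dvd hpZ).2 hnd)
    exact ⟨-t * b, t * a, by linear_combination -t * hab⟩
  have hhZ : (2 : ℚ) = p ^ δ * h := by exact_mod_cast hh
  -- For this `d`, the number `(d² - 1)n` is a multiple of `M/p`, and `s` is chosen so that it
  -- cancels `(M/p)t` modulo `M`.
  refine ⟨1 + s * p ^ k * (q * M₀ * W'), ?_, ?_, ?_⟩
  · have h1 : IsCoprime (1 + s * p ^ k * (q * M₀ * W') : ℤ) ((p : ℤ) ^ r * W') := by
      refine IsCoprime.mul_right (IsCoprime.pow_right ?_) ?_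
      · refine ⟨1, -(s * p ^ (k - 1) * (q * M₀ * W')), ?_⟩
        have : (p : ℤ) ^ k = p ^ (k - 1) * p := by
          rw [← pow_succ]; congr 1; omega
        rw [this]; ring
      · exact ⟨1, -(s * p ^ k * (q * M₀)), by ring⟩
    have h2 : C ∣ (p : ℤ) ^ r * W' := by
      have : ((p : ℤ) ^ r * W') = 12 * |C| := by
        rw [Int.abs_eq_natAbs]; exact_mod_cast hCW.symm
      rw [this]
      exact ((dvd_abs C C).2 dvd_rfl).mul_left 12
    exact h1.of_isCoprime_of_dvd_right h2
  · obtain ⟨z, hz⟩ := h12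
    have : (1 + s * p ^ k * (q * M₀ * W') : ℤ) = 1 + 12 * (s * q * M₀ * z) := by
      linear_combination s * q * M₀ * hz
    rw [this]
    omega
  · refine ⟨y + s * W' * (s * p ^ k' * (q * M₀ * W')) * u', ?_⟩
    have hs' : (s : ℚ) * W' * h * u' + t = p * y := by exact_mod_cast hs
    have hn' : ((M / p : ℕ) : ℚ) * t + β = (p : ℚ) ^ v * (u' / q) := by
      rw [hMp]
      nth_rewrite 1 [hβ']
      rw [hu']
      push_cast
      field_simp
      ring
    have hexpand : ((1 + s * p ^ k * (q * M₀ * W') : ℤ) : ℚ) ^ 2 * ((M / p : ℕ) * t + β) =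
        ((s : ℚ) * p ^ k * (q * M₀ * W')) * (2 + s * p ^ k * (q * M₀ * W')) *
          ((M / p : ℕ) * t + β) + (M / p : ℕ) * t + β := by
      push_cast
      ring
    rw [hexpand, hn', hMM, hMp]
    have hpk : (p : ℚ) ^ k = p ^ δ * p * p ^ k' := by
      rw [hkdef, pow_add, pow_succ]
    have h2x : (2 : ℚ) + s * p ^ k * (q * M₀ * W') =
        p ^ δ * (h + p * (s * p ^ k' * (q * M₀ * W'))) := by
      rw [hpk]
      linear_combination hhZ
    rw [h2x, pow_add]
    push_cast
    field_simp
    linear_combination (p : ℚ) ^ v * p ^ δ * p ^ k * M₀ * hs'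

/-! ### Enlarging an explained congruence -/

theorem IsAdmissibleJacobiForm.exists_symmetries {φ : ℍ → ℂ → ℂ} (h : IsAdmissibleJacobiForm φ)
    (hne : ∃ (τ : ℍ) (z : ℂ), z ∉ latticePoints τ ∧ φ τ z ≠ 0) {M : ℕ} (hM : 0 < M) :
    ∃ (w m : ℤ) (N : ℕ) (χ : Mp1Z → ℂ) (κ α : ℂ), 0 < N ∧
      IsWeaklyHolomorphicJacobiForm w m (Gamma0Tilde N) χ φ ∧ HasJacobiSymmetries φ m κ α ∧
      IsTwistInvariant χ M N := by
  obtain ⟨w, m, N, χ, hN, ⟨-, h⟩ | h⟩ := h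
  · obtain ⟨m', κ, α, rfl, hs⟩ := h.hasJacobiSymmetries hne (by
      simpa only [dirichletChar_translation, one_mul] using thetaChar_translation_pow)
    exact ⟨w, m', N, _, κ, α, hN, h, hs, isTwistInvariant_theta hM χ⟩
  · obtain ⟨m', κ, α, rfl, hs⟩ := h.hasJacobiSymmetries hne (by
      simpa only [dirichletChar_translation, one_mul] using etaChar_translation_pow)
    exact ⟨w, m', N, _, κ, α, hN, h, hs, isTwistInvariant_eta hM χ⟩

/-- The values of `φ` at torsion points control its divisibility by a cyclotomic polynomial; as the
progressions on which they vanish can be multiplied by squares, explained congruences propagate. -/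
theorem mem_explainableProgressions_of_forall_sq {f : ℍ → ℂ} {ℓ M M' : ℕ} (hℓ : ℓ.Prime)
    (hM : 0 < M) (hM' : 0 < M') {β : ℚ} (hmem : arithProg M β ∈ explainableProgressions f ℓ)
    (hsq : ∀ n ∈ arithProg M' β, ∀ C : ℤ, C ≠ 0 →
      ∃ d : ℤ, IsCoprime d C ∧ d % 12 = 1 ∧ (d : ℚ) ^ 2 * n ∈ arithProg M β) :
    arithProg M' β ∈ explainableProgressions f ℓ := by
  obtain ⟨M₁, β₁, -, hA, -, φ, hadm, ν, c, hspec, ⟨⟨n₀, hn₀⟩, ε₀, hε₀, hexp₀⟩,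
    hint, hdvd⟩ := hmem
  rw [← hA] at hdvd
  obtain ⟨w, m, N, χ, κ, α, hN, hφ, hsym, hχ⟩ := hadm.exists_symmetries hspec.exists_ne_zero hM
  obtain ⟨b, hb⟩ := exists_binomial_series ν
  set ε := min ε₀ (1 / 2)
  have hε : 0 < ε := lt_min hε₀ (by norm_num)
  have hε1 : ε ≤ 1 / 2 := min_le_right _ _
  have hc : ExpandsOn φ c ε := fun τ z h0 h1 => hexp₀ τ z h0
    (h1.trans_le (mul_le_mul_of_nonneg_right (min_le_left _ _) τ.im_pos.le))
  have hfin : ∀ n, (Function.support (regCoeff b c n)).Finite :=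
    hc.finite_support_regCoeff hsym hε hε1 hspec hb hn₀
  have hlead : ∀ (n : ℚ) (z : ℂ), 0 < z.im →
      leadingCoeff c ν n z = e (-(ν * (z / 2))) * ∑' t : ℤ, regCoeff b c n t * e (t * z) :=
    fun n z hz => hc.leadingCoeff_eq hsym hε hε1 hb n hz
  have hcoeff : ∀ n z, regSlice b c n z ≠ 0 → ∃ k : ℤ, 24 * n = k := fun n z hne => by
    by_contra hk
    refine hne ?_
    have : ∀ t, regCoeff b c n t = 0 := fun t => by
      by_contra ht
      obtain ⟨k, hk'⟩ := exists_of_regCoeff_ne_zero ht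
      exact hk (hc.exponents hsym hε hε1 hk').2
    simp [regSlice, this]
  have hreal : ∀ j : ℤ, (((j / ℓ : ℝ) : ℝ) : ℂ) = j / ℓ := fun j => by push_cast; rfl
  have hvanish : ∀ n ∈ arithProg M' β, ∀ i : ℤ, ¬(ℓ : ℤ) ∣ i → regSlice b c n (i / ℓ) = 0 := by
    intro n hn i hi
    have hne : ∀ j : ℤ, ¬(ℓ : ℤ) ∣ j → e (j / ℓ) ≠ 1 := fun j hj =>
      (isPrimitiveRoot_e_div hℓ hj).ne_one hℓ.one_lt
    have hM0 : (M : ℤ) ≠ 0 := by exact_mod_cast hM.ne'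
    have hN0 : (N : ℤ) ≠ 0 := by exact_mod_cast hN.ne'
    have hℓ0 : (ℓ : ℤ) ≠ 0 := by exact_mod_cast hℓ.ne_zero
    obtain ⟨d, hd, hd12, hdn⟩ := hsq n hn (24 * (96 * M ^ 2 * N * ℓ ^ 2)) (by positivity)
    have := coeff_torsion_eq_zero hφ hsym hχ hM hN hℓ
      (a := fun j n => (e (j / ℓ) - 1) ^ (-ν) * regSlice b c n (j / ℓ)) ?_ ?_ ?_ hd hd12 hi hdn
    · exact (mul_eq_zero.1 this).resolve_left (zpow_ne_zero _ (sub_ne_zero.2 (hne i hi)))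
    · intro j hj τ
      have h1 := (hc.hasSum_regSlice hsym hε hε1 hspec hb τ (j / ℓ : ℝ)).mul_left
        ((e (j / ℓ) - 1) ^ (-ν))
      rw [hreal, regularized, if_neg (hne j hj), ← mul_assoc, ← zpow_add₀
        (sub_ne_zero.2 (hne j hj)), neg_add_cancel, zpow_zero, one_mul] at h1
      exact h1.congr_fun fun n => mul_assoc _ _ _
    · exact fun j n h => hcoeff n _ (right_ne_zero_of_mul h)
    · intro j hj n hn
      exact mul_eq_zero_of_right _
        (trigSum_eq_zero_of_cyclotomicDvd hℓ (hfin n) (hlead n) (hdvd n hn) hj)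
  refine ⟨M', β, hM', rfl, ⟨fun n => regSlice b c n 0, ⟨?_, fun τ => ?_⟩, fun n hn => ?_⟩, φ, hadm,
    ν, c, hspec, ⟨⟨n₀, hn₀⟩, ε₀, hε₀, hexp₀⟩, hint, fun n hn => ?_⟩
  · refine ⟨n₀, fun n hn => ?_⟩
    simp [regSlice, regCoeff, convCoeff, hn₀ n hn]
  · have := hc.hasSum_regSlice hsym hε hε1 hspec hb τ 0
    rw [Complex.ofReal_zero, regularized, if_pos e_zero] at this
    exact this
  · obtain ⟨K, -, hK⟩ := hint
    exact exists_ellIntegral_of_trigSum_eq_zero hℓ (hfin n)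
      (hc.isEllIntegral_regCoeff hℓ hsym hε hε1 hn₀ (fun n r => (hK n r).2) n)
      (fun j hj => hvanish n hn j hj)
  · exact cyclotomicDvd_of_trigSum_eq_zero hℓ (hfin n) (hlead n) fun j hj => hvanish n hn j hj

theorem not_maximal_of_padicValRat_add_le {f : ℍ → ℂ} {ℓ M p : ℕ} (hℓ : ℓ.Prime) (hp : p.Prime)
    (hM : 0 < M) {β : ℚ} (hβ : β ≠ 0) (hpM : p ∣ M)
    (hv : padicValRat p β + 2 + 2 * padicValNat p 2 ≤ padicValNat p M) :
    ¬Maximal (fun A : Set ℚ => A ∈ explainableProgressions f ℓ) (arithProg M β) := by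
  intro hmax
  have hM' : 0 < M / p := Nat.div_pos (Nat.le_of_dvd hM hpM) hp.pos
  have hsub : arithProg M β ≤ arithProg (M / p) β := by
    rintro _ ⟨t, rfl⟩
    refine ⟨p * t, ?_⟩
    have : (M : ℚ) = ((M / p : ℕ) : ℚ) * p := by exact_mod_cast (Nat.div_mul_cancel hpM).symm
    rw [this]
    push_cast
    ring
  have hle := hmax.2 (mem_explainableProgressions_of_forall_sq hℓ hM hM' hmax.1
    fun n hn C hC => exists_sq_mul_mem_arithProg hp hM hβ hpM hn hv hC) hsub
  have h2 : M = M / p * p := (Nat.div_mul_cancel hpM).symm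
  generalize M / p = q at h2 hM' hle
  obtain ⟨t, ht⟩ := hle (show (q : ℚ) * (1 : ℤ) + β ∈ arithProg q β from ⟨1, rfl⟩)
  have h1 : (q : ℤ) * 1 = q * (p * t) := by
    have := add_right_cancel ht
    rw [h2] at this
    push_cast at this
    rw [← mul_assoc]
    exact_mod_cast this
  have h3 := mul_left_cancel₀ (by exact_mod_cast hM'.ne') h1
  exact hp.one_lt.ne' (by exact_mod_cast Int.eq_one_of_dvd_one (by positivity) ⟨t, h3⟩)

theorem ordAt_le_of_maximal {f : ℍ → ℂ} {ℓ M p : ℕ} (hℓ : ℓ.Prime) (hp : p.Prime) (hM : 0 < M)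
    {β : ℚ} (hmax : Maximal (fun A : Set ℚ => A ∈ explainableProgressions f ℓ) (arithProg M β)) :
    ordAt p M ≤ max 0 (ordAt p β + ((1 + 2 * padicValNat p 2 : ℕ) : ℤ)) := by
  by_cases hβ : β = 0
  · simp [ordAt, hβ]
  have := Fact.mk hp
  have hM0 : (M : ℚ) ≠ 0 := by exact_mod_cast hM.ne'
  rw [ordAt, ordAt, if_neg hβ, if_neg hM0, padicValRat.of_nat]
  by_contra hlt
  rw [not_le, max_lt_iff] at hlt
  have h1 : (0 : ℤ) < padicValNat p M := by exact_mod_cast hlt.1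
  have h2 : padicValRat p β + ((1 + 2 * padicValNat p 2 : ℕ) : ℤ) < padicValNat p M := by
    exact_mod_cast hlt.2
  refine not_maximal_of_padicValRat_add_le hℓ hp hM hβ
    (dvd_of_one_le_padicValNat (by omega)) ?_ hmax
  omega

end ExplainableRC

theorem mainTheorem2 {w : ℤ} {Γ : Subgroup Mp1Z} (hΓ : Γ.FiniteIndex) {χ : Γ →* ℂˣ} {f : ℍ → ℂ}
    (hf : IsWeaklyHolomorphicModularForm w Γ χ f) {ℓ : ℕ} (hℓ : ℓ.Prime)
    {M : ℕ} (hM : 0 < M) {β : ℚ}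
    (hmax : Maximal (fun A : Set ℚ => A ∈ explainableProgressions f ℓ) (arithProg M β)) :
    (∀ p : ℕ, p.Prime → p ≠ 2 → ordAt p M ≤ max 0 (ordAt p β + 1)) ∧
      ordAt 2 M ≤ max 0 (ordAt 2 β + 3) := by
  refine ⟨fun p hp hp2 => ?_, ?_⟩
  · have h := ordAt_le_of_maximal hℓ hp hM hmax
    have h0 : padicValNat p 2 = 0 := padicValNat.eq_zero_of_not_dvd fun hdvd =>
      hp2 ((Nat.prime_dvd_prime_iff_eq hp Nat.prime_two).1 hdvd)
    simpa [h0] using h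
  · have h := ordAt_le_of_maximal hℓ Nat.prime_two hM hmax
    have h1 : padicValNat 2 2 = 1 := padicValNat.self (by norm_num)
    rw [h1] at h
    exact h
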